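/- Let $q$ be a complex number with $0<|q|<1$. Write $(a;q)_n=\prod_{k=0}^{n-1}(1-aq^k)$ and $(a;q)_\infty=\prod_{k\ge 0}(1-aq^k)$, and for integers $m\ge 1$ and $a$ put $$J_m=(q^m;q^m)_\infty,\qquad J_{a,m}=(q^a;q^m)_\infty\,(q^{m-a};q^m)_\infty\,(q^m;q^m)_\infty .$$ Then the following three triple series converge absolutely and $$\sum_{i,j,k\geq 0} \frac{q^{2i^2+2j^2+2k^2-2ij-2ik-2i+2j}}{(q^2;q^2)_i(q^2;q^2)_j(q^2;q^2)_k}=4 \frac{J_4^{6}J_{28}^{3}}{J_2^{6}J_{4,28}J_{6,28}J_{8,28}}-\frac{1}{2}\frac{J_{1}^{5}J_{7}J_{1,14}J_{3,14}}{J_{2}^{5}J_{2,14}J_{6,14}J_{14}}-\frac{1}{2}\frac{J_{2}^{11}J_{5,14}J_{4,28}}{J_1^{6}J_{4}^{6}J_{28}},$$ $$\sum_{i,j,k\geq 0} \frac{q^{2i^2+2j^2+2k^2-2ij-2ik}}{(q^2;q^2)_i(q^2;q^2)_j(q^2;q^2)_k}=\frac{1}{2}\frac{J_{2}^{11}J_{1,14}J_{12,28}}{J_1^{6}J_{4}^{6}J_{28}}+\frac{1}{2}\frac{J_{1}^{5}J_{7}J_{3,14}J_{5,14}}{J_{2}^{5}J_{4,14}J_{6,14}J_{14}}-4q^2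 \frac{J_4^{6}J_{28}^{3}}{J_2^{6}J_{4,28}J_{10,28}J_{12,28}},$$ $$\sum_{i,j,k\geq 0} \frac{q^{2i^2+2j^2+2k^2-2ij-2ik-2i+2j+2k}}{(q^2;q^2)_i(q^2;q^2)_j(q^2;q^2)_k}=\frac{1}{2q}\frac{J_{2}^{11}J_{14}J_{3,28}J_{11,28}}{J_1^{6}J_{4}^{5}J_{28}J_{4,28}J_{12,28}}-\frac{1}{2q}\frac{J_{1}^{5}J_{7}J_{1,14}J_{5,14}}{J_{2}^{5}J_{2,14}J_{4,14}J_{14}}-4\frac{J_4^{6}J_{28}^{3}}{J_2^{6}J_{2,28}J_{8,28}J_{12,28}}.$$ -/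

import Mathlib

namespace NahmA3

/-- The finite `q`-shifted factorial `(a; q)_n = ∏_{0 ≤ k < n} (1 - a q^k)`. -/
noncomputable def qPoch (a q : ℂ) (n : ℕ) : ℂ :=
  ∏ k ∈ Finset.range n, (1 - a * q ^ k)

/-- The infinite `q`-shifted factorial `(a; q)_∞ = ∏_{k ≥ 0} (1 - a q^k)`. -/
noncomputable def qPochInf (a q : ℂ) : ℂ :=
  ∏' k : ℕ, (1 - a * q ^ k)

/-- The product defining `(a; q)_∞` converges for `|q| < 1`. -/
theorem multipliable_qPochInf (a : ℂ) {q : ℂ} (hq : ‖q‖ < 1) :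
    Multipliable fun k : ℕ => 1 - a * q ^ k := by
  have h : Summable fun k : ℕ => ‖-(a * q ^ k)‖ := by
    simpa [norm_mul, norm_pow] using
      (summable_geometric_of_lt_one (norm_nonneg q) hq).mul_left ‖a‖
  simpa [sub_eq_add_neg] using multipliable_one_add_of_summable h

/-- `J_m = (q^m; q^m)_∞`. -/
noncomputable def J (q : ℂ) (m : ℕ) : ℂ :=
  qPochInf (q ^ m) (q ^ m)

/-- `J_{a,m} = (q^a, q^{m-a}, q^m; q^m)_∞`. -/
noncomputable def J₂ (q : ℂ) (a : ℤ) (m : ℕ) : ℂ :=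
  qPochInf (q ^ a) (q ^ m) * qPochInf (q ^ ((m : ℤ) - a)) (q ^ m) * qPochInf (q ^ m) (q ^ m)

/-- The term of index `(i, j, k)` of the Nahm sum with linear part `b₁ i + b₂ j + b₃ k`:
`q^{2i²+2j²+2k²-2ij-2ik + b₁i+b₂j+b₃k} / ((q²;q²)_i (q²;q²)_j (q²;q²)_k)`. -/
noncomputable def nahmTerm (q : ℂ) (b₁ b₂ b₃ : ℤ) (n : ℕ × ℕ × ℕ) : ℂ :=
  let i : ℤ := n.1
  let j : ℤ := n.2.1
  let k : ℤ := n.2.2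
  q ^ (2 * i ^ 2 + 2 * j ^ 2 + 2 * k ^ 2 - 2 * i * j - 2 * i * k
      + b₁ * i + b₂ * j + b₃ * k) /
    (qPoch (q ^ 2) (q ^ 2) n.1 * qPoch (q ^ 2) (q ^ 2) n.2.1 * qPoch (q ^ 2) (q ^ 2) n.2.2)

end NahmA3

/-!
Write `p = q²`, `(x) = (x; p)_∞` and `1 / (p; p)_k = 0` for `k < 0`. The three series are the cases
`(ε, y) = (1, 1), (0, 0), (0, 2)` of one series, with linear part
`(-ε - y) i + (y + ε) j + (y - ε) k`. The proof reduces it to six single series, each of which is a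
quintuple product.

*Reduction to theta functions.* Multiply the series by `(p)` and expand `(p) / (p; p)_i` by Euler's
formula. Since the expansion vanishes for `i < 0`, the index `i` then runs over all integers, and
one further summation is a finite `q`-binomial sum (`sum_invPoch_sq`). What is left
(`exists_hasSum_nahmTerm`) is a sum of `q^{A² + B² - εA + yB + s² - εs} / ((p; p)_s (p; p)_l)` with
`A + B = s + 2 l`. Expanding `(p) / (p; p)_l` in the same way frees `A` and `B`, up to the parity
condition on `A + B + s`, so that they sum to theta functions `∑ q^{n²} z^n` at integral powers of
`q`, up to sign, while `s` sums to a product; only the index `r` of the last expansion remains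
(`hasSum_singleTerm`). By quasi-periodicity of the theta function, the even and the odd values of
`r` give three single series, in `q`, in `-q` and in `q²` (`hasSum_nahmTerm_one_one` and the two
lemmas like it): this is the reason for the three products on the right-hand sides.

*Evaluation of the single series.* The terms of these series are products `c_n β_n`, where
`β_n` is `1 / (p; p)_{2n}` or `1 / (p; p)_{2n + 1}`, possibly times `p^n`, and where `c_n` belongs
to a limiting case of the `q`-Gauss sum (`hasSum_conjugate`). The `β_n` are members of Bailey pairs
whose `α_r` are signed powers of `q`, supported on one or two residue classes modulo `3`; the pairs
follow from one another by Pascal's recurrence and the symmetry of the `q`-binomial coefficients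
(`hasSum_evenTerm` and its companions).
Bailey's lemma (`hasSum_bailey`) turns each single series into a difference of two theta series with
exponents `21 j² + b j + c`, which the quintuple product identity (`hasSum_quintuple`), itself
deduced from two triple products, writes as a product of level `28`.

*Products.* It remains to compare products, which is done by splitting all of them into the
factors `(q^r; q^28)_∞`.
-/

namespace NahmA3

open Filter Topology

/-! ### The `q`-shifted factorials -/

theorem qPoch_succ (a q : ℂ) (n : ℕ) : qPoch a q (n + 1) = qPoch a q n * (1 - a * q ^ n) :=
  Finset.prod_range_succ _ _

theorem qPoch_add (a q : ℂ) (n m : ℕ) :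
    qPoch a q (n + m) = qPoch a q n * qPoch (a * q ^ n) q m := by
  simp [qPoch, Finset.prod_range_add, pow_add, mul_assoc]

theorem qPoch_succ_left (a q : ℂ) (n : ℕ) :
    qPoch a q (n + 1) = (1 - a) * qPoch (a * q) q n := by
  rw [add_comm, qPoch_add]
  simp [qPoch]

theorem qPoch_mul_eq_prod (a q : ℂ) (m n : ℕ) :
    qPoch a q (m * n) = ∏ i ∈ Finset.range m, qPoch (a * q ^ i) (q ^ m) n := by
  induction n with
  | zero => simp [qPoch]
  | succ n ih =>
    rw [Nat.mul_succ, qPoch_add, ih]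
    simp_rw [qPoch_succ]
    rw [Finset.prod_mul_distrib]
    congr 1
    refine Finset.prod_congr rfl fun i _ => ?_
    ring

theorem tendsto_qPoch (a : ℂ) {q : ℂ} (hq : ‖q‖ < 1) :
    Tendsto (qPoch a q) atTop (𝓝 (qPochInf a q)) :=
  (multipliable_qPochInf a hq).tendsto_prod_tprod_nat

theorem qPochInf_eq_mul (a : ℂ) {q : ℂ} (hq : ‖q‖ < 1) (n : ℕ) :
    qPochInf a q = qPoch a q n * qPochInf (a * q ^ n) q := by
  refine tendsto_nhds_unique ((tendsto_add_atTop_iff_nat n).2 (tendsto_qPoch a hq)) ?_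
  refine ((tendsto_qPoch (a * q ^ n) hq).const_mul (qPoch a q n)).congr fun m => ?_
  rw [add_comm, qPoch_add]

theorem qPochInf_eq_one_sub_mul (a : ℂ) {q : ℂ} (hq : ‖q‖ < 1) :
    qPochInf a q = (1 - a) * qPochInf (a * q) q := by
  rw [qPochInf_eq_mul a hq 1]
  simp [qPoch]

theorem qPochInf_eq_zero {a q : ℂ} (hq : ‖q‖ < 1) {k : ℕ} (h : a * q ^ k = 1) :
    qPochInf a q = 0 := by
  rw [qPochInf_eq_mul a hq (k + 1), qPoch_succ, h]
  ring

theorem qPochInf_ne_zero {a q : ℂ} (hq : ‖q‖ < 1) (h : ∀ k : ℕ, a * q ^ k ≠ 1) :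
    qPochInf a q ≠ 0 := by
  have := tprod_one_add_ne_zero_of_summable (f := fun k : ℕ => -(a * q ^ k))
    (fun k => by rw [← sub_eq_add_neg, sub_ne_zero]; exact (h k).symm) ?_
  · simpa [qPochInf, sub_eq_add_neg] using this
  · simpa [norm_mul, norm_pow] using
      (summable_geometric_of_lt_one (norm_nonneg q) hq).mul_left ‖a‖

theorem mul_pow_ne_one {a q : ℂ} (ha : ‖a‖ < 1) (hq : ‖q‖ < 1) (k : ℕ) : a * q ^ k ≠ 1 := by
  intro h
  have h1 : ‖a * q ^ k‖ = 1 := by rw [h, norm_one]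
  rw [norm_mul, norm_pow] at h1
  nlinarith [pow_le_one₀ (n := k) (norm_nonneg q) hq.le, norm_nonneg a,
    pow_nonneg (norm_nonneg q) k]

theorem qPochInf_ne_zero_of_norm_lt {a q : ℂ} (ha : ‖a‖ < 1) (hq : ‖q‖ < 1) :
    qPochInf a q ≠ 0 :=
  qPochInf_ne_zero hq (mul_pow_ne_one ha hq)

theorem qPoch_ne_zero {a q : ℂ} (ha : ‖a‖ < 1) (hq : ‖q‖ < 1) (n : ℕ) : qPoch a q n ≠ 0 :=
  Finset.prod_ne_zero_iff.2 fun k _ => sub_ne_zero.2 (mul_pow_ne_one ha hq k).symm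

/-- Splitting `(a; q)_∞` according to the residue of the index modulo `m`. -/
theorem qPochInf_eq_prod (a : ℂ) {q : ℂ} (hq : ‖q‖ < 1) {m : ℕ} (hm : 0 < m) :
    qPochInf a q = ∏ i ∈ Finset.range m, qPochInf (a * q ^ i) (q ^ m) := by
  have hqm : ‖q ^ m‖ < 1 := by
    rw [norm_pow]; exact pow_lt_one₀ (norm_nonneg q) hq hm.ne'
  refine tendsto_nhds_unique ((tendsto_qPoch a hq).comp
    (Filter.tendsto_id.const_mul_atTop' hm)) ?_
  refine (tendsto_finsetProd (Finset.range m) fun i _ =>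
    tendsto_qPoch (a * q ^ i) hqm).congr fun n => ?_
  simp [qPoch_mul_eq_prod]

theorem qPochInf_mul_neg (a : ℂ) {q : ℂ} (hq : ‖q‖ < 1) :
    qPochInf a q * qPochInf (-a) q = qPochInf (a ^ 2) (q ^ 2) := by
  unfold qPochInf
  rw [← (multipliable_qPochInf a hq).tprod_mul (multipliable_qPochInf (-a) hq)]
  refine tprod_congr fun k => ?_
  ring

/-! ### Reciprocals of `(q²; q²)_k` and Euler's expansion -/

theorem norm_sq_lt_one {q : ℂ} (hq : ‖q‖ < 1) : ‖q ^ 2‖ < 1 := by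
  rw [norm_pow]; exact pow_lt_one₀ (norm_nonneg q) hq two_ne_zero

/-- `1 / (q²; q²)_k` for integer `k`, equal to `0` for `k < 0`. All series of the argument are
written to the base `q²`, so that the exponents `k (k ± 1) / 2` of that base are integral powers
of `q`. -/
noncomputable def invPoch (q : ℂ) (k : ℤ) : ℂ :=
  if 0 ≤ k then (qPoch (q ^ 2) (q ^ 2) k.toNat)⁻¹ else 0

theorem invPoch_natCast (q : ℂ) (n : ℕ) : invPoch q n = (qPoch (q ^ 2) (q ^ 2) n)⁻¹ := by
  simp [invPoch]

theorem invPoch_of_neg (q : ℂ) {k : ℤ} (hk : k < 0) : invPoch q k = 0 :=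
  if_neg (not_le.2 hk)

@[simp] theorem invPoch_zero (q : ℂ) : invPoch q 0 = 1 := by simp [invPoch, qPoch]

theorem invPoch_sub_one {q : ℂ} (hq : ‖q‖ < 1) (k : ℤ) :
    invPoch q (k - 1) = (1 - q ^ (2 * k)) * invPoch q k := by
  rcases lt_trichotomy k 0 with hk | rfl | hk
  · rw [invPoch_of_neg q hk, invPoch_of_neg q (by omega), mul_zero]
  · rw [invPoch_of_neg q (by omega)]; simp
  · obtain ⟨n, rfl⟩ : ∃ n : ℕ, k = n + 1 := ⟨(k - 1).toNat, by omega⟩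
    have h := qPoch_ne_zero (norm_sq_lt_one hq) (norm_sq_lt_one hq) (n + 1)
    rw [add_sub_cancel_right, invPoch_natCast, ← Nat.cast_succ, invPoch_natCast]
    rw [qPoch_succ] at h ⊢
    have h1 : q ^ (2 * ((n + 1 : ℕ) : ℤ)) = q ^ 2 * (q ^ 2) ^ n := by
      rw [show 2 * ((n + 1 : ℕ) : ℤ) = ((2 * (n + 1) : ℕ) : ℤ) by push_cast; ring, zpow_natCast]
      ring
    rw [h1, mul_inv, mul_comm, mul_assoc, inv_mul_cancel₀ (right_ne_zero_of_mul h), mul_one]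

theorem exists_norm_invPoch_le {q : ℂ} (hq : ‖q‖ < 1) :
    ∃ C : ℝ, 0 < C ∧ ∀ k : ℤ, ‖invPoch q k‖ ≤ C := by
  have hq2 := norm_sq_lt_one hq
  have h := Metric.isBounded_range_of_tendsto _
    ((tendsto_qPoch (q ^ 2) hq2).inv₀ (qPochInf_ne_zero_of_norm_lt hq2 hq2))
  obtain ⟨C, hC⟩ := h.exists_norm_le
  refine ⟨max C 1, by positivity, fun k => ?_⟩
  unfold invPoch
  split_ifs
  · exact (hC _ ⟨_, rfl⟩).trans (le_max_left _ _)
  · simp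

/-- Euler's expansion `(z; q²)_∞ = ∑ (-z)^s q^{s² - s} / (q²; q²)_s`. -/
theorem hasSum_euler {q : ℂ} (hq0 : q ≠ 0) (hq : ‖q‖ < 1) (z : ℂ) :
    HasSum (fun s : ℕ => invPoch q s * q ^ ((s : ℤ) ^ 2 - s) * (-z) ^ s) (qPochInf z (q ^ 2)) := by
  have hq2 := norm_sq_lt_one hq
  -- Both sides satisfy `F(w) = (1 - w) F(q² w)` and tend to `1` as `w → 0`.
  set c : ℕ → ℂ := fun s => invPoch q s * q ^ ((s : ℤ) ^ 2 - s) * (-1) ^ s with hc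
  have hc0 : c 0 = 1 := by simp [hc]
  have hcs : ∀ s : ℕ, c (s + 1) * (1 - q ^ 2 * (q ^ 2) ^ s) = -((q ^ 2) ^ s * c s) := by
    intro s
    have h1 := invPoch_sub_one hq ((s : ℤ) + 1)
    rw [add_sub_cancel_right] at h1
    have h2 : q ^ (2 * ((s : ℤ) + 1)) = q ^ 2 * (q ^ 2) ^ s := by
      rw [show 2 * ((s : ℤ) + 1) = ((2 * (s + 1) : ℕ) : ℤ) by push_cast; ring, zpow_natCast]
      ring
    have h3 : q ^ (((s + 1 : ℕ) : ℤ) ^ 2 - ((s + 1 : ℕ) : ℤ))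
        = (q ^ 2) ^ s * q ^ ((s : ℤ) ^ 2 - s) := by
      rw [← pow_mul, ← zpow_natCast q (2 * s), ← zpow_add₀ hq0]
      congr 1; push_cast; ring
    simp only [hc]
    rw [h3, h1, h2]
    push_cast
    ring
  have hne : ∀ s : ℕ, (1 - q ^ 2 * (q ^ 2) ^ s) ≠ 0 := fun s =>
    sub_ne_zero.2 (mul_pow_ne_one hq2 hq2 s).symm
  have hpow : Tendsto (fun s : ℕ => (q ^ 2) ^ s) atTop (𝓝 0) :=
    tendsto_pow_atTop_nhds_zero_of_norm_lt_one hq2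
  have hsum : ∀ w : ℂ, Summable fun s => ‖c s * w ^ s‖ := by
    intro w
    have hlim : Tendsto (fun s : ℕ => ‖(q ^ 2) ^ s * w / (1 - q ^ 2 * (q ^ 2) ^ s)‖)
        atTop (𝓝 0) := by
      have := ((hpow.mul_const w).div ((hpow.const_mul (q ^ 2)).const_sub 1) (by simp)).norm
      simpa using this
    refine summable_of_ratio_norm_eventually_le (r := 1 / 2) (by norm_num) ?_
    filter_upwards [hlim.eventually (gt_mem_nhds (show (0 : ℝ) < 1 / 2 by norm_num))] with s hs
    have : c (s + 1) * w ^ (s + 1)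
        = -((q ^ 2) ^ s * w / (1 - q ^ 2 * (q ^ 2) ^ s)) * (c s * w ^ s) := by
      field_simp [hne s]
      rw [pow_succ]
      linear_combination (w * w ^ s) * hcs s
    rw [norm_norm, norm_norm, this, norm_mul, norm_neg]
    exact mul_le_mul_of_nonneg_right hs.le (norm_nonneg _)
  set F : ℂ → ℂ := fun w => ∑' s, c s * w ^ s with hF
  have hFS : ∀ w, HasSum (fun s => c s * w ^ s) (F w) := fun w => (hsum w).of_norm.hasSum
  have hfun : ∀ w, F w = (1 - w) * F (w * q ^ 2) := by
    intro w
    have h1 : HasSum (fun s => c s * w ^ s - c s * (w * q ^ 2) ^ s) (F w - F (w * q ^ 2)) :=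
      (hFS w).sub (hFS _)
    rw [← hasSum_nat_add_iff' 1] at h1
    simp only [Finset.range_one, Finset.sum_singleton, pow_zero, sub_self, sub_zero] at h1
    have h2 := (hFS (w * q ^ 2)).mul_left (-w)
    have h3 := h1.unique (h2.congr_fun fun s => ?_)
    · linear_combination h3
    · have := hcs s
      rw [mul_pow, mul_pow]
      linear_combination w ^ (s + 1) * this
  have hiter : ∀ n : ℕ, F z = qPoch z (q ^ 2) n * F (z * (q ^ 2) ^ n) := by
    intro n
    induction n with
    | zero => simp [qPoch]
    | succ n ih => rw [ih, qPoch_succ, hfun (z * (q ^ 2) ^ n)]; ring_nf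
  have hlim : Tendsto (fun n : ℕ => F (z * (q ^ 2) ^ n)) atTop (𝓝 1) := by
    have h1 : (1 : ℂ) = ∑' s : ℕ, if s = 0 then 1 else 0 := by rw [tsum_ite_eq]
    rw [h1]
    refine tendsto_tsum_of_dominated_convergence (hsum z) (fun s => ?_) ?_
    · rcases Nat.eq_zero_or_pos s with rfl | hs
      · simp [hc0]
      · rw [if_neg hs.ne']
        have := ((hpow.const_mul z).pow s).const_mul (c s)
        simpa [hs.ne'] using this
    · refine Eventually.of_forall fun n s => ?_
      rw [mul_pow, ← mul_assoc, norm_mul]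
      refine mul_le_of_le_one_right (norm_nonneg _) ?_
      rw [norm_pow, norm_pow]
      exact pow_le_one₀ (by positivity) (pow_le_one₀ (norm_nonneg _) hq2.le)
  have hval : F z = qPochInf z (q ^ 2) := by
    have h2 := (tendsto_qPoch z hq2).mul hlim
    rw [mul_one] at h2
    exact tendsto_nhds_unique (tendsto_const_nhds.congr hiter) h2
  rw [← hval]
  refine (hFS z).congr_fun fun s => ?_
  simp only [hc]
  rw [neg_pow z]
  ring

/-- The right-hand side vanishes for `l < 0`, where the product has a zero factor. -/
theorem qPochInf_zpow {q : ℂ} (hq0 : q ≠ 0) (hq : ‖q‖ < 1) (l : ℤ) :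
    qPochInf (q ^ (2 * l + 2)) (q ^ 2) = qPochInf (q ^ 2) (q ^ 2) * invPoch q l := by
  have hq2 := norm_sq_lt_one hq
  rcases lt_or_ge l 0 with hl | hl
  · rw [invPoch_of_neg q hl, mul_zero]
    refine qPochInf_eq_zero hq2 (k := (-l - 1).toNat) ?_
    rw [← pow_mul, ← zpow_natCast, ← zpow_add₀ hq0]
    rw [show 2 * l + 2 + ((2 * (-l - 1).toNat : ℕ) : ℤ) = 0 by omega, zpow_zero]
  · lift l to ℕ using hl
    rw [invPoch_natCast, qPochInf_eq_mul (q ^ 2) hq2 l, mul_right_comm,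
      mul_inv_cancel₀ (qPoch_ne_zero hq2 hq2 l), one_mul]
    congr 1
    rw [← pow_mul, ← zpow_natCast, ← zpow_natCast, ← zpow_add₀ hq0]
    congr 1
    push_cast; ring

/-- Euler's expansion at `z = q^{2l + 2}`, for all integers `l`. -/
theorem hasSum_invPoch {q : ℂ} (hq0 : q ≠ 0) (hq : ‖q‖ < 1) (l : ℤ) :
    HasSum (fun r : ℕ => (-1) ^ r * q ^ ((r : ℤ) ^ 2 + r + 2 * r * l) * invPoch q r)
      (qPochInf (q ^ 2) (q ^ 2) * invPoch q l) := by
  rw [← qPochInf_zpow hq0 hq]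
  refine (hasSum_euler hq0 hq (q ^ (2 * l + 2))).congr_fun fun r => ?_
  have h4 : q ^ ((r : ℤ) ^ 2 + r + 2 * r * l)
      = q ^ ((r : ℤ) ^ 2 - r) * (q ^ (2 * l + 2)) ^ r := by
    rw [← zpow_natCast, ← zpow_mul, ← zpow_add₀ hq0]
    congr 1; ring
  rw [h4, neg_pow (q ^ (2 * l + 2))]
  ring

-- Unfolding `HasSum` while unifying two series of complicated terms is very slow.
attribute [local irreducible] HasSum

/-! ### The finite `q`-binomial theorem and the triple product identity -/

/-- Pascal's recurrence for the `q²`-binomial coefficients `(q²)_L / ((q²)_k (q²)_{L-k})`. -/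
theorem invPoch_pascal {q : ℂ} (hq0 : q ≠ 0) (hq : ‖q‖ < 1) (L k : ℤ) :
    (1 - q ^ (2 * L)) * (invPoch q k * invPoch q (L - k))
      = invPoch q (k - 1) * invPoch q (L - k)
        + q ^ (2 * k) * (invPoch q k * invPoch q (L - 1 - k)) := by
  rw [invPoch_sub_one hq k, show L - 1 - k = L - k - 1 by ring, invPoch_sub_one hq (L - k)]
  have : q ^ (2 * L) = q ^ (2 * k) * q ^ (2 * (L - k)) := by
    rw [← zpow_add₀ hq0]; congr 1; ring
  rw [this]; ring

/-- The finite `q`-binomial theorem. -/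
theorem sum_qBinomial {q : ℂ} (hq0 : q ≠ 0) (hq : ‖q‖ < 1) (M : ℕ) (x : ℂ) :
    ∑ j ∈ Finset.range (M + 1),
        invPoch q j * invPoch q (M - j) * q ^ ((j : ℤ) ^ 2 - j) * (-x) ^ j
      = qPoch x (q ^ 2) M * invPoch q M := by
  induction M generalizing x with
  | zero => simp [qPoch]
  | succ M ih =>
    have hne : (1 - q ^ (2 * ((M + 1 : ℕ) : ℤ))) ≠ 0 := by
      refine sub_ne_zero.2 fun h => mul_pow_ne_one (norm_sq_lt_one hq) (norm_sq_lt_one hq) M ?_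
      rw [h, ← pow_succ', ← pow_mul, ← zpow_natCast]
      push_cast; rfl
    refine mul_left_cancel₀ hne ?_
    have hr : (1 - q ^ (2 * ((M + 1 : ℕ) : ℤ))) * invPoch q ((M + 1 : ℕ) : ℤ) = invPoch q M := by
      rw [← invPoch_sub_one hq]; congr 1; push_cast; ring
    rw [qPoch_succ_left, mul_left_comm, hr, mul_assoc, ← ih (x * q ^ 2), Finset.mul_sum]
    have hterm : ∀ j : ℕ, (1 - q ^ (2 * ((M + 1 : ℕ) : ℤ))) *
        (invPoch q j * invPoch q (((M + 1 : ℕ) : ℤ) - j) * q ^ ((j : ℤ) ^ 2 - j) * (-x) ^ j)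
        = invPoch q ((j : ℤ) - 1) * invPoch q (((M + 1 : ℕ) : ℤ) - j)
            * q ^ ((j : ℤ) ^ 2 - j) * (-x) ^ j
          + invPoch q j * invPoch q (M - j) * q ^ ((j : ℤ) ^ 2 - j) * (-(x * q ^ 2)) ^ j := by
      intro j
      have h := invPoch_pascal hq0 hq ((M + 1 : ℕ) : ℤ) j
      rw [show ((M + 1 : ℕ) : ℤ) - 1 - j = M - j by push_cast; ring] at h
      have h2 : (-(x * q ^ 2)) ^ j = q ^ (2 * (j : ℤ)) * (-x) ^ j := by
        rw [show 2 * (j : ℤ) = ((2 * j : ℕ) : ℤ) by push_cast; ring, zpow_natCast,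
          ← neg_mul, mul_pow, ← pow_mul]
        ring
      rw [h2]
      linear_combination (q ^ ((j : ℤ) ^ 2 - j) * (-x) ^ j) * h
    simp_rw [hterm]
    rw [Finset.sum_add_distrib, Finset.sum_range_succ' _ (M + 1), Finset.sum_range_succ _ (M + 1)]
    rw [show (M : ℤ) - ((M + 1 : ℕ) : ℤ) = -1 by push_cast; ring,
      show ((0 : ℕ) : ℤ) - 1 = -1 by norm_num, invPoch_of_neg q (show (-1 : ℤ) < 0 by norm_num)]
    simp only [mul_zero, zero_mul, add_zero]
    rw [sub_mul, one_mul, sub_eq_add_neg, add_comm, Finset.mul_sum, ← Finset.sum_neg_distrib]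
    congr 1
    refine Finset.sum_congr rfl fun j _ => ?_
    have h3 : q ^ (((j + 1 : ℕ) : ℤ) ^ 2 - ((j + 1 : ℕ) : ℤ))
        = q ^ ((j : ℤ) ^ 2 - j) * (q ^ 2) ^ j := by
      rw [← pow_mul, ← zpow_natCast q (2 * j), ← zpow_add₀ hq0]
      congr 1; push_cast; ring
    rw [h3, show ((j + 1 : ℕ) : ℤ) - 1 = j by push_cast; ring,
      show ((M + 1 : ℕ) : ℤ) - ((j + 1 : ℕ) : ℤ) = M - j by push_cast; ring,
      ← neg_mul x (q ^ 2), mul_pow (-x), pow_succ]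
    ring

theorem summable_norm_pow_mul_invPoch {q : ℂ} (hq : ‖q‖ < 1) {x : ℂ} (hx : ‖x‖ < 1) :
    Summable fun m : ℕ => ‖x ^ m * invPoch q m‖ := by
  obtain ⟨C, hC0, hC⟩ := exists_norm_invPoch_le hq
  refine ((summable_geometric_of_lt_one (norm_nonneg x) hx).mul_right C).of_nonneg_of_le
    (fun _ => norm_nonneg _) fun m => ?_
  rw [norm_mul, norm_pow]
  exact mul_le_mul_of_nonneg_left (hC _) (by positivity)

/-- Euler's expansion of the reciprocal product `1 / (x; q²)_∞`. -/
theorem tsum_pow_mul_invPoch {q : ℂ} (hq0 : q ≠ 0) (hq : ‖q‖ < 1) {x : ℂ} (hx : ‖x‖ < 1) :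
    (∑' m : ℕ, x ^ m * invPoch q m) * qPochInf x (q ^ 2) = 1 := by
  have he := hasSum_euler hq0 hq x
  rw [← he.tsum_eq, tsum_mul_tsum_eq_tsum_sum_antidiagonal_of_summable_norm
    (summable_norm_pow_mul_invPoch hq hx) he.summable.norm]
  have : ∀ n : ℕ, ∑ kl ∈ Finset.HasAntidiagonal.antidiagonal n, x ^ kl.1 * invPoch q kl.1 *
      (invPoch q kl.2 * q ^ ((kl.2 : ℤ) ^ 2 - kl.2) * (-x) ^ kl.2) = if n = 0 then 1 else 0 := by
    intro n
    rw [← Finset.Nat.sum_antidiagonal_swap, Finset.Nat.sum_antidiagonal_eq_sum_range_succ_mk]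
    have h1 := sum_qBinomial hq0 hq n 1
    have h2 : qPoch 1 (q ^ 2) n * invPoch q n = if n = 0 then 1 else 0 := by
      cases n with
      | zero => simp [qPoch]
      | succ n => rw [qPoch_succ_left]; simp
    rw [← h2, ← h1]
    have h3 : (if n = 0 then (1 : ℂ) else 0) = x ^ n * (if n = 0 then (1 : ℂ) else 0) := by
      split_ifs with h <;> simp [h]
    rw [h1, h2, h3, ← h2, ← h1, Finset.mul_sum]
    refine Finset.sum_congr rfl fun j hj => ?_
    have hj' : j ≤ n := Nat.lt_succ_iff.1 (Finset.mem_range.1 hj)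
    obtain ⟨i, rfl⟩ := Nat.exists_eq_add_of_le hj'
    simp only [Prod.swap, add_tsub_cancel_left]
    rw [show (((j + i : ℕ) : ℤ) - j) = i by push_cast; ring, neg_pow x, pow_add]
    ring
  simp_rw [this]
  exact tsum_ite_eq 0 _

theorem summable_sq_mul_zpow {q : ℂ} (hq : ‖q‖ < 1) (z : ℂ) :
    Summable fun n : ℤ => ‖q ^ (n ^ 2) * z ^ n‖ := by
  have key : ∀ w : ℂ, Summable fun n : ℕ => ‖q ^ (n ^ 2) * w ^ n‖ := by
    intro w
    have hlim : Tendsto (fun n : ℕ => ‖q ^ (2 * n + 1) * w‖) atTop (𝓝 0) := by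
      have h := (((tendsto_pow_atTop_nhds_zero_of_norm_lt_one hq).comp
        (tendsto_id.const_mul_atTop' (show 0 < 2 by norm_num))).const_mul q).mul_const w |>.norm
      simp only [mul_zero, zero_mul, norm_zero] at h
      refine h.congr fun n => ?_
      simp only [Function.comp, id, pow_succ']
    refine summable_of_ratio_norm_eventually_le (r := 1 / 2) (by norm_num) ?_
    filter_upwards [hlim.eventually (gt_mem_nhds (show (0 : ℝ) < 1 / 2 by norm_num))] with n hn
    rw [norm_norm, norm_norm, show q ^ ((n + 1) ^ 2) * w ^ (n + 1)
      = (q ^ (2 * n + 1) * w) * (q ^ (n ^ 2) * w ^ n) by ring, norm_mul]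
    exact mul_le_mul_of_nonneg_right hn.le (norm_nonneg _)
  rw [summable_int_iff_summable_nat_and_neg]
  refine ⟨(key z).congr fun n => ?_, (key z⁻¹).congr fun n => ?_⟩
  · rw [zpow_natCast, ← Nat.cast_pow, zpow_natCast]
  · rw [zpow_neg, zpow_natCast, neg_sq, ← Nat.cast_pow, zpow_natCast, inv_pow]

/-- The theta function `∑ q^{n²} z^n`, given by its product
`(-zq, -q/z, q²; q²)_∞`. -/
noncomputable def theta (q z : ℂ) : ℂ :=
  qPochInf (-(z * q)) (q ^ 2) * qPochInf (-(q / z)) (q ^ 2) * qPochInf (q ^ 2) (q ^ 2)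

theorem theta_inv (q z : ℂ) : theta q z⁻¹ = theta q z := by
  simp only [theta, div_eq_mul_inv, inv_inv]
  rw [mul_comm z⁻¹ q, mul_comm q z, mul_comm (qPochInf (-(q * z⁻¹)) (q ^ 2))]

theorem hasSum_nat_of_hasSum_int {f : ℤ → ℂ} {S : ℂ} (h : HasSum f S) (hf : ∀ n < 0, f n = 0) :
    HasSum (fun n : ℕ => f n) S := by
  refine (Function.Injective.hasSum_iff (g := fun n : ℕ => (n : ℤ)) Nat.cast_injective
    fun s hs => hf s ?_).2 h
  by_contra h
  exact hs ⟨s.toNat, Int.toNat_of_nonneg (not_lt.1 h)⟩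

theorem hasSum_unique_of_eq {ι : Type*} {f g : ι → ℂ} {a b : ℂ} (hf : HasSum f a)
    (hg : HasSum g b) (h : ∀ i, f i = g i) : a = b :=
  hf.unique (hg.congr_fun h)

theorem hasSum_mul_of_summable_norm {ι κ : Type*} {f : ι → ℂ} {g : κ → ℂ} {a b : ℂ}
    (hf : HasSum f a) (hg : HasSum g b) (hf' : Summable fun i => ‖f i‖)
    (hg' : Summable fun i => ‖g i‖) : HasSum (fun x : ι × κ => f x.1 * g x.2) (a * b) :=
  hf.mul hg (summable_mul_of_summable_norm hf' hg')

/-- The shear `(n, m) ↦ (n + m, m)` of `ℤ × ℕ`. -/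
def shear : ℤ × ℕ ≃ ℤ × ℕ where
  toFun x := (x.1 + x.2, x.2)
  invFun x := (x.1 - x.2, x.2)
  left_inv x := by simp
  right_inv x := by simp

theorem theta_term_shear {q : ℂ} (hq0 : q ≠ 0) {z : ℂ} (hz : z ≠ 0) (s : ℤ) (m : ℕ) :
    q ^ ((s + m) ^ 2) * z ^ (s + m) * ((-(q / z)) ^ m * invPoch q m)
      = q ^ (s ^ 2) * z ^ s * ((-1) ^ m * q ^ ((m : ℤ) ^ 2 + m + 2 * m * s) * invPoch q m) := by
  rw [neg_pow, div_pow, zpow_add₀ hz, zpow_natCast]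
  have h3 : q ^ ((s + m) ^ 2) * q ^ m = q ^ (s ^ 2) * q ^ ((m : ℤ) ^ 2 + m + 2 * m * s) := by
    rw [← zpow_natCast, ← zpow_add₀ hq0, ← zpow_add₀ hq0]
    congr 1; ring
  have hzm : z ^ m * (q ^ m / z ^ m) = q ^ m := mul_div_cancel₀ _ (pow_ne_zero _ hz)
  linear_combination ((-1) ^ m * z ^ s * invPoch q m) * h3
    + (q ^ ((s + m) ^ 2) * z ^ s * (-1) ^ m * invPoch q m) * hzm

/-- The triple product for `|q| < |z|`, where the reciprocal of `(-q/z; q²)_∞` has a convergent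
expansion in powers of `q / z`. -/
theorem hasSum_theta_of_norm_lt {q : ℂ} (hq0 : q ≠ 0) (hq : ‖q‖ < 1) {z : ℂ} (hz : z ≠ 0)
    (hqz : ‖q‖ < ‖z‖) : HasSum (fun n : ℤ => q ^ (n ^ 2) * z ^ n) (theta q z) := by
  have hx : ‖-(q / z)‖ < 1 := by
    rw [norm_neg, norm_div]; exact (div_lt_one (norm_pos_iff.2 hz)).2 hqz
  obtain ⟨G, hGs⟩ := (summable_norm_pow_mul_invPoch hq hx).of_norm
  have hG1 : G * qPochInf (-(q / z)) (q ^ 2) = 1 := by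
    rw [← hGs.tsum_eq]; exact tsum_pow_mul_invPoch hq0 hq hx
  have hs := summable_sq_mul_zpow hq z
  obtain ⟨Φ, hΦs⟩ := hs.of_norm
  have hprod := hasSum_mul_of_summable_norm hΦs hGs hs (summable_norm_pow_mul_invPoch hq hx)
  -- After the shear, each inner sum is Euler's expansion of `1 / (q²; q²)_s`.
  have h1 : HasSum (fun x : ℤ × ℕ => q ^ ((x.1 + x.2) ^ 2) * z ^ (x.1 + x.2) *
      ((-(q / z)) ^ x.2 * invPoch q x.2)) (Φ * G) := shear.hasSum_iff.2 hprod
  have h2 := h1.prod_fiberwise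
    (g := fun s : ℤ => q ^ (s ^ 2) * z ^ s * (qPochInf (q ^ 2) (q ^ 2) * invPoch q s))
    fun s => ((hasSum_invPoch hq0 hq s).mul_left (q ^ (s ^ 2) * z ^ s)).congr_fun fun m =>
      (theta_term_shear hq0 hz s m).trans rfl
  have h3 : HasSum (fun s : ℕ => q ^ ((s : ℤ) ^ 2) * z ^ (s : ℤ) *
      (qPochInf (q ^ 2) (q ^ 2) * invPoch q s)) (Φ * G) :=
    hasSum_nat_of_hasSum_int h2 fun s hs => by rw [invPoch_of_neg q hs]; ring
  have h4 := (hasSum_euler hq0 hq (-(z * q))).mul_left (qPochInf (q ^ 2) (q ^ 2))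
  have h5 : Φ * G = qPochInf (q ^ 2) (q ^ 2) * qPochInf (-(z * q)) (q ^ 2) := by
    refine hasSum_unique_of_eq h3 h4 fun s => ?_
    have : q ^ ((s : ℤ) ^ 2) = q ^ ((s : ℤ) ^ 2 - s) * q ^ s := by
      rw [← zpow_natCast, ← zpow_add₀ hq0]
      congr 1; ring
    rw [this, neg_neg, mul_pow, zpow_natCast]
    ring
  have : Φ = theta q z := by
    have hG0 : G ≠ 0 := left_ne_zero_of_mul_eq_one hG1
    refine mul_right_cancel₀ hG0 ?_
    rw [h5, theta]
    linear_combination (-(qPochInf (-(z * q)) (q ^ 2) * qPochInf (q ^ 2) (q ^ 2))) * hG1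
  rwa [← this]

/-- Jacobi's triple product identity. -/
theorem hasSum_theta {q : ℂ} (hq0 : q ≠ 0) (hq : ‖q‖ < 1) {z : ℂ} (hz : z ≠ 0) :
    HasSum (fun n : ℤ => q ^ (n ^ 2) * z ^ n) (theta q z) := by
  rcases lt_or_ge ‖q‖ ‖z‖ with h | h
  · exact hasSum_theta_of_norm_lt hq0 hq hz h
  · have hz1 : ‖q‖ < ‖z⁻¹‖ := by
      rw [norm_inv]
      exact hq.trans (one_lt_inv_iff₀.2 ⟨norm_pos_iff.2 hz, h.trans_lt hq⟩)
    have := hasSum_theta_of_norm_lt hq0 hq (inv_ne_zero hz) hz1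
    rw [theta_inv, ← (Equiv.neg ℤ).hasSum_iff] at this
    refine this.congr_fun fun n => ?_
    simp [Function.comp]

/-- Quasi-periodicity of the theta function. -/
theorem theta_mul_zpow {q : ℂ} (hq0 : q ≠ 0) (hq : ‖q‖ < 1) {z : ℂ} (hz : z ≠ 0) (n : ℤ) :
    theta q (z * q ^ (2 * n)) = q ^ (-n ^ 2) * z ^ (-n) * theta q z := by
  have h1 := hasSum_theta hq0 hq (mul_ne_zero hz (zpow_ne_zero (2 * n) hq0))
  have h2 := ((Equiv.addRight n).hasSum_iff.2 (hasSum_theta hq0 hq hz)).mul_left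
    (q ^ (-n ^ 2) * z ^ (-n))
  refine h1.unique (h2.congr_fun fun a => ?_)
  simp only [Function.comp, Equiv.coe_addRight]
  rw [zpow_add₀ hz, mul_zpow, ← zpow_mul]
  have h3 : q ^ (a ^ 2) * q ^ (2 * n * a) = q ^ (-n ^ 2) * q ^ ((a + n) ^ 2) := by
    rw [← zpow_add₀ hq0, ← zpow_add₀ hq0]
    congr 1; ring
  have h4 : z ^ (-n) * z ^ n = 1 := by rw [← zpow_add₀ hz, neg_add_cancel, zpow_zero]
  linear_combination z ^ a * h3 - (q ^ (-n ^ 2) * q ^ ((a + n) ^ 2) * z ^ a) * h4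

theorem theta_neg_self {q : ℂ} (hq0 : q ≠ 0) (hq : ‖q‖ < 1) : theta q (-q) = 0 := by
  have : qPochInf (-(q / -q)) (q ^ 2) = 0 :=
    qPochInf_eq_zero (norm_sq_lt_one hq) (k := 0) (by field_simp)
  rw [theta, this]; ring

section

/-! ### Summability of series with positive definite exponents -/

/-- The function `N` takes each value so rarely that `∑ r ^ N i` converges for all `0 < r < 1`. -/
def GeomSummable {ι : Type*} (N : ι → ℕ) : Prop :=
  ∀ r : ℝ, 0 < r → r < 1 → Summable fun i => r ^ N i

theorem geomSummable_nat : GeomSummable fun n : ℕ => n :=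
  fun _ h0 h1 => summable_geometric_of_lt_one h0.le h1

theorem geomSummable_int : GeomSummable Int.natAbs := fun r h0 h1 => by
  rw [summable_int_iff_summable_nat_and_neg]
  simpa using summable_geometric_of_lt_one h0.le h1

theorem GeomSummable.prod {ι κ : Type*} {N : ι → ℕ} {M : κ → ℕ} (hN : GeomSummable N)
    (hM : GeomSummable M) : GeomSummable fun x : ι × κ => N x.1 + M x.2 := fun r h0 h1 => by
  simpa only [pow_add] using (hN r h0 h1).mul_of_nonneg (hM r h0 h1)
    (fun _ => pow_nonneg h0.le _) (fun _ => pow_nonneg h0.le _)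

/-- A series with terms of size `|q|^E` converges if `E` grows at least like a multiple of `N`. -/
theorem GeomSummable.summable {ι : Type*} {N : ι → ℕ} (hN : GeomSummable N) {q : ℂ}
    (hq0 : q ≠ 0) (hq : ‖q‖ < 1) {f : ι → ℂ} {E : ι → ℤ} {K : ℝ} {d c : ℕ} (hd : d ≠ 0)
    (hf : ∀ i, ‖f i‖ ≤ K * ‖q ^ E i‖) (hE : ∀ i, (N i : ℤ) ≤ d * E i + c) : Summable f := by
  have hρ := norm_pos_iff.2 hq0
  obtain ⟨r, hr0, hr⟩ : ∃ r : ℝ, 0 < r ∧ r ^ d = ‖q‖ :=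
    ⟨‖q‖ ^ ((d : ℝ)⁻¹), Real.rpow_pos_of_pos hρ _, Real.rpow_inv_natCast_pow hρ.le hd⟩
  have hr1 : r < 1 := by
    by_contra h
    have := one_le_pow₀ (n := d) (not_lt.1 h)
    linarith
  refine Summable.of_norm_bounded ((hN r hr0 hr1).mul_left (|K| * r ^ (-(c : ℤ)))) fun i => ?_
  refine (hf i).trans ((mul_le_mul_of_nonneg_right (le_abs_self K) (norm_nonneg _)).trans ?_)
  rw [mul_assoc]
  refine mul_le_mul_of_nonneg_left ?_ (abs_nonneg K)
  rw [norm_zpow, ← hr, ← zpow_natCast, ← zpow_natCast, ← zpow_mul, ← zpow_add₀ hr0.ne']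
  exact zpow_le_zpow_right_of_le_one₀ hr0 hr1.le (by linarith [hE i])

theorem abs_le_sq (a : ℤ) : |a| ≤ a ^ 2 :=
  (Int.natCast_natAbs a).symm.trans_le (Int.natAbs_le_self_sq a)

/-! ### The central index of the triple series -/

/-- A case of the finite `q`-binomial theorem, for `q^{-2k}`; both sides vanish for `M > k`. -/
theorem sum_invPoch_sq {q : ℂ} (hq0 : q ≠ 0) (hq : ‖q‖ < 1) (M : ℕ) (k : ℤ) :
    invPoch q k * ∑ j ∈ Finset.range (M + 1), (-1) ^ (M + j) *
        q ^ ((j - k) ^ 2 + (M - j) : ℤ) * (invPoch q j * invPoch q (M - j))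
      = invPoch q M * invPoch q (k - M) * q ^ ((k - M) ^ 2) := by
  have h1 : ∀ M : ℕ, invPoch q k * qPoch (q ^ (-2 * k)) (q ^ 2) M
      = (-1) ^ M * q ^ ((M : ℤ) ^ 2 - M - 2 * k * M) * invPoch q (k - M) := by
    intro M
    induction M with
    | zero => simp [qPoch]
    | succ M ih =>
      rw [qPoch_succ, ← mul_assoc, ih]
      have h2 := invPoch_sub_one hq (k - M)
      rw [show k - M - 1 = k - ((M + 1 : ℕ) : ℤ) by push_cast; ring] at h2
      have h3 : q ^ (-2 * k) * (q ^ 2) ^ M = q ^ (-(2 * (k - M))) := by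
        rw [← pow_mul, ← zpow_natCast, ← zpow_add₀ hq0]
        congr 1; push_cast; ring
      have h4 : q ^ (((M + 1 : ℕ) : ℤ) ^ 2 - ((M + 1 : ℕ) : ℤ) - 2 * k * ((M + 1 : ℕ) : ℤ))
          = q ^ ((M : ℤ) ^ 2 - M - 2 * k * M) * q ^ (-(2 * (k - M))) := by
        rw [← zpow_add₀ hq0]
        congr 1; push_cast; ring
      have h5 : q ^ (-(2 * (k - M))) * q ^ (2 * (k - M)) = 1 := by
        rw [← zpow_add₀ hq0, neg_add_cancel, zpow_zero]
      rw [h2, h3, h4, pow_succ (-1 : ℂ)]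
      linear_combination (-((-1) ^ M * q ^ ((M : ℤ) ^ 2 - M - 2 * k * M) * invPoch q (k - M))) * h5
  have h6 := sum_qBinomial hq0 hq M (q ^ (-2 * k))
  have h7 : ∑ j ∈ Finset.range (M + 1), (-1) ^ (M + j) *
        q ^ ((j - k) ^ 2 + (M - j) : ℤ) * (invPoch q j * invPoch q (M - j))
      = (-1) ^ M * q ^ (k ^ 2 + M) * (qPoch (q ^ (-2 * k)) (q ^ 2) M * invPoch q M) := by
    rw [← h6, Finset.mul_sum]
    refine Finset.sum_congr rfl fun j _ => ?_
    have h8 : q ^ ((j - k) ^ 2 + (M - j) : ℤ)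
        = q ^ (k ^ 2 + M) * (q ^ ((j : ℤ) ^ 2 - j) * (q ^ (-2 * k)) ^ j) := by
      rw [← zpow_natCast (q ^ (-2 * k)), ← zpow_mul, ← zpow_add₀ hq0, ← zpow_add₀ hq0]
      congr 1; ring
    rw [h8, neg_pow (q ^ (-2 * k)), pow_add]
    ring
  have h9 : (-1 : ℂ) ^ M * (-1) ^ M = 1 := by rw [← mul_pow]; simp
  have h10 : q ^ (k ^ 2 + M) * q ^ ((M : ℤ) ^ 2 - M - 2 * k * M) = q ^ ((k - M) ^ 2) := by
    rw [← zpow_add₀ hq0]; congr 1; ring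
  rw [h7]
  linear_combination ((-1) ^ M * q ^ (k ^ 2 + M) * invPoch q M) * h1 M
    + (q ^ (k ^ 2 + M) * invPoch q M * q ^ ((M : ℤ) ^ 2 - M - 2 * k * M) * invPoch q (k - M)) * h9
    + invPoch q M * invPoch q (k - M) * h10

variable {q : ℂ} {ε y : ℤ}

/-- The triple series with linear part `(-ε - y) i + (y + ε) j + (y - ε) k`, times `(q²; q²)_∞`,
with `1 / (q²; q²)_i` expanded by Euler's formula (summation index `m`). -/
noncomputable def expandedTerm (q : ℂ) (ε y : ℤ) (x : (ℤ × ℕ × ℕ) × ℕ) : ℂ :=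
  (-1) ^ x.2 * q ^ ((x.1.1 + x.2) ^ 2 + (x.1.2.1 + x.1.2.2 - x.1.1) ^ 2
    + (x.1.2.1 - x.1.2.2 : ℤ) ^ 2 + x.2 - ε * (x.1.1 + x.2) + y * (x.1.2.1 + x.1.2.2 - x.1.1)
    + ε * (x.2 + x.1.2.1 - x.1.2.2)) * (invPoch q x.2 * invPoch q x.1.2.1 * invPoch q x.1.2.2)

theorem norm_invPoch_mul_le {C : ℝ} (hC0 : 0 < C) (hC : ∀ k : ℤ, ‖invPoch q k‖ ≤ C)
    (a b c : ℤ) : ‖invPoch q a * invPoch q b * invPoch q c‖ ≤ C * C * C := by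
  rw [norm_mul, norm_mul]
  exact mul_le_mul (mul_le_mul (hC _) (hC _) (norm_nonneg _) hC0.le) (hC _) (norm_nonneg _)
    (by positivity)

theorem summable_expandedTerm (hq0 : q ≠ 0) (hq : ‖q‖ < 1) (hε : ε ^ 2 ≤ 1) (hy : y ^ 2 ≤ 4) :
    Summable (expandedTerm q ε y) := by
  obtain ⟨C, hC0, hC⟩ := exists_norm_invPoch_le hq
  refine ((geomSummable_int.prod (geomSummable_nat.prod geomSummable_nat)).prod
    geomSummable_nat).summable hq0 hq (K := C * C * C) (d := 4) (c := 22)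
    (E := fun x => (x.1.1 + x.2) ^ 2 + (x.1.2.1 + x.1.2.2 - x.1.1) ^ 2
    + (x.1.2.1 - x.1.2.2 : ℤ) ^ 2 + x.2 - ε * (x.1.1 + x.2) + y * (x.1.2.1 + x.1.2.2 - x.1.1)
    + ε * (x.2 + x.1.2.1 - x.1.2.2)) four_ne_zero
    (fun x => ?_) fun x => ?_
  · unfold expandedTerm
    rw [norm_mul, norm_mul, norm_pow, norm_neg, norm_one, one_pow, one_mul, mul_comm]
    exact mul_le_mul_of_nonneg_right (norm_invPoch_mul_le hC0 hC _ _ _) (norm_nonneg _)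
  · obtain ⟨⟨i, j, k⟩, m⟩ := x
    push_cast
    generalize hA : i + (m : ℤ) = A
    generalize hB : (j : ℤ) + k - i = B
    have h1 : |i| ≤ |A| + m := by
      rw [show i = A - m by omega]
      exact (abs_sub _ _).trans (by simp)
    have h2 : |A| ≤ A ^ 2 := abs_le_sq A
    have h3 : (m : ℤ) + j + k = A + B := by omega
    have hm : (0 : ℤ) ≤ m := by positivity
    have hε1 : -1 ≤ ε := by nlinarith
    have hem : 0 ≤ ε * m + m := by nlinarith
    nlinarith [sq_nonneg (A - 2 * ε), sq_nonneg (B + 2 * y), sq_nonneg (2 * ((j : ℤ) - k) + ε),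
      sq_nonneg (A - B), sq_nonneg (A + B - 1)]

/-- For `i < 0` the expansion sums to `0`, so that `i` may run over all integers. -/
theorem expandedTerm_fiber (hq0 : q ≠ 0) (hq : ‖q‖ < 1) (i : ℤ) (j k : ℕ) :
    HasSum (fun m : ℕ => expandedTerm q ε y ((i, j, k), m))
      (qPochInf (q ^ 2) (q ^ 2) * (q ^ (2 * i ^ 2 + 2 * j ^ 2 + 2 * k ^ 2 - 2 * i * j - 2 * i * k
      + (-ε - y) * i + (y + ε) * j + (y - ε) * k : ℤ)
      * (invPoch q i * invPoch q j * invPoch q k))) := by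
  have h := (hasSum_invPoch hq0 hq i).mul_right
    (q ^ (2 * i ^ 2 + 2 * j ^ 2 + 2 * k ^ 2 - 2 * i * j - 2 * i * k
      + (-ε - y) * i + (y + ε) * j + (y - ε) * k : ℤ) * (invPoch q j * invPoch q k))
  have h2 : ∀ a b c d e : ℂ, a * b * (c * (d * e)) = a * (c * (b * d * e)) :=
    fun _ _ _ _ _ => by ring
  rw [h2] at h
  refine h.congr_fun fun m => ?_
  · unfold expandedTerm
    dsimp only
    have : q ^ ((i + m) ^ 2 + (j + k - i) ^ 2 + (j - k : ℤ) ^ 2 + m - ε * (i + m)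
        + y * (j + k - i) + ε * (m + j - k))
        = q ^ ((m : ℤ) ^ 2 + m + 2 * m * i) * q ^ (2 * i ^ 2 + 2 * j ^ 2 + 2 * k ^ 2 - 2 * i * j
        - 2 * i * k + (-ε - y) * i + (y + ε) * j + (y - ε) * k : ℤ) := by
      rw [← zpow_add₀ hq0]; congr 1; ring
    rw [this]; ring

/-- The terms left after the elimination of one index; `A` and `B = s + 2 l - A` run over all
integers. -/
noncomputable def reducedTerm (q : ℂ) (ε y A : ℤ) (s l : ℤ) : ℂ :=
  q ^ (A ^ 2 + (s + 2 * l - A) ^ 2 - ε * A + y * (s + 2 * l - A) + s ^ 2 - ε * s)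
    * (invPoch q s * invPoch q l)

/-- The series of `expandedTerm` in terms of `A = i + m`, `k`, `M = j + m` and `j`, in this
order. -/
theorem hasSum_expandedTerm_reorder (hq0 : q ≠ 0) {S : ℂ} (hS : HasSum (expandedTerm q ε y) S) :
    HasSum (fun x : (ℤ × ℕ × ℕ) × ℕ => (-1) ^ (x.1.2.2 + x.2) *
      q ^ ((x.2 - x.1.2.1) ^ 2 + (x.1.2.2 - x.2) : ℤ) * (invPoch q x.2 * invPoch q (x.1.2.2 - x.2))
      * (q ^ (x.1.1 ^ 2 + (x.1.2.1 + x.1.2.2 - x.1.1) ^ 2 - ε * x.1.1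
        + y * (x.1.2.1 + x.1.2.2 - x.1.1) + ε * (x.1.2.2 - x.1.2.1)) * invPoch q x.1.2.1)) S := by
  let φ : (ℤ × ℕ × ℕ) × ℕ → (ℤ × ℕ × ℕ) × ℕ := fun x =>
    ((x.1.1 + x.2, x.1.2.2, x.1.2.1 + x.2), x.1.2.1)
  have hφ : Function.Injective φ := by
    rintro ⟨⟨i, j, k⟩, m⟩ ⟨⟨i', j', k'⟩, m'⟩ h
    simp only [φ, Prod.mk.injEq] at h ⊢
    omega
  refine (hφ.hasSum_iff ?_).1 (hS.congr_fun fun x => ?_)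
  · rintro ⟨⟨A, k, M⟩, j⟩ hx
    have : (M : ℤ) - j < 0 := by
      by_contra h
      refine hx ⟨((A - (M - j : ℕ), j, k), M - j), ?_⟩
      simp only [φ, Prod.mk.injEq, true_and, and_true]
      omega
    simp [invPoch_of_neg q this]
  · obtain ⟨⟨i, j, k⟩, m⟩ := x
    have h1 : (-1 : ℂ) ^ (j + m + j) = (-1) ^ m := by
      rw [show j + m + j = m + 2 * j by ring, pow_add, pow_mul]; simp
    simp only [φ, Function.comp, expandedTerm]
    rw [h1]
    push_cast
    rw [add_sub_cancel_left (j : ℤ) m]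
    have h2 : q ^ ((i + m) ^ 2 + (j + k - i) ^ 2 + (j - k : ℤ) ^ 2 + m - ε * (i + m)
        + y * (j + k - i) + ε * (m + j - k)) = q ^ ((j - k : ℤ) ^ 2 + m)
          * q ^ ((i + m) ^ 2 + (k + (j + m) - (i + m)) ^ 2 - ε * (i + m)
            + y * (k + (j + m) - (i + m)) + ε * (j + m - k)) := by
      rw [← zpow_add₀ hq0]; congr 1; ring
    rw [h2]
    ring

theorem hasSum_reducedTerm (hq0 : q ≠ 0) (hq : ‖q‖ < 1) {S : ℂ}
    (hS : HasSum (expandedTerm q ε y) S) :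
    HasSum (fun x : ℤ × ℕ × ℕ => reducedTerm q ε y x.1 x.2.1 x.2.2) S := by
  have h1 := (hasSum_expandedTerm_reorder hq0 hS).prod_fiberwise (g := fun x : ℤ × ℕ × ℕ =>
    reducedTerm q ε y x.1 (x.2.1 - x.2.2) x.2.2) fun x => by
      obtain ⟨A, k, M⟩ := x
      dsimp only
      have h2 := sum_invPoch_sq hq0 hq M k
      have h3 : reducedTerm q ε y A (k - M) M = (∑ j ∈ Finset.range (M + 1), (-1) ^ (M + j) *
          q ^ ((j - k) ^ 2 + (M - j) : ℤ) * (invPoch q j * invPoch q (M - j)))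
          * (q ^ (A ^ 2 + (k + M - A) ^ 2 - ε * A + y * (k + M - A) + ε * (M - k))
            * invPoch q k) := by
        have h4 : q ^ (A ^ 2 + (k - M + 2 * M - A) ^ 2 - ε * A + y * (k - M + 2 * M - A)
            + (k - M : ℤ) ^ 2 - ε * (k - M)) = q ^ (A ^ 2 + (k + M - A) ^ 2 - ε * A
              + y * (k + M - A) + ε * (M - k)) * q ^ ((k - M : ℤ) ^ 2) := by
          rw [← zpow_add₀ hq0]; congr 1; ring
        rw [reducedTerm, h4]
        linear_combination (-(q ^ (A ^ 2 + (k + M - A) ^ 2 - ε * A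
              + y * (k + M - A) + ε * (M - k)))) * h2
      rw [h3]
      refine HasSum.mul_right _ (hasSum_sum_of_ne_finset_zero fun j hj => ?_)
      rw [invPoch_of_neg q (k := (M : ℤ) - j) (by rw [Finset.mem_range] at hj; omega)]
      ring
  let φ : ℤ × ℕ × ℕ → ℤ × ℕ × ℕ := fun x => (x.1, x.2.1 + x.2.2, x.2.2)
  have hφ : Function.Injective φ := by
    rintro ⟨A, s, l⟩ ⟨A', s', l'⟩ h
    simp only [φ, Prod.mk.injEq] at h ⊢
    omega
  have h5 := (hφ.hasSum_iff ?_).2 h1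
  · refine h5.congr_fun fun x => ?_
    simp [φ, Function.comp]
  · rintro ⟨A, k, M⟩ hx
    have : (k : ℤ) - M < 0 := by
      by_contra h
      refine hx ⟨(A, k - M, M), ?_⟩
      simp only [φ, Prod.mk.injEq, true_and, and_true]
      omega
    simp [reducedTerm, invPoch_of_neg q this]

/-- The triple series converges, and its sum times `(q²; q²)_∞` is the sum of `reducedTerm`. -/
theorem exists_hasSum_nahmTerm (hq0 : q ≠ 0) (hq : ‖q‖ < 1) (hε : ε ^ 2 ≤ 1) (hy : y ^ 2 ≤ 4) :
    ∃ S : ℂ, HasSum (nahmTerm q (-ε - y) (y + ε) (y - ε)) (S / qPochInf (q ^ 2) (q ^ 2)) ∧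
      HasSum (fun x : ℤ × ℕ × ℕ => reducedTerm q ε y x.1 x.2.1 x.2.2) S := by
  have hP := qPochInf_ne_zero_of_norm_lt (norm_sq_lt_one hq) (norm_sq_lt_one hq)
  obtain ⟨S, hS⟩ := summable_expandedTerm hq0 hq hε hy
  refine ⟨S, ?_, hasSum_reducedTerm hq0 hq hS⟩
  have h1 := hS.prod_fiberwise fun x => expandedTerm_fiber hq0 hq x.1 x.2.1 x.2.2
  let φ : ℕ × ℕ × ℕ → ℤ × ℕ × ℕ := fun x => (x.1, x.2.1, x.2.2)
  have hφ : Function.Injective φ := by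
    rintro ⟨i, j, k⟩ ⟨i', j', k'⟩ h
    simpa [φ] using h
  have h2 := ((hφ.hasSum_iff ?_).2 h1).div_const (qPochInf (q ^ 2) (q ^ 2))
  · refine h2.congr_fun fun x => ?_
    simp only [nahmTerm, φ, Function.comp, invPoch_natCast]
    field_simp
  · rintro ⟨i, j, k⟩ hx
    have : i < 0 := by
      by_contra h
      exact hx ⟨(i.toNat, j, k), by simp [φ]; omega⟩
    simp [invPoch_of_neg q this]

end

section

/-! ### Separation into theta functions -/

variable {q : ℂ} {ε y : ℤ}

theorem hasSum_theta_mul (hq0 : q ≠ 0) (hq : ‖q‖ < 1) {a b c : ℂ} (ha : a ≠ 0) (hb : b ≠ 0) :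
    HasSum (fun x : ℤ × ℤ × ℕ => q ^ (x.1 ^ 2) * a ^ x.1 * (q ^ (x.2.1 ^ 2) * b ^ x.2.1 *
      (invPoch q x.2.2 * q ^ ((x.2.2 : ℤ) ^ 2 - x.2.2) * c ^ x.2.2)))
      (theta q a * (theta q b * qPochInf (-c) (q ^ 2))) := by
  have hc := hasSum_euler hq0 hq (-c)
  rw [neg_neg] at hc
  have h1 := hasSum_mul_of_summable_norm (hasSum_theta hq0 hq hb) hc
    (summable_sq_mul_zpow hq b) hc.summable.norm
  exact hasSum_mul_of_summable_norm (hasSum_theta hq0 hq ha) h1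
    (summable_sq_mul_zpow hq a) h1.summable.norm

/-- Extraction of the terms with `A + B + s = 2 l` even. -/
theorem hasSum_theta_mul_even (hq0 : q ≠ 0) (hq : ‖q‖ < 1) {a b c : ℂ} (ha : a ≠ 0)
    (hb : b ≠ 0) :
    HasSum (fun x : ℤ × ℕ × ℤ => q ^ (x.1 ^ 2) * a ^ x.1 *
      (q ^ ((x.2.1 + 2 * x.2.2 - x.1) ^ 2) * b ^ (x.2.1 + 2 * x.2.2 - x.1) *
      (invPoch q x.2.1 * q ^ ((x.2.1 : ℤ) ^ 2 - x.2.1) * c ^ x.2.1)))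
      ((theta q a * (theta q b * qPochInf (-c) (q ^ 2))
        + theta q (-a) * (theta q (-b) * qPochInf c (q ^ 2))) / 2) := by
  have h1 := hasSum_theta_mul hq0 hq (c := c) ha hb
  have h2 := hasSum_theta_mul hq0 hq (c := -c) (neg_ne_zero.2 ha) (neg_ne_zero.2 hb)
  rw [neg_neg] at h2
  have h3 := (h1.add h2).div_const 2
  let φ : ℤ × ℕ × ℤ → ℤ × ℤ × ℕ := fun x => (x.1, x.2.1 + 2 * x.2.2 - x.1, x.2.1)
  have hφ : Function.Injective φ := by
    rintro ⟨A, s, l⟩ ⟨A', s', l'⟩ h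
    simp only [φ, Prod.mk.injEq] at h ⊢
    omega
  have key : ∀ (A B : ℤ) (s : ℕ), (q ^ (A ^ 2) * a ^ A * (q ^ (B ^ 2) * b ^ B *
      (invPoch q s * q ^ ((s : ℤ) ^ 2 - s) * c ^ s))
      + q ^ (A ^ 2) * (-a) ^ A * (q ^ (B ^ 2) * (-b) ^ B *
      (invPoch q s * q ^ ((s : ℤ) ^ 2 - s) * (-c) ^ s))) / 2
      = q ^ (A ^ 2) * a ^ A * (q ^ (B ^ 2) * b ^ B *
      (invPoch q s * q ^ ((s : ℤ) ^ 2 - s) * c ^ s)) * ((1 + (-1) ^ (A + B + s)) / 2) := by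
    intro A B s
    rw [← neg_one_mul a, ← neg_one_mul b, neg_pow c, mul_zpow, mul_zpow,
      zpow_add₀ (by norm_num), zpow_add₀ (by norm_num), zpow_natCast]
    ring
  refine ((hφ.hasSum_iff ?_).2 h3).congr_fun fun x => ?_
  · rintro ⟨A, B, s⟩ hx
    dsimp only
    rw [key]
    have : Odd (A + B - s) := by
      rw [← Int.not_even_iff_odd]
      rintro ⟨l, hl⟩
      refine hx ⟨(A, s, l), ?_⟩
      simp only [φ, Prod.mk.injEq, true_and, and_true]
      omega
    have h4 : Odd (A + B + s) := by
      rw [show A + B + s = A + B - s + 2 * s by ring]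
      exact this.add_even (even_two_mul _)
    rw [h4.neg_one_zpow]
    ring
  · obtain ⟨A, s, l⟩ := x
    simp only [Function.comp, φ]
    rw [key]
    have h4 : Even (A + (s + 2 * l - A) + s) := ⟨s + l, by ring⟩
    rw [h4.neg_one_zpow]
    ring

/-- The terms of the expansion of `(q²; q²)_∞^2` times the triple series over the single index
`r`. -/
noncomputable def singleTerm (q : ℂ) (ε y : ℤ) (r : ℕ) : ℂ :=
  (-1) ^ r * q ^ ((r : ℤ) ^ 2 + r) * invPoch q r *
    ((theta q (q ^ (r - ε)) * (theta q (q ^ (r + y)) * qPochInf (-q ^ (1 - ε - r)) (q ^ 2))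
      + theta q (-q ^ (r - ε)) * (theta q (-q ^ (r + y)) * qPochInf (q ^ (1 - ε - r)) (q ^ 2))) / 2)

theorem hasSum_singleTerm (hq0 : q ≠ 0) (hq : ‖q‖ < 1) (hε : ε ^ 2 ≤ 1) (hy : y ^ 2 ≤ 4) {S : ℂ}
    (hS : HasSum (fun x : ℤ × ℕ × ℕ => reducedTerm q ε y x.1 x.2.1 x.2.2) S) :
    HasSum (singleTerm q ε y) (qPochInf (q ^ 2) (q ^ 2) * S) := by
  -- Letting `l` run over all integers adds only zero terms.
  have h1 : HasSum (fun x : ℤ × ℕ × ℤ => reducedTerm q ε y x.1 x.2.1 x.2.2) S := by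
    let φ : ℤ × ℕ × ℕ → ℤ × ℕ × ℤ := fun x => (x.1, x.2.1, x.2.2)
    have hφ : Function.Injective φ := by
      rintro ⟨A, s, l⟩ ⟨A', s', l'⟩ h
      simpa [φ] using h
    refine (hφ.hasSum_iff ?_).1 hS
    rintro ⟨A, s, l⟩ hx
    have : l < 0 := by
      by_contra h
      exact hx ⟨(A, s, l.toNat), by simp [φ]; omega⟩
    simp [reducedTerm, invPoch_of_neg q this]
  let f : (ℤ × ℕ × ℤ) × ℕ → ℂ := fun x =>
    (-1) ^ x.2 * q ^ (x.1.1 ^ 2 + (x.1.2.1 + 2 * x.1.2.2 - x.1.1) ^ 2 - ε * x.1.1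
      + y * (x.1.2.1 + 2 * x.1.2.2 - x.1.1) + (x.1.2.1 : ℤ) ^ 2 - ε * x.1.2.1
      + (x.2 : ℤ) ^ 2 + x.2 + 2 * x.2 * x.1.2.2) * (invPoch q x.1.2.1 * invPoch q x.2)
  have hf : Summable f := by
    obtain ⟨C, hC0, hC⟩ := exists_norm_invPoch_le hq
    refine ((geomSummable_int.prod (geomSummable_nat.prod geomSummable_int)).prod
      geomSummable_nat).summable hq0 hq (K := C * C) (d := 32) (c := 768)
      (E := fun x => x.1.1 ^ 2 + (x.1.2.1 + 2 * x.1.2.2 - x.1.1) ^ 2 - ε * x.1.1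
      + y * (x.1.2.1 + 2 * x.1.2.2 - x.1.1) + (x.1.2.1 : ℤ) ^ 2 - ε * x.1.2.1
      + (x.2 : ℤ) ^ 2 + x.2 + 2 * x.2 * x.1.2.2) (by norm_num) (fun x => ?_) fun x => ?_
    · simp only [f]
      rw [norm_mul, norm_mul, norm_pow, norm_neg, norm_one, one_pow, one_mul, mul_comm, norm_mul]
      exact mul_le_mul_of_nonneg_right
        (mul_le_mul (hC _) (hC _) (norm_nonneg _) hC0.le) (norm_nonneg _)
    · obtain ⟨⟨A, s, l⟩, r⟩ := x
      push_cast
      generalize hB : (s : ℤ) + 2 * l - A = B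
      have hl : 2 * l = A + B - s := by omega
      have h2 : 2 * |l| ≤ |A| + |B| + s := by
        have : |2 * l| = 2 * |l| := by rw [abs_mul]; rfl
        rw [← this, hl]
        refine (abs_sub _ _).trans ?_
        rw [Nat.abs_cast]
        linarith [abs_add_le A B]
      have hA : |A| ≤ A ^ 2 := abs_le_sq A
      have hB' : |B| ≤ B ^ 2 := abs_le_sq B
      have hs : (s : ℤ) ≤ (s : ℤ) ^ 2 := Int.le_self_sq s
      have hr : (r : ℤ) ≤ (r : ℤ) ^ 2 := Int.le_self_sq r
      have hr0 : (0 : ℤ) ≤ r := by positivity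
      have hs0 : (0 : ℤ) ≤ s := by positivity
      have hrl : 2 * (r : ℤ) * l = r * (A + B - s) := by rw [← hl]; ring
      rw [hrl]
      have e1 := sq_nonneg (A - 8 * ε)
      have e2 := sq_nonneg (B + 8 * y)
      have e3 := sq_nonneg ((s : ℤ) - 8 * ε)
      have e4 := sq_nonneg (7 * A + 4 * r)
      have e5 := sq_nonneg (7 * B + 4 * r)
      have e6 := sq_nonneg (7 * (s : ℤ) - 4 * r)
      nlinarith
  obtain ⟨S', hS'⟩ := hf
  have h2 := hS'.prod_fiberwise
    (g := fun x => qPochInf (q ^ 2) (q ^ 2) * reducedTerm q ε y x.1 x.2.1 x.2.2) fun x => by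
      obtain ⟨A, s, l⟩ := x
      have h := (hasSum_invPoch hq0 hq l).mul_right
        (q ^ (A ^ 2 + (s + 2 * l - A) ^ 2 - ε * A + y * (s + 2 * l - A) + (s : ℤ) ^ 2 - ε * s)
          * invPoch q s)
      have h3 : ∀ a b c d : ℂ, a * b * (c * d) = a * (c * (d * b)) := fun _ _ _ _ => by ring
      rw [h3] at h
      refine h.congr_fun fun r => ?_
      simp only [f]
      have h4 : q ^ (A ^ 2 + (s + 2 * l - A) ^ 2 - ε * A + y * (s + 2 * l - A) + (s : ℤ) ^ 2
          - ε * s + (r : ℤ) ^ 2 + r + 2 * r * l) = q ^ ((r : ℤ) ^ 2 + r + 2 * r * l)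
          * q ^ (A ^ 2 + (s + 2 * l - A) ^ 2 - ε * A + y * (s + 2 * l - A) + (s : ℤ) ^ 2
          - ε * s) := by
        rw [← zpow_add₀ hq0]; congr 1; ring
      rw [h4]; ring
  rw [(h1.mul_left _).unique h2]
  refine ((Equiv.prodComm _ _).hasSum_iff.2 hS').prod_fiberwise fun r => ?_
  have h3 := (hasSum_theta_mul_even hq0 hq (c := q ^ (1 - ε - r))
    (zpow_ne_zero (r - ε) hq0) (zpow_ne_zero (r + y) hq0)).mul_left
    ((-1) ^ r * q ^ ((r : ℤ) ^ 2 + r) * invPoch q r)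
  refine h3.congr_fun fun x => ?_
  obtain ⟨A, s, l⟩ := x
  simp only [f, Function.comp, Equiv.prodComm_apply, Prod.swap]
  have h4 : q ^ (A ^ 2 + (s + 2 * l - A) ^ 2 - ε * A + y * (s + 2 * l - A) + (s : ℤ) ^ 2
          - ε * s + (r : ℤ) ^ 2 + r + 2 * r * l) = q ^ ((r : ℤ) ^ 2 + r) * (q ^ (A ^ 2)
          * (q ^ (r - ε)) ^ A * (q ^ ((s + 2 * l - A) ^ 2) * (q ^ (r + y)) ^ (s + 2 * l - A)
          * (q ^ ((s : ℤ) ^ 2 - s) * (q ^ (1 - ε - r)) ^ s))) := by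
    rw [← zpow_natCast (q ^ (1 - ε - r)), ← zpow_mul, ← zpow_mul, ← zpow_mul]
    simp only [← zpow_add₀ hq0]
    congr 1; ring
  rw [h4]; ring

end

/-! ### The conjugate Bailey pair -/

/-- The identity `∑ [n, j] (a; q²)_j a^{n - j} = 1` for `q²`-binomial coefficients `[n, j]`,
divided by `(q²; q²)_n`. -/
theorem sum_qPoch_mul_pow {q : ℂ} (hq0 : q ≠ 0) (hq : ‖q‖ < 1) (n : ℕ) (a : ℂ) :
    ∑ j ∈ Finset.range (n + 1), qPoch a (q ^ 2) j * a ^ (n - j) * (invPoch q j * invPoch q (n - j))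
      = invPoch q n := by
  induction n with
  | zero => simp [qPoch]
  | succ n ih =>
    have hne : (1 - q ^ (2 * ((n + 1 : ℕ) : ℤ))) ≠ 0 := by
      refine sub_ne_zero.2 fun h => mul_pow_ne_one (norm_sq_lt_one hq) (norm_sq_lt_one hq) n ?_
      rw [h, ← pow_succ', ← pow_mul, ← zpow_natCast]
      push_cast; rfl
    refine mul_left_cancel₀ hne ?_
    have hr : (1 - q ^ (2 * ((n + 1 : ℕ) : ℤ))) * invPoch q ((n + 1 : ℕ) : ℤ) = invPoch q n := by
      rw [← invPoch_sub_one hq]; congr 1; push_cast; ring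
    rw [hr, ← ih, Finset.mul_sum]
    have hterm : ∀ j : ℕ, (1 - q ^ (2 * ((n + 1 : ℕ) : ℤ))) * (qPoch a (q ^ 2) j * a ^ (n + 1 - j)
        * (invPoch q j * invPoch q (((n + 1 : ℕ) : ℤ) - j)))
        = qPoch a (q ^ 2) j * a ^ (n + 1 - j) *
          (invPoch q ((j : ℤ) - 1) * invPoch q (((n + 1 : ℕ) : ℤ) - j))
        + qPoch a (q ^ 2) j * a ^ (n + 1 - j) * ((q ^ 2) ^ j
          * (invPoch q j * invPoch q (n - j))) := by
      intro j
      have h := invPoch_pascal hq0 hq ((n + 1 : ℕ) : ℤ) j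
      rw [show ((n + 1 : ℕ) : ℤ) - 1 - j = n - j by push_cast; ring] at h
      have h2 : q ^ (2 * (j : ℤ)) = (q ^ 2) ^ j := by
        rw [← pow_mul, ← zpow_natCast]; push_cast; rfl
      rw [h2] at h
      linear_combination (qPoch a (q ^ 2) j * a ^ (n + 1 - j)) * h
    simp_rw [hterm]
    rw [Finset.sum_add_distrib, Finset.sum_range_succ' _ (n + 1), Finset.sum_range_succ _ (n + 1)]
    rw [show (n : ℤ) - ((n + 1 : ℕ) : ℤ) = -1 by push_cast; ring,
      show ((0 : ℕ) : ℤ) - 1 = -1 by norm_num, invPoch_of_neg q (show (-1 : ℤ) < 0 by norm_num)]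
    simp only [mul_zero, zero_mul, add_zero]
    rw [← Finset.sum_add_distrib]
    refine Finset.sum_congr rfl fun j hj => ?_
    have hj' : j ≤ n := Nat.lt_succ_iff.1 (Finset.mem_range.1 hj)
    rw [show ((j + 1 : ℕ) : ℤ) - 1 = j by push_cast; ring,
      show ((n + 1 : ℕ) : ℤ) - ((j + 1 : ℕ) : ℤ) = n - j by push_cast; ring, qPoch_succ,
      Nat.add_sub_add_right, Nat.succ_sub hj', pow_succ a (n - j)]
    ring

theorem exists_norm_qPoch_le (a : ℂ) {q : ℂ} (hq : ‖q‖ < 1) :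
    ∃ C : ℝ, 0 < C ∧ ∀ n, ‖qPoch a q n‖ ≤ C := by
  obtain ⟨C, hC⟩ := (Metric.isBounded_range_of_tendsto _ (tendsto_qPoch a hq)).exists_norm_le
  exact ⟨max C 1, by positivity, fun n => (hC _ ⟨n, rfl⟩).trans (le_max_left _ _)⟩

/-- The limiting case `∑ (a)_N (-a)^N p^{N(N-1)/2} / ((p)_N (a²)_N) = (a)_∞ / (a²)_∞` of the
`q`-Gauss sum, multiplied by `(a²)_∞`, with `p = q²`. -/
theorem hasSum_qGauss {q : ℂ} (hq0 : q ≠ 0) (hq : ‖q‖ < 1) {a : ℂ} (ha : ‖a‖ < 1) :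
    HasSum (fun N : ℕ => qPoch a (q ^ 2) N * (-a) ^ N * q ^ ((N : ℤ) ^ 2 - N) * invPoch q N *
      qPochInf (a ^ 2 * (q ^ 2) ^ N) (q ^ 2)) (qPochInf a (q ^ 2)) := by
  -- Both sides are single sums of the double series `g`, where `n = N + k`.
  let g : ℕ × ℕ → ℂ := fun x => (-a) ^ x.1 * q ^ ((x.1 : ℤ) ^ 2 - x.1) *
    (qPoch a (q ^ 2) x.2 * a ^ (x.1 - x.2) * (invPoch q x.2 * invPoch q (x.1 - x.2)))
  let φ : ℕ × ℕ → ℕ × ℕ := fun x => (x.1 + x.2, x.1)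
  have hφ : Function.Injective φ := by
    rintro ⟨N, k⟩ ⟨N', k'⟩ h
    simp only [φ, Prod.mk.injEq] at h ⊢
    omega
  have hg0 : ∀ x ∉ Set.range φ, g x = 0 := by
    rintro ⟨n, N⟩ hx
    have : (n : ℤ) - N < 0 := by
      by_contra h
      refine hx ⟨(N, n - N), ?_⟩
      simp only [φ, Prod.mk.injEq, and_true]
      omega
    simp [g, invPoch_of_neg q this]
  have hgφ : ∀ N k : ℕ, g (φ (N, k)) = qPoch a (q ^ 2) N * (-a) ^ N * q ^ ((N : ℤ) ^ 2 - N)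
      * invPoch q N
      * (invPoch q k * q ^ ((k : ℤ) ^ 2 - k) * (-(a ^ 2 * (q ^ 2) ^ N)) ^ k) := by
    intro N k
    simp only [g, φ]
    have h1 : q ^ (((N + k : ℕ) : ℤ) ^ 2 - ((N + k : ℕ) : ℤ))
        = q ^ ((N : ℤ) ^ 2 - N) * q ^ ((k : ℤ) ^ 2 - k) * ((q ^ 2) ^ N) ^ k := by
      rw [← pow_mul, ← pow_mul, ← zpow_natCast q (2 * (N * k)), ← zpow_add₀ hq0, ← zpow_add₀ hq0]
      congr 1; push_cast; ring
    rw [h1, add_tsub_cancel_left, show ((N + k : ℕ) : ℤ) - N = k by push_cast; ring,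
      ← neg_mul, mul_pow, neg_pow (a ^ 2), pow_add, neg_pow a k]
    ring
  have hsum : Summable (g ∘ φ) := by
    obtain ⟨C, hC0, hC⟩ := exists_norm_invPoch_le hq
    obtain ⟨D, hD0, hD⟩ := exists_norm_qPoch_le a (norm_sq_lt_one hq)
    refine (geomSummable_nat.prod geomSummable_nat).summable hq0 hq (K := D * (C * C)) (d := 1)
      (c := 1) (E := fun x => ((x.1 + x.2 : ℕ) : ℤ) ^ 2 - ((x.1 + x.2 : ℕ) : ℤ)) one_ne_zero
      (fun x => ?_) fun x => ?_
    · obtain ⟨N, k⟩ := x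
      simp only [g, φ, Function.comp]
      rw [mul_comm (D * _), norm_mul, norm_mul, norm_mul, norm_mul, norm_mul, norm_pow, norm_pow,
        norm_neg, mul_comm (‖a‖ ^ (N + k)), mul_assoc]
      refine mul_le_mul_of_nonneg_left ?_ (norm_nonneg _)
      refine (mul_le_of_le_one_left (by positivity) (pow_le_one₀ (norm_nonneg a) ha.le)).trans ?_
      refine mul_le_mul ((mul_le_of_le_one_right (norm_nonneg _)
        (pow_le_one₀ (norm_nonneg a) ha.le)).trans (hD N))
        (mul_le_mul (hC _) (hC _) (norm_nonneg _) hC0.le) (by positivity) hD0.le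
    · have := sq_nonneg (((x.1 + x.2 : ℕ) : ℤ) - 1)
      push_cast at this ⊢
      nlinarith
  obtain ⟨S, hS⟩ := hsum
  have h1 := hS.prod_fiberwise fun N =>
    ((hasSum_euler hq0 hq (a ^ 2 * (q ^ 2) ^ N)).mul_left (qPoch a (q ^ 2) N * (-a) ^ N *
      q ^ ((N : ℤ) ^ 2 - N) * invPoch q N)).congr_fun fun k => hgφ N k
  have hgS : HasSum g S := (hφ.hasSum_iff hg0).1 hS
  have h2 := hgS.prod_fiberwise
    (g := fun n : ℕ => (-a) ^ n * q ^ ((n : ℤ) ^ 2 - n) * invPoch q n) fun n => by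
      rw [← sum_qPoch_mul_pow hq0 hq n a]
      refine HasSum.mul_left ((-a) ^ n * q ^ ((n : ℤ) ^ 2 - n))
        (hasSum_sum_of_ne_finset_zero fun j hj => ?_)
      rw [invPoch_of_neg q (k := (n : ℤ) - j) (by rw [Finset.mem_range] at hj; omega)]
      ring
  rwa [hasSum_unique_of_eq h2 (hasSum_euler hq0 hq a) fun n => by ring] at h1

/-- The limiting `q`-Gauss sum with `a = -q^{1 + δ} p^r`, shifted by `r`. -/
theorem hasSum_conjugate_nat {q : ℂ} (hq0 : q ≠ 0) (hq : ‖q‖ < 1) (δ r : ℕ) :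
    HasSum (fun n : ℕ => qPoch (-q ^ (1 + δ)) (q ^ 2) n * q ^ ((n : ℤ) ^ 2 + δ * n) *
      (invPoch q (n - r) * invPoch q (n + r + δ)))
      (q ^ ((r : ℤ) ^ 2 + δ * r)
        * (qPochInf (-q ^ (1 + δ)) (q ^ 2) / qPochInf (q ^ 2) (q ^ 2))) := by
  have hP := qPochInf_ne_zero_of_norm_lt (norm_sq_lt_one hq) (norm_sq_lt_one hq)
  have ha : ‖-q ^ (1 + δ) * (q ^ 2) ^ r‖ < 1 := by
    rw [norm_mul, norm_neg, ← pow_mul, norm_pow, norm_pow, ← pow_add]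
    exact pow_lt_one₀ (norm_nonneg q) hq (by omega)
  have h1 := (hasSum_qGauss hq0 hq ha).mul_left (qPoch (-q ^ (1 + δ)) (q ^ 2) r *
    q ^ ((r : ℤ) ^ 2 + δ * r) / qPochInf (q ^ 2) (q ^ 2))
  have h2 : qPoch (-q ^ (1 + δ)) (q ^ 2) r * q ^ ((r : ℤ) ^ 2 + δ * r)
      / qPochInf (q ^ 2) (q ^ 2) * qPochInf (-q ^ (1 + δ) * (q ^ 2) ^ r) (q ^ 2)
      = q ^ ((r : ℤ) ^ 2 + δ * r)
        * (qPochInf (-q ^ (1 + δ)) (q ^ 2) / qPochInf (q ^ 2) (q ^ 2)) := by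
    rw [qPochInf_eq_mul (-q ^ (1 + δ)) (norm_sq_lt_one hq) r]; ring
  rw [h2] at h1
  have hinj : Function.Injective fun N : ℕ => N + r := add_left_injective r
  refine (hinj.hasSum_iff ?_).1 (h1.congr_fun fun N => ?_)
  · intro n hn
    have : (n : ℤ) - r < 0 := by
      by_contra h
      exact hn ⟨n - r, by simp only; omega⟩
    simp [invPoch_of_neg q this]
  · have h3 : (-q ^ (1 + δ) * (q ^ 2) ^ r) ^ 2 * (q ^ 2) ^ N
        = q ^ (2 * ((N + 2 * r + δ : ℕ) : ℤ) + 2) := by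
      rw [show 2 * ((N + 2 * r + δ : ℕ) : ℤ) + 2 = ((2 * (N + 2 * r + δ) + 2 : ℕ) : ℤ) by
        push_cast; ring, zpow_natCast]
      ring
    rw [h3, qPochInf_zpow hq0 hq]
    simp only [Function.comp]
    rw [add_comm N r, qPoch_add, show (((r + N : ℕ) : ℤ) - r) = N by push_cast; ring,
      show (((r + N : ℕ) : ℤ) + r + δ) = ((N + 2 * r + δ : ℕ) : ℤ) by push_cast; ring,
      neg_mul, neg_neg]
    have h4 : q ^ (((r + N : ℕ) : ℤ) ^ 2 + δ * ((r + N : ℕ) : ℤ)) = q ^ ((r : ℤ) ^ 2 + δ * r)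
        * ((q ^ (1 + δ) * (q ^ 2) ^ r) ^ N * q ^ ((N : ℤ) ^ 2 - N)) := by
      rw [← pow_mul, ← pow_add, ← pow_mul, ← zpow_natCast q ((1 + δ + 2 * r) * N),
        ← zpow_add₀ hq0, ← zpow_add₀ hq0]
      congr 1; push_cast; ring
    rw [h4]
    field_simp

/-- The conjugate Bailey pair relative to `p^δ`, `δ ∈ {0, 1}`, `p = q²`, with parameter
`-q^{1 + δ}`; the index `r` may be any integer because of the symmetry `r ↦ -r - δ`. -/
theorem hasSum_conjugate {q : ℂ} (hq0 : q ≠ 0) (hq : ‖q‖ < 1) {δ : ℕ} (hδ : δ ≤ 1) (r : ℤ) :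
    HasSum (fun n : ℕ => qPoch (-q ^ (1 + δ)) (q ^ 2) n * q ^ ((n : ℤ) ^ 2 + δ * n) *
      (invPoch q (n - r) * invPoch q (n + r + δ)))
      (q ^ (r ^ 2 + δ * r)
        * (qPochInf (-q ^ (1 + δ)) (q ^ 2) / qPochInf (q ^ 2) (q ^ 2))) := by
  rcases lt_or_ge r 0 with hr | hr
  · obtain ⟨s, hs⟩ : ∃ s : ℕ, r = -s - δ := ⟨(-r - δ).toNat, by omega⟩
    have h := hasSum_conjugate_nat hq0 hq δ s
    rw [show ((s : ℤ) ^ 2 + δ * s) = r ^ 2 + δ * r by rw [hs]; ring] at h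
    refine h.congr_fun fun n => ?_
    rw [show (n : ℤ) - r = n + s + δ by omega, show (n : ℤ) + r + δ = n - s by omega]
    ring
  · lift r to ℕ using hr
    exact hasSum_conjugate_nat hq0 hq δ r

section

/-! ### Bailey pairs with `β_n` a multiple of `1 / (p; p)_{2n + δ}` -/

/-- The `p`-binomial coefficient divided by `(p; p)_L`, for `p = q²` and integers `L`, `k`. -/
noncomputable def qbin (q : ℂ) (L k : ℤ) : ℂ := invPoch q k * invPoch q (L - k)

variable {q : ℂ}

theorem qbin_symm (q : ℂ) (L k : ℤ) : qbin q L (L - k) = qbin q L k := by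
  simp [qbin, mul_comm]

theorem qbin_pascal (hq0 : q ≠ 0) (hq : ‖q‖ < 1) (L k : ℤ) :
    (1 - q ^ (2 * (L + 1))) * qbin q (L + 1) k = qbin q L (k - 1) + q ^ (2 * k) * qbin q L k := by
  have h := invPoch_pascal hq0 hq (L + 1) k
  rw [add_sub_cancel_right] at h
  rw [qbin, h, qbin, qbin, show L + 1 - k = L - (k - 1) by ring]

theorem qbin_pascal' (hq0 : q ≠ 0) (hq : ‖q‖ < 1) (L k : ℤ) :
    (1 - q ^ (2 * (L + 1))) * qbin q (L + 1) k
      = qbin q L k + q ^ (2 * (L + 1 - k)) * qbin q L (k - 1) := by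
  have h := qbin_pascal hq0 hq L (L + 1 - k)
  rw [qbin_symm, show L + 1 - k - 1 = L - k by ring, qbin_symm,
    show L + 1 - k = L - (k - 1) by ring, qbin_symm] at h
  rw [h, show L - (k - 1) = L + 1 - k by ring]

theorem qbin_eq (hq : ‖q‖ < 1) (L k : ℤ) :
    qbin q L k = (1 - q ^ (2 * (L + 1 - k))) * qbin q (L + 1) k := by
  rw [qbin, show L - k = L + 1 - k - 1 by ring, invPoch_sub_one hq, qbin]; ring

theorem one_sub_zpow_ne_zero (hq : ‖q‖ < 1) (n : ℕ) : 1 - q ^ (2 * ((n : ℤ) + 1)) ≠ 0 := by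
  refine sub_ne_zero.2 fun h => mul_pow_ne_one (norm_sq_lt_one hq) (norm_sq_lt_one hq) n ?_
  rw [h, ← pow_succ', ← pow_mul, ← zpow_natCast]
  push_cast; rfl

theorem invPoch_eq (hq : ‖q‖ < 1) (L : ℤ) :
    invPoch q L = (1 - q ^ (2 * (L + 1))) * invPoch q (L + 1) := by
  rw [← invPoch_sub_one hq, add_sub_cancel_right]

theorem summable_qbin (q : ℂ) (c : ℤ → ℂ) (L κ : ℤ) :
    Summable fun j : ℤ => c j * qbin q L (κ - 3 * j) := by
  refine summable_of_hasFiniteSupport ((Set.finite_Icc (-(|L| + |κ|)) (|L| + |κ|)).subset ?_)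
  intro j hj
  rw [Function.mem_support] at hj
  have h1 : 0 ≤ κ - 3 * j := by
    by_contra h
    exact hj (by rw [qbin, invPoch_of_neg q (not_le.1 h)]; ring)
  have h2 : 0 ≤ L - (κ - 3 * j) := by
    by_contra h
    exact hj (by rw [qbin, invPoch_of_neg q (not_le.1 h)]; ring)
  have := le_abs_self L
  have := neg_abs_le L
  have := le_abs_self κ
  have := neg_abs_le κ
  constructor <;> linarith

/-- Terms may be moved along a permutation of the index. -/
theorem hasSum_sub_comp_equiv {F G H : ℤ → ℂ} {S : ℂ} (hF : HasSum F S) (hH : Summable H)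
    (e : ℤ ≃ ℤ) (hG : ∀ j, G j = F j + (H j - H (e j))) : HasSum G S := by
  obtain ⟨T, hT⟩ := hH
  have := hF.add (hT.sub (e.hasSum_iff.2 hT))
  rw [sub_self, add_zero] at this
  exact this.congr_fun hG

/-- The involution `j ↦ -j - 1`. -/
def reflectSucc : ℤ ≃ ℤ where
  toFun j := -j - 1
  invFun j := -j - 1
  left_inv j := by ring
  right_inv j := by ring

theorem hasSum_of_mul_left {F : ℤ → ℂ} {S a b : ℂ} (ha : a ≠ 0) (hF : HasSum F S)
    {G : ℤ → ℂ} (hG : ∀ j, a * G j = F j) (hb : S = a * b) : HasSum G b := by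
  have h1 : HasSum (fun j => a * G j) (a * b) := by
    rw [← hb]; exact hF.congr_fun hG
  exact (hasSum_mul_left_iff ha).1 h1

/-- Terms of the Bailey pair with `β_n = 1 / (p; p)_{2n}` relative to `1`. -/
noncomputable def evenTerm (q : ℂ) (n : ℤ) (j : ℤ) : ℂ :=
  q ^ (12 * j ^ 2 + 2 * j) * qbin q (2 * n) (n - 3 * j)
    - q ^ (12 * j ^ 2 + 10 * j + 2) * qbin q (2 * n) (n - 1 - 3 * j)

/-- Terms of the Bailey pair with `β_n = 1 / (p; p)_{2n + 1}` relative to `p`. -/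
noncomputable def oddTerm (q : ℂ) (n : ℤ) (j : ℤ) : ℂ :=
  q ^ (12 * j ^ 2 + 2 * j) * qbin q (2 * n + 1) (n - 3 * j)
    - q ^ (12 * j ^ 2 + 10 * j + 2) * qbin q (2 * n + 1) (n - 1 - 3 * j)

/-- Pascal's recurrence; the additional terms cancel under `j ↦ -j - 1`. -/
theorem oddTerm_of_evenTerm (hq0 : q ≠ 0) (hq : ‖q‖ < 1) (n : ℕ)
    (h : HasSum (evenTerm q n) (invPoch q (2 * n))) :
    HasSum (oddTerm q n) (invPoch q (2 * n + 1)) := by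
  have hne : 1 - q ^ (2 * (2 * (n : ℤ) + 1)) ≠ 0 := by
    have := one_sub_zpow_ne_zero hq (2 * n); push_cast at this; exact this
  refine hasSum_of_mul_left hne (hasSum_sub_comp_equiv h (summable_qbin q
    (fun j => q ^ (12 * j ^ 2 + 8 * j + 2 * n + 2)) (2 * n) (n - 1)) reflectSucc fun j => rfl)
    (fun j => ?_) (invPoch_eq hq _)
  have h1 := qbin_pascal' hq0 hq (2 * n) (n - 3 * j)
  have h2 := qbin_pascal' hq0 hq (2 * n) (n - 1 - 3 * j)
  have h3 := qbin_symm q (2 * n) (n - 1 - 3 * j - 1)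
  rw [show 2 * (n : ℤ) - (n - 1 - 3 * j - 1) = n - 1 - 3 * reflectSucc j by
    simp only [reflectSucc, Equiv.coe_fn_mk]; ring] at h3
  rw [show (n : ℤ) - 3 * j - 1 = n - 1 - 3 * j by ring] at h1
  have e1 : q ^ (12 * j ^ 2 + 8 * j + 2 * n + 2)
      = q ^ (12 * j ^ 2 + 2 * j) * q ^ (2 * (2 * n + 1 - (n - 3 * j))) := by
    rw [← zpow_add₀ hq0]; congr 1; ring
  have e2 : q ^ (12 * reflectSucc j ^ 2 + 8 * reflectSucc j + 2 * n + 2)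
      = q ^ (12 * j ^ 2 + 10 * j + 2) * q ^ (2 * (2 * n + 1 - (n - 1 - 3 * j))) := by
    rw [← zpow_add₀ hq0]; congr 1; simp only [reflectSucc, Equiv.coe_fn_mk]; ring
  simp only [evenTerm, oddTerm]
  rw [e1, e2, h3]
  linear_combination q ^ (12 * j ^ 2 + 2 * j) * h1 - q ^ (12 * j ^ 2 + 10 * j + 2) * h2

/-- Pascal's recurrence; the additional terms cancel under `j ↦ -j`. -/
theorem evenTerm_of_oddTerm (hq0 : q ≠ 0) (hq : ‖q‖ < 1) (n : ℕ)
    (h : HasSum (oddTerm q n) (invPoch q (2 * n + 1))) :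
    HasSum (evenTerm q (n + 1)) (invPoch q (2 * (n + 1))) := by
  have hne : 1 - q ^ (2 * (2 * (n : ℤ) + 1 + 1)) ≠ 0 := by
    have := one_sub_zpow_ne_zero hq (2 * n + 1); push_cast at this; exact this
  refine hasSum_of_mul_left hne (hasSum_sub_comp_equiv h (summable_qbin q
    (fun j => q ^ (12 * j ^ 2 - 4 * j + 2 * n + 2)) (2 * n + 1) (n + 1)) (Equiv.neg ℤ)
    fun j => rfl) (fun j => ?_) ?_
  · have h1 := qbin_pascal hq0 hq (2 * n + 1) (n + 1 - 3 * j)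
    have h2 := qbin_pascal hq0 hq (2 * n + 1) (n - 3 * j)
    have h3 := qbin_symm q (2 * n + 1) (n - 3 * j)
    rw [show 2 * (n : ℤ) + 1 - (n - 3 * j) = n + 1 - 3 * (Equiv.neg ℤ) j by
      simp only [Equiv.neg_apply]; ring] at h3
    rw [show (n : ℤ) + 1 - 3 * j - 1 = n - 3 * j by ring] at h1
    rw [show (n : ℤ) - 3 * j - 1 = n - 1 - 3 * j by ring] at h2
    have e1 : q ^ (12 * j ^ 2 - 4 * j + 2 * n + 2)
        = q ^ (12 * j ^ 2 + 2 * j) * q ^ (2 * (n + 1 - 3 * j)) := by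
      rw [← zpow_add₀ hq0]; congr 1; ring
    have e2 : q ^ (12 * (Equiv.neg ℤ) j ^ 2 - 4 * (Equiv.neg ℤ) j + 2 * n + 2)
        = q ^ (12 * j ^ 2 + 10 * j + 2) * q ^ (2 * (n - 3 * j)) := by
      rw [← zpow_add₀ hq0]; congr 1; simp only [Equiv.neg_apply]; ring
    simp only [evenTerm, oddTerm]
    rw [e1, e2, h3, show 2 * ((n : ℤ) + 1) = 2 * n + 1 + 1 by ring,
      show (n : ℤ) + 1 - 1 - 3 * j = n - 3 * j by ring]
    linear_combination q ^ (12 * j ^ 2 + 2 * j) * h1 - q ^ (12 * j ^ 2 + 10 * j + 2) * h2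
  · rw [invPoch_eq hq, show 2 * ((n : ℤ) + 1) = 2 * n + 1 + 1 by ring]

theorem qbin_zero_of_ne {k : ℤ} (hk : k ≠ 0) : qbin q 0 k = 0 := by
  rcases lt_or_gt_of_ne hk with h | h
  · rw [qbin, invPoch_of_neg q h, zero_mul]
  · rw [qbin, invPoch_of_neg q (by omega : 0 - k < 0), mul_zero]

theorem hasSum_evenTerm (hq0 : q ≠ 0) (hq : ‖q‖ < 1) (n : ℕ) :
    HasSum (evenTerm q n) (invPoch q (2 * n)) := by
  induction n with
  | zero =>
    have h : evenTerm q (0 : ℕ) 0 = invPoch q (2 * (0 : ℕ)) := by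
      simp only [evenTerm, Nat.cast_zero, mul_zero, sub_zero, zero_sub]
      rw [qbin_zero_of_ne (by norm_num : (-1 : ℤ) ≠ 0)]
      simp [qbin]
    rw [← h]
    refine hasSum_single 0 fun j hj => ?_
    simp only [evenTerm, Nat.cast_zero, mul_zero]
    rw [qbin_zero_of_ne (by omega), qbin_zero_of_ne (by omega)]; ring
  | succ n ih =>
    have := evenTerm_of_oddTerm hq0 hq n (oddTerm_of_evenTerm hq0 hq n ih)
    push_cast
    exact this

theorem hasSum_oddTerm (hq0 : q ≠ 0) (hq : ‖q‖ < 1) (n : ℕ) :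
    HasSum (oddTerm q n) (invPoch q (2 * n + 1)) :=
  oddTerm_of_evenTerm hq0 hq n (hasSum_evenTerm hq0 hq n)

/-- The Bailey pair with `β_n = p^n / (p; p)_{2n + 1}` relative to `p`. -/
theorem hasSum_odd_pow (hq0 : q ≠ 0) (hq : ‖q‖ < 1) (n : ℕ) :
    HasSum (fun j : ℤ => q ^ (12 * j ^ 2 + 8 * j) *
      (qbin q (2 * n + 1) (n - 3 * j) - qbin q (2 * n + 1) (n - 1 - 3 * j)))
      (q ^ (2 * n) * invPoch q (2 * n + 1)) := by
  have hne : 1 - q ^ (2 * (2 * (n : ℤ) + 1)) ≠ 0 := by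
    have := one_sub_zpow_ne_zero hq (2 * n); push_cast at this; exact this
  refine hasSum_of_mul_left hne ((hasSum_sub_comp_equiv (hasSum_evenTerm hq0 hq n) (summable_qbin q
    (fun j => q ^ (12 * j ^ 2 + 10 * j + 2)) (2 * n) (n - 1)) reflectSucc fun j => rfl).mul_left
    (q ^ (2 * n))) (fun j => ?_) ?_
  · have h1 := qbin_pascal hq0 hq (2 * n) (n - 3 * j)
    have h2 := qbin_pascal' hq0 hq (2 * n) (n - 1 - 3 * j)
    have h3 := qbin_symm q (2 * n) (n - 1 - 3 * j - 1)
    rw [show 2 * (n : ℤ) - (n - 1 - 3 * j - 1) = n - 1 - 3 * reflectSucc j by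
      simp only [reflectSucc, Equiv.coe_fn_mk]; ring] at h3
    rw [show (n : ℤ) - 3 * j - 1 = n - 1 - 3 * j by ring] at h1
    have e1 : q ^ (2 * n) * q ^ (12 * j ^ 2 + 2 * j)
        = q ^ (12 * j ^ 2 + 8 * j) * q ^ (2 * (n - 3 * j)) := by
      rw [← zpow_natCast, ← zpow_add₀ hq0, ← zpow_add₀ hq0]; congr 1; push_cast; ring
    have e2 : q ^ (2 * n) * q ^ (12 * reflectSucc j ^ 2 + 10 * reflectSucc j + 2)
        = q ^ (12 * j ^ 2 + 8 * j) * q ^ (2 * (2 * n + 1 - (n - 1 - 3 * j))) := by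
      rw [← zpow_natCast, ← zpow_add₀ hq0, ← zpow_add₀ hq0]; congr 1
      simp only [reflectSucc, Equiv.coe_fn_mk]; push_cast; ring
    simp only [evenTerm]
    rw [h3]
    linear_combination q ^ (12 * j ^ 2 + 8 * j) * (h1 - h2) - qbin q (2 * n) (n - 3 * j) * e1
      + qbin q (2 * n) (n - 1 - 3 * j - 1) * e2
  · rw [invPoch_eq hq]; ring

theorem hasSum_even_pow_succ (hq0 : q ≠ 0) (hq : ‖q‖ < 1) (n : ℕ) :
    HasSum (fun j : ℤ => q ^ (12 * j ^ 2 + 4 * j) *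
      (qbin q (2 * n + 1 + 1) (n + 1 - 3 * j) - qbin q (2 * n + 1 + 1) (n - 3 * j)))
      (q ^ (2 * (n + 1)) * invPoch q (2 * n + 1 + 1)) := by
  have hne : 1 - q ^ (2 * (2 * (n : ℤ) + 1 + 1)) ≠ 0 := by
    have := one_sub_zpow_ne_zero hq (2 * n + 1); push_cast at this; exact this
  refine hasSum_of_mul_left hne ((hasSum_sub_comp_equiv (hasSum_oddTerm hq0 hq n) (summable_qbin q
    (fun j => -q ^ (12 * j ^ 2 + 2 * j)) (2 * n + 1) n) (Equiv.neg ℤ) fun j => rfl).mul_left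
    (q ^ (2 * (n + 1)))) (fun j => ?_) ?_
  · have h1 := qbin_pascal hq0 hq (2 * n + 1) (n + 1 - 3 * j)
    have h2 := qbin_pascal' hq0 hq (2 * n + 1) (n - 3 * j)
    have h3 := qbin_symm q (2 * n + 1) (n + 1 - 3 * j)
    rw [show 2 * (n : ℤ) + 1 - (n + 1 - 3 * j) = n - 3 * (Equiv.neg ℤ) j by
      simp only [Equiv.neg_apply]; ring] at h3
    rw [show (n : ℤ) + 1 - 3 * j - 1 = n - 3 * j by ring] at h1
    rw [show (n : ℤ) - 3 * j - 1 = n - 1 - 3 * j by ring] at h2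
    have e1 : q ^ (2 * (n + 1)) * q ^ (12 * (Equiv.neg ℤ) j ^ 2 + 2 * (Equiv.neg ℤ) j)
        = q ^ (12 * j ^ 2 + 4 * j) * q ^ (2 * (n + 1 - 3 * j)) := by
      rw [← zpow_natCast, ← zpow_add₀ hq0, ← zpow_add₀ hq0]; congr 1
      simp only [Equiv.neg_apply]; push_cast; ring
    have e2 : q ^ (2 * (n + 1)) * q ^ (12 * j ^ 2 + 10 * j + 2)
        = q ^ (12 * j ^ 2 + 4 * j) * q ^ (2 * (2 * n + 1 + 1 - (n - 3 * j))) := by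
      rw [← zpow_natCast, ← zpow_add₀ hq0, ← zpow_add₀ hq0]; congr 1
      push_cast; ring
    simp only [oddTerm]
    rw [h3]
    linear_combination q ^ (12 * j ^ 2 + 4 * j) * (h1 - h2)
      - qbin q (2 * n + 1) (n + 1 - 3 * j) * e1 + qbin q (2 * n + 1) (n - 1 - 3 * j) * e2
  · rw [invPoch_eq hq (2 * n + 1)]; ring

/-- The Bailey pair with `β_n = p^n / (p; p)_{2n}` relative to `1`. -/
theorem hasSum_even_pow (hq0 : q ≠ 0) (hq : ‖q‖ < 1) (n : ℕ) :
    HasSum (fun j : ℤ => q ^ (12 * j ^ 2 + 4 * j) *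
      (qbin q (2 * n) (n - 3 * j) - qbin q (2 * n) (n - 1 - 3 * j)))
      (q ^ (2 * n) * invPoch q (2 * n)) := by
  cases n with
  | zero =>
    have h : q ^ (12 * (0 : ℤ) ^ 2 + 4 * 0) * (qbin q (2 * (0 : ℕ)) ((0 : ℕ) - 3 * 0)
        - qbin q (2 * (0 : ℕ)) ((0 : ℕ) - 1 - 3 * 0)) = q ^ (2 * 0) * invPoch q (2 * (0 : ℕ)) := by
      simp only [Nat.cast_zero, mul_zero, sub_zero, zero_sub]
      rw [qbin_zero_of_ne (by norm_num : (-1 : ℤ) ≠ 0)]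
      simp [qbin]
    rw [← h]
    refine hasSum_single (f := fun j : ℤ => q ^ (12 * j ^ 2 + 4 * j) *
      (qbin q (2 * (0 : ℕ)) ((0 : ℕ) - 3 * j) - qbin q (2 * (0 : ℕ)) ((0 : ℕ) - 1 - 3 * j)))
      0 fun j hj => ?_
    simp only [Nat.cast_zero, mul_zero]
    rw [qbin_zero_of_ne (by omega), qbin_zero_of_ne (by omega)]; ring
  | succ n =>
    have := hasSum_even_pow_succ hq0 hq n
    rw [show 2 * (((n + 1 : ℕ)) : ℤ) = 2 * n + 1 + 1 by push_cast; ring]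
    refine this.congr_fun fun j => ?_
    rw [show ((n + 1 : ℕ) : ℤ) - 1 - 3 * j = n - 3 * j by push_cast; ring]
    push_cast; rfl

/-- The Bailey pair with `β_n = 1 / (p; p)_{2n}` relative to `p`. -/
theorem hasSum_odd_diff (hq0 : q ≠ 0) (hq : ‖q‖ < 1) (n : ℕ) :
    HasSum (fun j : ℤ => (q ^ (12 * j ^ 2 - 2 * j) - q ^ (12 * j ^ 2 + 10 * j + 2)) *
      qbin q (2 * n + 1) (n - 3 * j)) (invPoch q (2 * n)) := by
  refine hasSum_sub_comp_equiv (hasSum_evenTerm hq0 hq n) (summable_qbin q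
    (fun j => -q ^ (12 * j ^ 2 + 2 * j)) (2 * n) n) (Equiv.neg ℤ) fun j => ?_
  have h1 := qbin_symm q (2 * n) (n - 3 * j)
  rw [show 2 * (n : ℤ) - (n - 3 * j) = n - 3 * (Equiv.neg ℤ) j by
    simp only [Equiv.neg_apply]; ring, qbin_eq hq (2 * n) (n - 3 * j)] at h1
  have h2 := qbin_symm q (2 * n) (n - 1 - 3 * j)
  rw [show 2 * (n : ℤ) - (n - 1 - 3 * j) = 2 * n + 1 - (n - 3 * j) by ring, qbin_eq hq,
    qbin_symm] at h2
  have e1 : q ^ (12 * (Equiv.neg ℤ) j ^ 2 + 2 * (Equiv.neg ℤ) j) = q ^ (12 * j ^ 2 - 2 * j) := by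
    congr 1; simp only [Equiv.neg_apply]; ring
  have e2 : q ^ (12 * j ^ 2 - 2 * j) * q ^ (2 * (2 * n + 1 - (n - 3 * j)))
      = q ^ (12 * j ^ 2 + 10 * j + 2) * q ^ (2 * (2 * n + 1 - (2 * n + 1 - (n - 3 * j)))) := by
    rw [← zpow_add₀ hq0, ← zpow_add₀ hq0]; congr 1; ring
  simp only [evenTerm]
  rw [h1, e1, ← h2]
  linear_combination qbin q (2 * n + 1) (n - 3 * j) * e2

theorem hasSum_even_diff_succ (hq0 : q ≠ 0) (hq : ‖q‖ < 1) (n : ℕ) :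
    HasSum (fun j : ℤ => q ^ (12 * j ^ 2 - 2 * j) * qbin q (2 * n + 1 + 1) (n + 2 - 3 * j)
      - q ^ (12 * j ^ 2 + 10 * j + 2) * qbin q (2 * n + 1 + 1) (n - 1 - 3 * j))
      (invPoch q (2 * n + 1)) := by
  have h := hasSum_sub_comp_equiv (hasSum_oddTerm hq0 hq n) (summable_qbin q
    (fun j => -q ^ (12 * j ^ 2 + 2 * j)) (2 * n + 1) n) (Equiv.neg ℤ) fun j => rfl
  refine hasSum_sub_comp_equiv h (summable_qbin q (fun j => q ^ (12 * j ^ 2 - 8 * j + 4 + 2 * n))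
    (2 * n + 1 + 1) (n + 2)) (Equiv.addRight 1) fun j => ?_
  have h1 := qbin_eq hq (2 * n + 1) (n - 3 * (Equiv.neg ℤ) j)
  have h2 := qbin_eq hq (2 * n + 1) (n - 1 - 3 * j)
  have h3 := qbin_symm q (2 * n + 1 + 1) (n + 2 - 3 * j)
  rw [show 2 * (n : ℤ) + 1 + 1 - (n + 2 - 3 * j) = n - 3 * (Equiv.neg ℤ) j by
    simp only [Equiv.neg_apply]; ring] at h3
  have e0 : (n : ℤ) + 2 - 3 * (Equiv.addRight 1) j = n - 1 - 3 * j := by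
    simp only [Equiv.coe_addRight]; ring
  have e1 : q ^ (12 * (Equiv.neg ℤ) j ^ 2 + 2 * (Equiv.neg ℤ) j) = q ^ (12 * j ^ 2 - 2 * j) := by
    congr 1; simp only [Equiv.neg_apply]; ring
  have e2 : q ^ (12 * j ^ 2 - 8 * j + 4 + 2 * n) = q ^ (12 * j ^ 2 - 2 * j)
      * q ^ (2 * (2 * n + 1 + 1 - (n - 3 * (Equiv.neg ℤ) j))) := by
    rw [← zpow_add₀ hq0]; congr 1; simp only [Equiv.neg_apply]; ring
  have e3 : q ^ (12 * (Equiv.addRight 1) j ^ 2 - 8 * (Equiv.addRight 1) j + 4 + 2 * n)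
      = q ^ (12 * j ^ 2 + 10 * j + 2) * q ^ (2 * (2 * n + 1 + 1 - (n - 1 - 3 * j))) := by
    rw [← zpow_add₀ hq0]; congr 1; simp only [Equiv.coe_addRight]; ring
  simp only [oddTerm]
  rw [e0, e1, e2, e3, h1, h2, h3]
  ring

/-- The Bailey pair with `β_n = (1 - p^{2n}) / (p; p)_{2n}` relative to `1`. -/
theorem hasSum_even_diff (hq0 : q ≠ 0) (hq : ‖q‖ < 1) (n : ℕ) :
    HasSum (fun j : ℤ => q ^ (12 * j ^ 2 - 2 * j) * qbin q (2 * n) (n + 1 - 3 * j)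
      - q ^ (12 * j ^ 2 + 10 * j + 2) * qbin q (2 * n) (n - 2 - 3 * j))
      (invPoch q (2 * n - 1)) := by
  cases n with
  | zero =>
    simp only [Nat.cast_zero, mul_zero]
    rw [invPoch_of_neg q (by norm_num)]
    refine hasSum_zero.congr_fun fun j => ?_
    rw [qbin_zero_of_ne (by omega), qbin_zero_of_ne (by omega)]; ring
  | succ n =>
    have := hasSum_even_diff_succ hq0 hq n
    rw [show 2 * (((n + 1 : ℕ)) : ℤ) = 2 * n + 1 + 1 by push_cast; ring, add_sub_cancel_right]
    refine this.congr_fun fun j => ?_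
    rw [show ((n + 1 : ℕ) : ℤ) + 1 - 3 * j = n + 2 - 3 * j by push_cast; ring,
      show ((n + 1 : ℕ) : ℤ) - 2 - 3 * j = n - 1 - 3 * j by push_cast; ring]

end

section

/-! ### The quintuple product identity -/

variable {q : ℂ}

theorem hasSum_residues_three {g : ℤ → ℂ} {S : ℂ} (hg : HasSum g S) :
    HasSum (fun j : ℤ => g (3 * j) + g (3 * j + 1) + g (3 * j + 2)) S := by
  have h := (Int.divModEquiv 3).symm.hasSum_iff.2 hg
  refine h.prod_fiberwise (g := fun j : ℤ => g (3 * j) + g (3 * j + 1) + g (3 * j + 2))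
    fun j => ?_
  have h2 := hasSum_fintype fun c : Fin 3 => (g ∘ (Int.divModEquiv 3).symm) (j, c)
  rw [Fin.sum_univ_three] at h2
  simpa [Int.divModEquiv_symm_apply, mul_comm] using h2

/-- The product `(q⁴, q⁸, q¹²; q¹²)_∞ = (q⁴; q⁴)_∞` for the pentagonal number series. -/
theorem theta_cube (hq : ‖q‖ < 1) (hq0 : q ≠ 0) :
    theta (q ^ 6) (-q ^ (2 : ℤ)) = qPochInf (q ^ 4) (q ^ 4) := by
  have hq4 : ‖q ^ 4‖ < 1 := by
    rw [norm_pow]; exact pow_lt_one₀ (norm_nonneg q) hq four_ne_zero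
  rw [qPochInf_eq_prod (q ^ 4) hq4 (m := 3) (by norm_num), theta]
  simp only [Finset.prod_range_succ, Finset.prod_range_zero]
  rw [show -(-q ^ (2 : ℤ) * q ^ 6) = q ^ 4 * (q ^ 4) ^ 1 by
      rw [show (2 : ℤ) = ((2 : ℕ) : ℤ) by rfl, zpow_natCast]; ring,
    show -(q ^ 6 / -q ^ (2 : ℤ)) = q ^ 4 * (q ^ 4) ^ 0 by
      rw [show (2 : ℤ) = ((2 : ℕ) : ℤ) by rfl, zpow_natCast]; field_simp,
    show (q ^ 6) ^ 2 = q ^ 4 * (q ^ 4) ^ 2 by ring, show (q ^ 4) ^ 3 = q ^ 4 * (q ^ 4) ^ 2 by ring]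
  ring

/-- The series `∑ (-1)^n q^{6n² + 2cn}` for `c = ±1`. -/
theorem hasSum_pentagonal (hq0 : q ≠ 0) (hq : ‖q‖ < 1) {c : ℤ} (hc : c = 1 ∨ c = -1) :
    HasSum (fun n : ℤ => (-1) ^ n * q ^ (6 * n ^ 2 + 2 * c * n)) (qPochInf (q ^ 4) (q ^ 4)) := by
  have hq6 : ‖q ^ 6‖ < 1 := by
    rw [norm_pow]; exact pow_lt_one₀ (norm_nonneg q) hq (by norm_num)
  have h := hasSum_theta (pow_ne_zero 6 hq0) hq6
    (neg_ne_zero.2 (zpow_ne_zero (2 * c) hq0) : -q ^ (2 * c) ≠ 0)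
  have h1 : theta (q ^ 6) (-q ^ (2 * c)) = qPochInf (q ^ 4) (q ^ 4) := by
    rcases hc with rfl | rfl
    · exact theta_cube hq hq0
    · rw [← theta_cube hq hq0, ← theta_inv, inv_neg, ← zpow_neg]; norm_num
  rw [h1] at h
  refine h.congr_fun fun n => ?_
  rw [neg_eq_neg_one_mul (q ^ (2 * c)), mul_zpow, ← zpow_mul, ← zpow_natCast, ← zpow_mul,
    zpow_add₀ hq0]
  push_cast; ring

/-- The series `∑ (-1)^n q^{6n² - 6n}` vanishes. -/
theorem hasSum_triangular (hq0 : q ≠ 0) (hq : ‖q‖ < 1) :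
    HasSum (fun n : ℤ => (-1) ^ n * q ^ (6 * n ^ 2 - 6 * n)) 0 := by
  have hq6 : ‖q ^ 6‖ < 1 := by
    rw [norm_pow]; exact pow_lt_one₀ (norm_nonneg q) hq (by norm_num)
  have h := hasSum_theta (pow_ne_zero 6 hq0) hq6
    (inv_ne_zero (neg_ne_zero.2 (pow_ne_zero 6 hq0)) : (-q ^ 6)⁻¹ ≠ 0)
  rw [theta_inv, theta_neg_self (pow_ne_zero 6 hq0) hq6] at h
  refine h.congr_fun fun n => ?_
  rw [neg_eq_neg_one_mul (q ^ 6), mul_inv, mul_zpow, inv_neg_one, inv_zpow', ← zpow_natCast,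
    ← zpow_mul,
    ← zpow_mul, mul_left_comm, ← zpow_add₀ hq0]
  congr 2; push_cast; ring

/-- The quintuple product identity. The product of two triple products is regrouped along
`m + 2 n = N`; the inner sum depends only on `N` modulo `3`. -/
theorem hasSum_quintuple (hq0 : q ≠ 0) (hq : ‖q‖ < 1) {z : ℂ} (hz : z ≠ 0) :
    HasSum (fun j : ℤ => q ^ (3 * j ^ 2 + j) * (z ^ (3 * j) - z ^ (-3 * j - 1)))
      (qPochInf (q ^ 2) (q ^ 2) * qPochInf (z * q ^ 2) (q ^ 2) * qPochInf (1 / z) (q ^ 2) *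
        qPochInf (z ^ 2 * q ^ 2) (q ^ 4) * qPochInf (q ^ 2 / z ^ 2) (q ^ 4)) := by
  have hq2 := norm_sq_lt_one hq
  have hq20 := pow_ne_zero 2 hq0
  have hq4 : ‖q ^ 4‖ < 1 := by
    rw [norm_pow]; exact pow_lt_one₀ (norm_nonneg q) hq four_ne_zero
  have hP4 := qPochInf_ne_zero_of_norm_lt hq4 hq4
  have hw1 : -(z * q) ≠ 0 := neg_ne_zero.2 (mul_ne_zero hz hq0)
  have hw2 : -z ^ 2 ≠ 0 := neg_ne_zero.2 (pow_ne_zero 2 hz)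
  have h1 := hasSum_mul_of_summable_norm (hasSum_theta hq0 hq hw1) (hasSum_theta hq20 hq2 hw2)
    (summable_sq_mul_zpow hq _) (summable_sq_mul_zpow hq2 _)
  -- Pass to the indices `N = m + 2 n` and `n`.
  let e : ℤ × ℤ ≃ ℤ × ℤ :=
    { toFun := fun x => (x.1 - 2 * x.2, x.2)
      invFun := fun x => (x.1 + 2 * x.2, x.2)
      left_inv := fun x => by simp
      right_inv := fun x => by simp }
  have hterm : ∀ N n : ℤ, q ^ ((N - 2 * n) ^ 2) * (-(z * q)) ^ (N - 2 * n) *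
      ((q ^ 2) ^ (n ^ 2) * (-z ^ 2) ^ n)
      = (-1) ^ (N + n) * q ^ (6 * n ^ 2 - 4 * N * n - 2 * n + N ^ 2 + N) * z ^ N := by
    intro N n
    have hs : ((-1 : ℂ)) ^ (N - 2 * n) * (-1) ^ n = (-1) ^ (N + n) := by
      rw [← zpow_add₀ (by norm_num), show N + n = N - 2 * n + n + 2 * n by ring,
        zpow_add₀ (by norm_num) (N - 2 * n + n), zpow_mul _ 2 n]
      norm_num
    have hz' : z ^ (N - 2 * n) * z ^ (2 * n) = z ^ N := by
      rw [← zpow_add₀ hz]; congr 1; ring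
    have hq' : q ^ ((N - 2 * n) ^ 2) * q ^ (N - 2 * n) * q ^ (2 * n ^ 2)
        = q ^ (6 * n ^ 2 - 4 * N * n - 2 * n + N ^ 2 + N) := by
      rw [← zpow_add₀ hq0, ← zpow_add₀ hq0]; congr 1; ring
    rw [neg_eq_neg_one_mul (z * q), neg_eq_neg_one_mul (z ^ 2), mul_zpow, mul_zpow, mul_zpow,
      ← zpow_natCast q, ← zpow_natCast z, ← zpow_mul, ← zpow_mul, ← hs, ← hz', ← hq']
    push_cast; ring
  have h2 : HasSum (fun x : ℤ × ℤ => (-1) ^ (x.1 + x.2) *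
      q ^ (6 * x.2 ^ 2 - 4 * x.1 * x.2 - 2 * x.2 + x.1 ^ 2 + x.1) * z ^ x.1)
      (theta q (-(z * q)) * theta (q ^ 2) (-z ^ 2)) :=
    (e.hasSum_iff.2 h1).congr_fun fun x => (hterm x.1 x.2).symm
  obtain ⟨g, hg⟩ : ∃ g : ℤ → ℂ, ∀ N, HasSum (fun n : ℤ => (-1) ^ (N + n) *
      q ^ (6 * n ^ 2 - 4 * N * n - 2 * n + N ^ 2 + N) * z ^ N) (g N) :=
    ⟨_, fun N => (h2.summable.prod_factor N).hasSum⟩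
  have hg0 : ∀ j, g (3 * j)
      = q ^ (3 * j ^ 2 + j) * z ^ (3 * j) * qPochInf (q ^ 4) (q ^ 4) := by
    intro j
    refine hasSum_unique_of_eq ((Equiv.addRight j).hasSum_iff.2 (hg (3 * j)))
      ((hasSum_pentagonal hq0 hq (Or.inr rfl)).mul_left _) fun n => ?_
    simp only [Function.comp, Equiv.coe_addRight]
    rw [show 3 * j + (n + j) = n + 2 * (2 * j) by ring, zpow_add₀ (by norm_num), zpow_mul _ 2,
      show 6 * (n + j) ^ 2 - 4 * (3 * j) * (n + j) - 2 * (n + j) + (3 * j) ^ 2 + 3 * j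
        = (3 * j ^ 2 + j) + (6 * n ^ 2 + 2 * -1 * n) by ring, zpow_add₀ hq0]
    norm_num; ring
  have hg1 : ∀ j, g (3 * j + 1) = 0 := by
    intro j
    refine (hasSum_unique_of_eq ((Equiv.addRight j).hasSum_iff.2 (hg (3 * j + 1)))
      ((hasSum_triangular hq0 hq).mul_left (-(q ^ (3 * j ^ 2 + 3 * j + 2) * z ^ (3 * j + 1))))
      fun n => ?_).trans (mul_zero _)
    simp only [Function.comp, Equiv.coe_addRight]
    rw [show 3 * j + 1 + (n + j) = n + 2 * (2 * j) + 1 by ring, zpow_add₀ (by norm_num) _ 1,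
      zpow_add₀ (by norm_num), zpow_mul _ 2,
      show 6 * (n + j) ^ 2 - 4 * (3 * j + 1) * (n + j) - 2 * (n + j) + (3 * j + 1) ^ 2
        + (3 * j + 1) = (3 * j ^ 2 + 3 * j + 2) + (6 * n ^ 2 - 6 * n) by ring, zpow_add₀ hq0]
    norm_num; ring
  have hg2 : ∀ j, g (3 * j + 2)
      = -(q ^ (3 * j ^ 2 + 5 * j + 2) * z ^ (3 * j + 2)) * qPochInf (q ^ 4) (q ^ 4) := by
    intro j
    refine hasSum_unique_of_eq ((Equiv.addRight (j + 1)).hasSum_iff.2 (hg (3 * j + 2)))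
      ((hasSum_pentagonal hq0 hq (Or.inl rfl)).mul_left _) fun n => ?_
    simp only [Function.comp, Equiv.coe_addRight]
    rw [show 3 * j + 2 + (n + (j + 1)) = n + 2 * (2 * j + 1) + 1 by ring,
      zpow_add₀ (by norm_num) _ 1, zpow_add₀ (by norm_num), zpow_mul _ 2,
      show 6 * (n + (j + 1)) ^ 2 - 4 * (3 * j + 2) * (n + (j + 1)) - 2 * (n + (j + 1))
        + (3 * j + 2) ^ 2 + (3 * j + 2) = (3 * j ^ 2 + 5 * j + 2) + (6 * n ^ 2 + 2 * 1 * n) by ring,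
      zpow_add₀ hq0]
    norm_num; ring
  have h3 : HasSum g (theta q (-(z * q)) * theta (q ^ 2) (-z ^ 2)) :=
    h2.prod_fiberwise (g := g) hg
  have hH : Summable fun j : ℤ => -g (3 * j + 2) :=
    (h3.summable.comp_injective (i := fun j : ℤ => 3 * j + 2)
      (fun a b h => by simpa using h)).neg
  have h4 := hasSum_sub_comp_equiv (hasSum_residues_three h3) hH reflectSucc fun j => rfl
  refine hasSum_of_mul_left hP4 h4 (fun j => ?_) ?_
  · rw [hg0, hg1, hg2, hg2]
    simp only [reflectSucc, Equiv.coe_fn_mk]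
    rw [show 3 * (-j - 1) ^ 2 + 5 * (-j - 1) + 2 = 3 * j ^ 2 + j by ring,
      show 3 * (-j - 1) + 2 = -3 * j - 1 by ring]
    ring
  · rw [theta, theta, show -(-(z * q) * q) = z * q ^ 2 by ring,
      show -(q / -(z * q)) = 1 / z by field_simp, show -(-z ^ 2 * q ^ 2) = z ^ 2 * q ^ 2 by ring,
      show -(q ^ 2 / -z ^ 2) = q ^ 2 / z ^ 2 by field_simp, show (q ^ 2) ^ 2 = q ^ 4 by ring]
    ring

/-- The right-hand side of `hasSum_quintuple` for `q^7` and `z = q^{-a}`. -/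
noncomputable def quintuple (q : ℂ) (a : ℤ) : ℂ :=
  J₂ q a 14 * J₂ q (14 - 2 * a) 28 / J q 28

theorem J_ne_zero (hq : ‖q‖ < 1) {m : ℕ} (hm : m ≠ 0) : J q m ≠ 0 := by
  have h : ‖q ^ m‖ < 1 := by
    rw [norm_pow]; exact pow_lt_one₀ (norm_nonneg q) hq hm
  exact qPochInf_ne_zero_of_norm_lt h h

theorem hasSum_quintuple_zpow (hq0 : q ≠ 0) (hq : ‖q‖ < 1) (a : ℤ) :
    HasSum (fun j : ℤ => q ^ (21 * j ^ 2 + (7 - 3 * a) * j)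
      - q ^ (21 * j ^ 2 + (7 + 3 * a) * j + a))
      (quintuple q a) := by
  have hq7 : ‖q ^ 7‖ < 1 := by
    rw [norm_pow]; exact pow_lt_one₀ (norm_nonneg q) hq (by norm_num)
  have h := hasSum_quintuple (pow_ne_zero 7 hq0) hq7 (zpow_ne_zero (-a) hq0)
  have e : quintuple q a = qPochInf ((q ^ 7) ^ 2) ((q ^ 7) ^ 2) *
      qPochInf (q ^ (-a) * (q ^ 7) ^ 2) ((q ^ 7) ^ 2) * qPochInf (1 / q ^ (-a)) ((q ^ 7) ^ 2) *
      qPochInf ((q ^ (-a)) ^ 2 * (q ^ 7) ^ 2) ((q ^ 7) ^ 4) *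
      qPochInf ((q ^ 7) ^ 2 / (q ^ (-a)) ^ 2) ((q ^ 7) ^ 4) := by
    have hJ := J_ne_zero hq (m := 28) (by norm_num)
    have e1 : q ^ (-a) * (q ^ 7) ^ 2 = q ^ (((14 : ℕ) : ℤ) - a) := by
      rw [← pow_mul, ← zpow_natCast, ← zpow_add₀ hq0]; congr 1; push_cast; ring
    have e2 : 1 / q ^ (-a) = q ^ a := by rw [zpow_neg, one_div, inv_inv]
    have e3 : (q ^ (-a)) ^ 2 * (q ^ 7) ^ 2 = q ^ (14 - 2 * a) := by
      rw [← pow_mul, ← zpow_natCast, ← zpow_natCast, ← zpow_mul, ← zpow_add₀ hq0]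
      congr 1; push_cast; ring
    have e4 : (q ^ 7) ^ 2 / (q ^ (-a)) ^ 2 = q ^ (((28 : ℕ) : ℤ) - (14 - 2 * a)) := by
      rw [← pow_mul, ← zpow_natCast, ← zpow_natCast, ← zpow_mul, ← zpow_sub₀ hq0]
      congr 1; push_cast; ring
    rw [e1, e2, e3, e4, ← pow_mul, ← pow_mul, quintuple, J₂, J₂, div_eq_iff hJ, J]
    ring
  rw [e]
  refine h.congr_fun fun j => ?_
  rw [mul_sub, ← zpow_natCast q 7, ← zpow_mul, ← zpow_mul, ← zpow_mul, ← zpow_add₀ hq0,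
    ← zpow_add₀ hq0]
  congr 2 <;> push_cast <;> ring

end

section

/-! ### The single series as quintuple products -/

variable {q : ℂ}

/-- Bailey's lemma for a Bailey pair relative to `p^δ` with `α_r = q^{e₁ j}` for `r = r₁ j` and
`α_r = -q^{e₂ j}` for `r = r₂ j`, where `r` is any integer; the bounds on `e₁` and `e₂` serve only
the interchange of summations. -/
theorem hasSum_bailey (hq0 : q ≠ 0) (hq : ‖q‖ < 1) {δ : ℕ} (hδ : δ ≤ 1) {e₁ e₂ r₁ r₂ : ℤ → ℤ}
    (h₁ : ∀ j, |j| ≤ e₁ j + 100) (h₂ : ∀ j, |j| ≤ e₂ j + 100) {β : ℕ → ℂ} {T : ℂ}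
    (hβ : ∀ n : ℕ, HasSum (fun j => q ^ e₁ j * (invPoch q (n - r₁ j) * invPoch q (n + r₁ j + δ))
      - q ^ e₂ j * (invPoch q (n - r₂ j) * invPoch q (n + r₂ j + δ))) (β n))
    (hT : HasSum (fun j => q ^ (e₁ j + r₁ j ^ 2 + δ * r₁ j) - q ^ (e₂ j + r₂ j ^ 2 + δ * r₂ j)) T) :
    HasSum (fun n : ℕ => qPoch (-q ^ (1 + δ)) (q ^ 2) n * q ^ ((n : ℤ) ^ 2 + δ * n) * β n)
      (qPochInf (-q ^ (1 + δ)) (q ^ 2) / qPochInf (q ^ 2) (q ^ 2) * T) := by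
  set c : ℕ → ℂ := fun n => qPoch (-q ^ (1 + δ)) (q ^ 2) n * q ^ ((n : ℤ) ^ 2 + δ * n) with hc
  have hs : ∀ e r : ℤ → ℤ, (∀ j, |j| ≤ e j + 100) → Summable fun x : ℕ × ℤ =>
      c x.1 * (q ^ e x.2 * (invPoch q (x.1 - r x.2) * invPoch q (x.1 + r x.2 + δ))) := by
    intro e r he
    obtain ⟨C, hC0, hC⟩ := exists_norm_invPoch_le hq
    obtain ⟨D, hD0, hD⟩ := exists_norm_qPoch_le (-q ^ (1 + δ)) (norm_sq_lt_one hq)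
    refine (geomSummable_nat.prod geomSummable_int).summable hq0 hq (K := D * (C * C)) (d := 1)
      (c := 100) (E := fun x => ((x.1 : ℤ) ^ 2 + δ * x.1) + e x.2) one_ne_zero
      (fun x => ?_) fun x => ?_
    · rw [zpow_add₀ hq0, hc]
      simp only [norm_mul]
      calc _ = ‖q ^ ((x.1 : ℤ) ^ 2 + δ * x.1)‖ * ‖q ^ e x.2‖ *
            (‖qPoch (-q ^ (1 + δ)) (q ^ 2) x.1‖ *
              (‖invPoch q (x.1 - r x.2)‖ * ‖invPoch q (x.1 + r x.2 + δ)‖)) := by ring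
        _ ≤ ‖q ^ ((x.1 : ℤ) ^ 2 + δ * x.1)‖ * ‖q ^ e x.2‖ * (D * (C * C)) := by
          refine mul_le_mul_of_nonneg_left ?_ (by positivity)
          exact mul_le_mul (hD _) (mul_le_mul (hC _) (hC _) (norm_nonneg _) hC0.le)
            (by positivity) hD0.le
        _ = _ := by ring
    · have h := he x.2
      have h3 := abs_le_sq x.1
      rw [Nat.abs_cast] at h3
      have h4 : (0 : ℤ) ≤ δ * x.1 := by positivity
      push_cast
      linarith
  obtain ⟨S, hS⟩ := (hs e₁ r₁ h₁).sub (hs e₂ r₂ h₂)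
  have hn : HasSum (fun n => c n * β n) S := hS.prod_fiberwise (g := fun n : ℕ => c n * β n)
    fun n => ((hβ n).mul_left (c n)).congr_fun fun j => by ring
  have hj := ((Equiv.prodComm ℤ ℕ).hasSum_iff.2 hS).prod_fiberwise fun j =>
    (((hasSum_conjugate hq0 hq hδ (r₁ j)).mul_left (q ^ e₁ j)).sub
      ((hasSum_conjugate hq0 hq hδ (r₂ j)).mul_left (q ^ e₂ j))).congr_fun fun n => by
        simp only [Function.comp, Equiv.prodComm_apply, Prod.swap, hc]; ring
  rwa [hasSum_unique_of_eq hj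
    (hT.mul_left (qPochInf (-q ^ (1 + δ)) (q ^ 2) / qPochInf (q ^ 2) (q ^ 2)))
    fun j => by simp only [add_assoc, zpow_add₀ hq0]; ring] at hn

theorem hasSum_sub_reindex {f g : ℤ → ℂ} (hf : Summable f) (hg : Summable g) {T : ℂ}
    (h : HasSum (fun j => f j - g j) T) (σ τ : ℤ ≃ ℤ) :
    HasSum (fun j => f (σ j) - g (τ j)) T := by
  obtain ⟨a, ha⟩ := hf
  obtain ⟨b, hb⟩ := hg
  rw [h.unique (ha.sub hb)]
  exact (σ.hasSum_iff.2 ha).sub (τ.hasSum_iff.2 hb)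

theorem summable_quadratic (hq0 : q ≠ 0) (hq : ‖q‖ < 1) (b c : ℤ) :
    Summable fun j : ℤ => q ^ (21 * j ^ 2 + b * j + c) := by
  refine geomSummable_int.summable hq0 hq (K := 1) (d := 1) (c := (b ^ 2 + |c| + 1).natAbs)
    (E := fun j => 21 * j ^ 2 + b * j + c) one_ne_zero (fun j => (one_mul _).ge) fun j => ?_
  have h1 := abs_le_sq j
  have h2 := neg_abs_le c
  have h3 : (0 : ℤ) ≤ b ^ 2 + |c| + 1 := by positivity
  rw [Int.natCast_natAbs, Int.natCast_natAbs, abs_of_nonneg h3]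
  push_cast
  nlinarith [sq_nonneg (2 * j + b), sq_nonneg j]

/-- A linear term with coefficient of size at most `12` is dominated by `12 j²`; the exponents
below are written with a constant term, possibly `0`, to match this shape. -/
theorem abs_le_exponent {b c : ℤ} (hb : |b| ≤ 12) (hc : 0 ≤ c + 50) (j : ℤ) :
    |j| ≤ 12 * j ^ 2 + b * j + c + 100 := by
  have h1 := abs_le_sq j
  obtain ⟨h2, h3⟩ := abs_le.1 hb
  nlinarith [sq_nonneg (2 * j + b), sq_nonneg (j + 1), sq_nonneg (j - 1)]

/-- The Bailey pair is the one of `hasSum_evenTerm`; `hasSum_sub_reindex` adapts its two theta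
series to the form of the quintuple product identity. -/
theorem hasSum_even (hq0 : q ≠ 0) (hq : ‖q‖ < 1) :
    HasSum (fun n : ℕ => qPoch (-q) (q ^ 2) n * q ^ ((n : ℤ) ^ 2) * invPoch q (2 * n))
      (qPochInf (-q) (q ^ 2) / qPochInf (q ^ 2) (q ^ 2) * quintuple q 3) := by
  have hT := hasSum_sub_reindex (summable_quadratic hq0 hq (-2) 0) (summable_quadratic hq0 hq 16 3)
    ((hasSum_quintuple_zpow hq0 hq 3).congr_fun fun j => by ring_nf) (Equiv.neg ℤ) (Equiv.refl ℤ)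
  have h := hasSum_bailey hq0 hq (δ := 0) zero_le_one (e₁ := fun j => 12 * j ^ 2 + 2 * j + 0)
    (e₂ := fun j => 12 * j ^ 2 + 10 * j + 2)
    (r₁ := fun j => 3 * j) (r₂ := fun j => 3 * j + 1)
    (abs_le_exponent (by norm_num) (by norm_num)) (abs_le_exponent (by norm_num) (by norm_num))
    (fun n => (hasSum_evenTerm hq0 hq n).congr_fun fun j => by
      simp only [evenTerm, qbin]; push_cast; ring_nf)
    (hT.congr_fun fun j => by simp only [Equiv.neg_apply, Equiv.refl_apply]; push_cast; ring_nf)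
  rw [add_zero, pow_one] at h
  refine h.congr_fun fun n => ?_
  simp

theorem hasSum_even_mul_pow (hq0 : q ≠ 0) (hq : ‖q‖ < 1) :
    HasSum (fun n : ℕ => qPoch (-q) (q ^ 2) n * q ^ ((n : ℤ) ^ 2 + 2 * n) * invPoch q (2 * n))
      (qPochInf (-q) (q ^ 2) / qPochInf (q ^ 2) (q ^ 2) * quintuple q 1) := by
  have hT := hasSum_quintuple_zpow hq0 hq 1
  have h := hasSum_bailey hq0 hq (δ := 0) zero_le_one (e₁ := fun j => 12 * j ^ 2 + 4 * j + 0)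
    (e₂ := fun j => 12 * j ^ 2 + 4 * j + 0)
    (r₁ := fun j => 3 * j) (r₂ := fun j => 3 * j + 1)
    (abs_le_exponent (by norm_num) (by norm_num)) (abs_le_exponent (by norm_num) (by norm_num))
    (fun n => (hasSum_even_pow hq0 hq n).congr_fun fun j => by
      simp only [qbin]; push_cast; ring_nf)
    (hT.congr_fun fun j => by push_cast; ring_nf)
  rw [add_zero, pow_one] at h
  refine h.congr_fun fun n => ?_
  rw [zpow_add₀ hq0, ← zpow_natCast q (2 * n)]
  simp [mul_assoc]

/-- The Bailey pair is the one of `hasSum_even_diff`, with its index shifted by one. -/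
theorem hasSum_odd (hq0 : q ≠ 0) (hq : ‖q‖ < 1) :
    HasSum (fun n : ℕ =>
      qPoch (-q) (q ^ 2) (n + 1) * q ^ ((n : ℤ) ^ 2 + 2 * n) * invPoch q (2 * n + 1))
      (qPochInf (-q) (q ^ 2) / qPochInf (q ^ 2) (q ^ 2) * quintuple q 5) := by
  have hT := (hasSum_quintuple_zpow hq0 hq 5).mul_left q
  have h := hasSum_bailey hq0 hq (δ := 0) zero_le_one (e₁ := fun j => 12 * j ^ 2 + (-2) * j + 0)
    (e₂ := fun j => 12 * j ^ 2 + 10 * j + 2)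
    (r₁ := fun j => 3 * j - 1) (r₂ := fun j => 3 * j + 2)
    (abs_le_exponent (by norm_num) (by norm_num)) (abs_le_exponent (by norm_num) (by norm_num))
    (fun n => (hasSum_even_diff hq0 hq n).congr_fun fun j => by
      simp only [qbin]; push_cast; ring_nf)
    (hT.congr_fun fun j => by
      rw [mul_sub q, ← zpow_one_add₀ hq0, ← zpow_one_add₀ hq0]; push_cast; ring_nf)
  rw [add_zero, pow_one] at h
  have h1 : (qPochInf (-q) (q ^ 2) / qPochInf (q ^ 2) (q ^ 2) * quintuple q 5) * q
      = qPochInf (-q) (q ^ 2) / qPochInf (q ^ 2) (q ^ 2) * (q * quintuple q 5) := by ring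
  -- The term of index `0` vanishes.
  rw [← hasSum_nat_add_iff' 1, Finset.sum_range_one, invPoch_of_neg q (by norm_num), mul_zero,
    sub_zero, ← h1] at h
  refine (hasSum_mul_right_iff hq0).1 (h.congr_fun fun n => ?_)
  rw [show ((n + 1 : ℕ) : ℤ) ^ 2 + ((0 : ℕ) : ℤ) * ((n + 1 : ℕ) : ℤ) = (n : ℤ) ^ 2 + 2 * n + 1 by
    push_cast; ring, zpow_add_one₀ hq0,
    show 2 * ((n + 1 : ℕ) : ℤ) - 1 = 2 * n + 1 by push_cast; ring]
  ring

theorem hasSum_sq_odd (hq0 : q ≠ 0) (hq : ‖q‖ < 1) :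
    HasSum (fun n : ℕ => qPoch (-q ^ 2) (q ^ 2) n * q ^ ((n : ℤ) ^ 2 + n) * invPoch q (2 * n + 1))
      (qPochInf (-q ^ 2) (q ^ 2) / qPochInf (q ^ 2) (q ^ 2) * quintuple q 4) := by
  have hT := hasSum_sub_reindex (summable_quadratic hq0 hq (-5) 0) (summable_quadratic hq0 hq 19 4)
    ((hasSum_quintuple_zpow hq0 hq 4).congr_fun fun j => by ring_nf) (Equiv.neg ℤ) (Equiv.refl ℤ)
  have h := hasSum_bailey hq0 hq (δ := 1) le_rfl (e₁ := fun j => 12 * j ^ 2 + 2 * j + 0)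
    (e₂ := fun j => 12 * j ^ 2 + 10 * j + 2)
    (r₁ := fun j => 3 * j) (r₂ := fun j => 3 * j + 1)
    (abs_le_exponent (by norm_num) (by norm_num)) (abs_le_exponent (by norm_num) (by norm_num))
    (fun n => (hasSum_oddTerm hq0 hq n).congr_fun fun j => by
      simp only [oddTerm, qbin]; push_cast; ring_nf)
    (hT.congr_fun fun j => by simp only [Equiv.neg_apply, Equiv.refl_apply]; push_cast; ring_nf)
  rw [one_add_one_eq_two] at h
  refine h.congr_fun fun n => ?_
  simp

theorem hasSum_sq_odd_mul_pow (hq0 : q ≠ 0) (hq : ‖q‖ < 1) :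
    HasSum (fun n : ℕ =>
      qPoch (-q ^ 2) (q ^ 2) n * q ^ ((n : ℤ) ^ 2 + 3 * n) * invPoch q (2 * n + 1))
      (qPochInf (-q ^ 2) (q ^ 2) / qPochInf (q ^ 2) (q ^ 2) * quintuple q 6) := by
  have hT := hasSum_sub_reindex (summable_quadratic hq0 hq (-11) 0) (summable_quadratic hq0 hq 25 6)
    ((hasSum_quintuple_zpow hq0 hq 6).congr_fun fun j => by ring_nf) (Equiv.neg ℤ) reflectSucc
  have h := hasSum_bailey hq0 hq (δ := 1) le_rfl (e₁ := fun j => 12 * j ^ 2 + 8 * j + 0)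
    (e₂ := fun j => 12 * j ^ 2 + 8 * j + 0)
    (r₁ := fun j => 3 * j) (r₂ := fun j => 3 * j + 1)
    (abs_le_exponent (by norm_num) (by norm_num)) (abs_le_exponent (by norm_num) (by norm_num))
    (fun n => (hasSum_odd_pow hq0 hq n).congr_fun fun j => by
      simp only [qbin]; push_cast; ring_nf)
    (hT.congr_fun fun j => by
      simp only [Equiv.neg_apply, reflectSucc, Equiv.coe_fn_mk]; push_cast; ring_nf)
  rw [one_add_one_eq_two] at h
  refine h.congr_fun fun n => ?_
  rw [show (n : ℤ) ^ 2 + 3 * n = (n ^ 2 + n) + 2 * n by ring, zpow_add₀ hq0 _ (2 * (n : ℤ)),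
    ← zpow_natCast q (2 * n)]
  simp [mul_assoc]

theorem hasSum_sq_even (hq0 : q ≠ 0) (hq : ‖q‖ < 1) :
    HasSum (fun n : ℕ => qPoch (-q ^ 2) (q ^ 2) n * q ^ ((n : ℤ) ^ 2 + n) * invPoch q (2 * n))
      (qPochInf (-q ^ 2) (q ^ 2) / qPochInf (q ^ 2) (q ^ 2) * quintuple q 2) := by
  have hT := hasSum_quintuple_zpow hq0 hq 2
  have h := hasSum_bailey hq0 hq (δ := 1) le_rfl (e₁ := fun j => 12 * j ^ 2 + (-2) * j + 0)
    (e₂ := fun j => 12 * j ^ 2 + 10 * j + 2)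
    (r₁ := fun j => 3 * j) (r₂ := fun j => 3 * j)
    (abs_le_exponent (by norm_num) (by norm_num)) (abs_le_exponent (by norm_num) (by norm_num))
    (fun n => (hasSum_odd_diff hq0 hq n).congr_fun fun j => by
      simp only [qbin]; push_cast; ring_nf)
    (hT.congr_fun fun j => by push_cast; ring_nf)
  rw [one_add_one_eq_two] at h
  refine h.congr_fun fun n => ?_
  simp

end

section

/-! ### Evaluation of the three triple series -/

variable {q : ℂ}

theorem mul_sq_eq {σ : ℂ} (hσ : σ ^ 2 = 1) (q : ℂ) : (σ * q) ^ 2 = q ^ 2 := by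
  rw [mul_pow, hσ, one_mul]

theorem invPoch_congr {x : ℂ} (h : x ^ 2 = q ^ 2) (k : ℤ) : invPoch x k = invPoch q k := by
  rw [invPoch, invPoch, h]

theorem zpow_even_sign {σ : ℂ} (hσ : σ ^ 2 = 1) {m n : ℤ} (h : Even (m - n)) :
    σ ^ m = σ ^ n := by
  have h0 : σ ≠ 0 := by rintro rfl; norm_num at hσ
  obtain ⟨k, hk⟩ := h
  rw [show m = n + 2 * k by linarith, zpow_add₀ h0, zpow_mul,
    show σ ^ (2 : ℤ) = 1 from mod_cast hσ, one_zpow, mul_one]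

/-- The value of the theta function at `±q^{2m}`. -/
theorem theta_even (hq0 : q ≠ 0) (hq : ‖q‖ < 1) {σ : ℂ} (hσ : σ ^ 2 = 1) (m : ℤ) :
    theta q (σ * q ^ (2 * m)) = q ^ (-m ^ 2) * σ ^ m *
      (qPochInf (q ^ 2) (q ^ 2) * qPochInf (-(σ * q)) (q ^ 2) ^ 2) := by
  have h0 : σ ≠ 0 := by rintro rfl; norm_num at hσ
  have hi : q / σ = σ * q := by rw [div_eq_iff h0]; linear_combination -q * hσ
  rw [theta_mul_zpow hq0 hq h0, zpow_even_sign hσ (n := m) ⟨-m, by ring⟩, theta, hi]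
  ring

theorem theta_odd (hq0 : q ≠ 0) (hq : ‖q‖ < 1) (m : ℤ) :
    theta q (q ^ (2 * m + 1)) = q ^ (-m ^ 2 - m) *
      (2 * qPochInf (q ^ 2) (q ^ 2) * qPochInf (-q ^ 2) (q ^ 2) ^ 2) := by
  rw [zpow_add_one₀ hq0, mul_comm, theta_mul_zpow hq0 hq hq0, ← zpow_add₀ hq0, theta,
    div_self hq0, qPochInf_eq_one_sub_mul (-1) (norm_sq_lt_one hq)]
  rw [show -(q * q) = -q ^ 2 by ring, show -1 * q ^ 2 = -q ^ 2 by ring,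
    show -m ^ 2 + -m = -m ^ 2 - m by ring]
  ring

theorem theta_neg_odd (hq0 : q ≠ 0) (hq : ‖q‖ < 1) (m : ℤ) :
    theta q (-q ^ (2 * m + 1)) = 0 := by
  rw [zpow_add_one₀ hq0, show -(q ^ (2 * m) * q) = -q * q ^ (2 * m) by ring,
    theta_mul_zpow hq0 hq (neg_ne_zero.2 hq0), theta_neg_self hq0 hq, mul_zero]

theorem qPochInf_odd_shift (hq0 : q ≠ 0) (hq : ‖q‖ < 1) {σ : ℂ} (hσ : σ ^ 2 = 1) (n : ℕ) :
    qPochInf (-(σ * q ^ (1 - 2 * (n : ℤ)))) (q ^ 2) = q ^ (-(n : ℤ) ^ 2) * σ ^ (n : ℤ) *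
      (qPoch (-(σ * q)) (q ^ 2) n * qPochInf (-(σ * q)) (q ^ 2)) := by
  have h0 : σ ≠ 0 := by rintro rfl; norm_num at hσ
  induction n with
  | zero => simp [qPoch]
  | succ n ih =>
    have e1 : -(σ * q ^ (1 - 2 * ((n + 1 : ℕ) : ℤ))) * q ^ 2
        = -(σ * q ^ (1 - 2 * (n : ℤ))) := by
      rw [← zpow_natCast q 2, neg_mul, mul_assoc, ← zpow_add₀ hq0]
      congr 3; push_cast; ring
    have e2 : q ^ (-((n + 1 : ℕ) : ℤ) ^ 2)
        = q ^ (-(n : ℤ) ^ 2) * q ^ (1 - 2 * ((n + 1 : ℕ) : ℤ)) := by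
      rw [← zpow_add₀ hq0]; congr 1; push_cast; ring
    have e3 : q ^ (1 - 2 * ((n + 1 : ℕ) : ℤ)) * (q * (q ^ 2) ^ n) = 1 := by
      rw [← pow_mul, ← pow_succ', ← zpow_natCast, ← zpow_add₀ hq0]
      convert zpow_zero q using 2; push_cast; ring
    have e4 : σ ^ ((n + 1 : ℕ) : ℤ) = σ ^ (n : ℤ) * σ := by
      push_cast; exact zpow_add_one₀ h0 _
    rw [qPochInf_eq_one_sub_mul _ (norm_sq_lt_one hq), e1, ih, qPoch_succ, e2, e4]
    linear_combination (-(q ^ (-(n : ℤ) ^ 2) * σ ^ (n : ℤ) * (qPoch (-(σ * q)) (q ^ 2) n *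
      qPochInf (-(σ * q)) (q ^ 2)))) * (e3 * σ ^ 2 + hσ)

theorem qPochInf_even_shift (hq0 : q ≠ 0) (hq : ‖q‖ < 1) (n : ℕ) :
    qPochInf (-q ^ (-2 * (n : ℤ))) (q ^ 2) = 2 * q ^ (-(n : ℤ) ^ 2 - n) *
      (qPoch (-q ^ 2) (q ^ 2) n * qPochInf (-q ^ 2) (q ^ 2)) := by
  induction n with
  | zero =>
    rw [qPochInf_eq_one_sub_mul _ (norm_sq_lt_one hq)]
    simp [qPoch]; norm_num
  | succ n ih =>
    have e1 : -q ^ (-2 * ((n + 1 : ℕ) : ℤ)) * q ^ 2 = -q ^ (-2 * (n : ℤ)) := by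
      rw [← zpow_natCast q 2, neg_mul, ← zpow_add₀ hq0]
      congr 2; push_cast; ring
    have e2 : q ^ (-((n + 1 : ℕ) : ℤ) ^ 2 - ((n + 1 : ℕ) : ℤ))
        = q ^ (-(n : ℤ) ^ 2 - n) * q ^ (-2 * ((n + 1 : ℕ) : ℤ)) := by
      rw [← zpow_add₀ hq0]; congr 1; push_cast; ring
    have e3 : q ^ (-2 * ((n + 1 : ℕ) : ℤ)) * (q ^ 2 * (q ^ 2) ^ n) = 1 := by
      rw [← pow_mul, ← pow_add, ← zpow_natCast, ← zpow_add₀ hq0]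
      convert zpow_zero q using 2; push_cast; ring
    rw [qPochInf_eq_one_sub_mul _ (norm_sq_lt_one hq), e1, ih, qPoch_succ, e2]
    linear_combination (-(2 * q ^ (-(n : ℤ) ^ 2 - n) * (qPoch (-q ^ 2) (q ^ 2) n *
      qPochInf (-q ^ 2) (q ^ 2)))) * e3

/-- One of the two halves of `singleTerm`, which come from the parity condition on the central
index; `σ = ±1`. -/
noncomputable def halfTerm (q : ℂ) (ε y : ℤ) (σ : ℂ) (r : ℕ) : ℂ :=
  (-1) ^ r * q ^ ((r : ℤ) ^ 2 + r) * invPoch q r * (theta q (σ * q ^ (r - ε)) *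
    (theta q (σ * q ^ (r + y)) * qPochInf (-(σ * q ^ (1 - ε - r))) (q ^ 2)))

theorem singleTerm_eq (q : ℂ) (ε y : ℤ) (r : ℕ) :
    singleTerm q ε y r = (halfTerm q ε y 1 r + halfTerm q ε y (-1) r) / 2 := by
  simp only [singleTerm, halfTerm, one_mul, neg_one_mul, neg_neg]
  ring

theorem hasSum_nahmTerm {ε y : ℤ} (hq0 : q ≠ 0) (hq : ‖q‖ < 1) (hε : ε ^ 2 ≤ 1) (hy : y ^ 2 ≤ 4)
    {a a' b b' c : ℂ}
    (ha : HasSum (fun n : ℕ => halfTerm q ε y 1 (2 * n)) (qPochInf (q ^ 2) (q ^ 2) * a))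
    (ha' : HasSum (fun n : ℕ => halfTerm q ε y 1 (2 * n + 1)) (qPochInf (q ^ 2) (q ^ 2) * a'))
    (hb : HasSum (fun n : ℕ => halfTerm q ε y (-1) (2 * n)) (qPochInf (q ^ 2) (q ^ 2) * b))
    (hb' : HasSum (fun n : ℕ => halfTerm q ε y (-1) (2 * n + 1)) (qPochInf (q ^ 2) (q ^ 2) * b'))
    (hc : (a + a' + (b + b')) / 2 = c) :
    HasSum (nahmTerm q (-ε - y) (y + ε) (y - ε)) (c / qPochInf (q ^ 2) (q ^ 2)) := by
  have hP := qPochInf_ne_zero_of_norm_lt (norm_sq_lt_one hq) (norm_sq_lt_one hq)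
  obtain ⟨S, hS, hS'⟩ := exists_hasSum_nahmTerm hq0 hq hε hy
  have h1 := ((ha.even_add_odd ha').add (hb.even_add_odd hb')).div_const 2
  have h2 := hasSum_unique_of_eq (hasSum_singleTerm hq0 hq hε hy hS') h1
    fun n => singleTerm_eq q ε y n
  have : S = c := by
    refine mul_left_cancel₀ hP (h2.trans ?_)
    rw [← hc]; ring
  rwa [this] at hS

/-- The product, up to an elementary factor, to which `halfTerm` sums over the indices `r` for which
the theta functions are evaluated at even powers of `q`, up to sign; here `x = ±q`.
The product `(-σ q^{1 - ε - r}; q²)_∞` then starts with an odd power of `x`. -/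
noncomputable def oddProduct (x : ℂ) (a : ℤ) : ℂ := qPochInf (-x) (x ^ 2) ^ 6 * quintuple x a

/-- The product, up to an elementary factor, to which `halfTerm` sums over the indices `r` for which
the theta functions are evaluated at odd powers of `q` and the remaining product starts with an even
power. -/
noncomputable def evenProduct (q : ℂ) (a : ℤ) : ℂ :=
  qPochInf (-q ^ 2) (q ^ 2) ^ 6 * quintuple q a

theorem hasSum_odd_contribution {σ : ℂ} (hσ : σ ^ 2 = 1) (hq : ‖q‖ < 1)
    {f u : ℕ → ℂ} {a : ℤ} {k : ℂ}
    (hu : HasSum u (qPochInf (-(σ * q)) ((σ * q) ^ 2) / qPochInf ((σ * q) ^ 2) ((σ * q) ^ 2)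
      * quintuple (σ * q) a))
    (hf : ∀ n, f n = k * (qPochInf (q ^ 2) (q ^ 2) ^ 2 * qPochInf (-(σ * q)) (q ^ 2) ^ 5 * u n)) :
    HasSum f (qPochInf (q ^ 2) (q ^ 2) * (k * oddProduct (σ * q) a)) := by
  have hP := qPochInf_ne_zero_of_norm_lt (norm_sq_lt_one hq) (norm_sq_lt_one hq)
  have h := ((hu.mul_left (qPochInf (q ^ 2) (q ^ 2) ^ 2 *
    qPochInf (-(σ * q)) (q ^ 2) ^ 5)).mul_left k).congr_fun hf
  rw [mul_sq_eq hσ] at h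
  have e : qPochInf (q ^ 2) (q ^ 2) * (k * oddProduct (σ * q) a)
      = k * (qPochInf (q ^ 2) (q ^ 2) ^ 2 * qPochInf (-(σ * q)) (q ^ 2) ^ 5 *
        (qPochInf (-(σ * q)) (q ^ 2) / qPochInf (q ^ 2) (q ^ 2) * quintuple (σ * q) a)) := by
    rw [oddProduct, mul_sq_eq hσ]
    field_simp
  rwa [e]

theorem hasSum_even_contribution (hq : ‖q‖ < 1)
    {f u : ℕ → ℂ} {a : ℤ} {k : ℂ}
    (hu : HasSum u (qPochInf (-q ^ 2) (q ^ 2) / qPochInf (q ^ 2) (q ^ 2) * quintuple q a))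
    (hf : ∀ n, f n = k * (8 * qPochInf (q ^ 2) (q ^ 2) ^ 2 * qPochInf (-q ^ 2) (q ^ 2) ^ 5 * u n)) :
    HasSum f (qPochInf (q ^ 2) (q ^ 2) * (k * (8 * evenProduct q a))) := by
  have hP := qPochInf_ne_zero_of_norm_lt (norm_sq_lt_one hq) (norm_sq_lt_one hq)
  have h := ((hu.mul_left (8 * qPochInf (q ^ 2) (q ^ 2) ^ 2 *
    qPochInf (-q ^ 2) (q ^ 2) ^ 5)).mul_left k).congr_fun hf
  have e : qPochInf (q ^ 2) (q ^ 2) * (k * (8 * evenProduct q a))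
      = k * (8 * qPochInf (q ^ 2) (q ^ 2) ^ 2 * qPochInf (-q ^ 2) (q ^ 2) ^ 5 *
        (qPochInf (-q ^ 2) (q ^ 2) / qPochInf (q ^ 2) (q ^ 2) * quintuple q a)) := by
    rw [evenProduct]
    field_simp
  rwa [e]

theorem hasSum_halfTerm_neg_one (hq0 : q ≠ 0) (hq : ‖q‖ < 1) {ε y : ℤ} {r : ℕ → ℕ}
    (h : ∀ n, Odd ((r n : ℤ) - ε)) :
    HasSum (fun n => halfTerm q ε y (-1) (r n)) (qPochInf (q ^ 2) (q ^ 2) * 0) := by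
  rw [mul_zero]
  refine hasSum_zero.congr_fun fun n => ?_
  obtain ⟨k, hk⟩ := h n
  rw [halfTerm, neg_one_mul, hk, theta_neg_odd hq0 hq]; ring

theorem norm_sign_mul_lt {σ : ℂ} (hσ : σ ^ 2 = 1) (hq : ‖q‖ < 1) : ‖σ * q‖ < 1 := by
  have h : ‖σ‖ ^ 2 = 1 := by rw [← norm_pow, hσ, norm_one]
  rw [norm_mul, (pow_eq_one_iff_of_nonneg (norm_nonneg σ) two_ne_zero).1 h, one_mul]
  exact hq

theorem sign_mul_ne_zero {σ : ℂ} (hσ : σ ^ 2 = 1) (hq0 : q ≠ 0) : σ * q ≠ 0 := by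
  refine mul_ne_zero (fun h => ?_) hq0
  rw [h] at hσ
  norm_num at hσ

/-- The reduced form of `halfTerm` for `r ≡ ε ≡ y` modulo `2`; it depends on `σ` and `q` only
through `x = σ q`. -/
theorem halfTerm_of_even (hq0 : q ≠ 0) (hq : ‖q‖ < 1) {σ : ℂ} (hσ : σ ^ 2 = 1) {ε y m l : ℤ}
    {r k : ℕ} (hm : r - ε = 2 * m) (hl : r + y = 2 * l) (hk : r + ε = 2 * k) {N : ℤ}
    (hN : (r : ℤ) ^ 2 + r - m ^ 2 - l ^ 2 - k ^ 2 = N) (hp : Even (m + l + k - N)) :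
    halfTerm q ε y σ r = (-1) ^ r * (qPochInf (q ^ 2) (q ^ 2) ^ 2 *
      qPochInf (-(σ * q)) (q ^ 2) ^ 5 *
      (qPoch (-(σ * q)) ((σ * q) ^ 2) k * (σ * q) ^ N * invPoch (σ * q) r)) := by
  have h0 : σ ≠ 0 := by rintro rfl; norm_num at hσ
  rw [halfTerm, hm, hl, show (1 : ℤ) - ε - r = 1 - 2 * k by linarith, theta_even hq0 hq hσ,
    theta_even hq0 hq hσ, qPochInf_odd_shift hq0 hq hσ, mul_sq_eq hσ,
    invPoch_congr (mul_sq_eq hσ q), mul_zpow, ← zpow_even_sign hσ hp, ← hN]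
  have e1 : q ^ ((r : ℤ) ^ 2 + r - m ^ 2 - l ^ 2 - k ^ 2)
      = q ^ ((r : ℤ) ^ 2 + r) * q ^ (-m ^ 2) * q ^ (-l ^ 2) * q ^ (-(k : ℤ) ^ 2) := by
    simp only [← zpow_add₀ hq0]; congr 1
  rw [e1, zpow_add₀ h0, zpow_add₀ h0]
  ring

theorem halfTerm_of_odd (hq0 : q ≠ 0) (hq : ‖q‖ < 1) {ε y m l : ℤ}
    {r k : ℕ} (hm : r - ε = 2 * m + 1) (hl : r + y = 2 * l + 1) (hk : r + ε = 2 * k + 1) {N : ℤ}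
    (hN : (r : ℤ) ^ 2 + r - m ^ 2 - m - l ^ 2 - l - k ^ 2 - k = N) :
    halfTerm q ε y 1 r = (-1) ^ r * (8 * qPochInf (q ^ 2) (q ^ 2) ^ 2 *
      qPochInf (-q ^ 2) (q ^ 2) ^ 5 * (qPoch (-q ^ 2) (q ^ 2) k * q ^ N * invPoch q r)) := by
  rw [halfTerm, hm, hl, show (1 : ℤ) - ε - r = -2 * k by linarith, one_mul, one_mul, one_mul,
    theta_odd hq0 hq, theta_odd hq0 hq, qPochInf_even_shift hq0 hq, ← hN]
  have e1 : q ^ ((r : ℤ) ^ 2 + r - m ^ 2 - m - l ^ 2 - l - k ^ 2 - k)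
      = q ^ ((r : ℤ) ^ 2 + r) * q ^ (-m ^ 2 - m) * q ^ (-l ^ 2 - l) * q ^ (-(k : ℤ) ^ 2 - k) := by
    simp only [← zpow_add₀ hq0]; congr 1; ring
  rw [e1]
  ring

theorem hasSum_nahmTerm_zero_zero (hq0 : q ≠ 0) (hq : ‖q‖ < 1) :
    HasSum (nahmTerm q 0 0 0) ((1 / 2 * oddProduct q 1 + 1 / 2 * oddProduct (-q) 1
      - 4 * q ^ 2 * evenProduct q 6) / qPochInf (q ^ 2) (q ^ 2)) := by
  have hev : ∀ σ : ℂ, σ ^ 2 = 1 → HasSum (fun n : ℕ => halfTerm q 0 0 σ (2 * n))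
      (qPochInf (q ^ 2) (q ^ 2) * (1 * oddProduct (σ * q) 1)) := fun σ hσ =>
    hasSum_odd_contribution hσ hq
      (hasSum_even_mul_pow (sign_mul_ne_zero hσ hq0) (norm_sign_mul_lt hσ hq)) fun n => by
      rw [halfTerm_of_even hq0 hq hσ (m := n) (l := n) (k := n) (N := n ^ 2 + 2 * n)
        (by push_cast; ring) (by push_cast; ring) (by push_cast; ring) (by push_cast; ring)
        (by rw [show (n : ℤ) + n + n - (n ^ 2 + 2 * n) = n * (n + 1) - 2 * n ^ 2 by ring]
            exact (Int.even_mul_succ_self n).sub (even_two_mul _)), pow_mul]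
      push_cast; norm_num
  have hod : HasSum (fun n : ℕ => halfTerm q 0 0 1 (2 * n + 1))
      (qPochInf (q ^ 2) (q ^ 2) * (-q ^ 2 * (8 * evenProduct q 6))) :=
    hasSum_even_contribution hq (hasSum_sq_odd_mul_pow hq0 hq) fun n => by
      rw [halfTerm_of_odd hq0 hq (m := n) (l := n) (k := n) (N := n ^ 2 + 3 * n + (2 : ℕ))
        (by push_cast; ring) (by push_cast; ring) (by push_cast; ring) (by push_cast; ring),
        pow_succ (-1 : ℂ), pow_mul, zpow_add₀ hq0, zpow_natCast]
      push_cast; norm_num; ring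
  exact hasSum_nahmTerm hq0 hq (ε := 0) (y := 0) (by norm_num) (by norm_num)
    (hev 1 (by norm_num)) hod (hev (-1) (by norm_num))
    (hasSum_halfTerm_neg_one hq0 hq fun n => ⟨n, by push_cast; ring⟩)
    (by rw [one_mul q, neg_one_mul q]; ring)

theorem hasSum_nahmTerm_zero_two (hq0 : q ≠ 0) (hq : ‖q‖ < 1) :
    HasSum (nahmTerm q (-2) 2 2) ((1 / (2 * q) * oddProduct q 3 - 1 / (2 * q) * oddProduct (-q) 3
      - 4 * evenProduct q 4) / qPochInf (q ^ 2) (q ^ 2)) := by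
  have hev : ∀ σ : ℂ, σ ^ 2 = 1 → HasSum (fun n : ℕ => halfTerm q 0 2 σ (2 * n))
      (qPochInf (q ^ 2) (q ^ 2) * ((σ * q)⁻¹ * oddProduct (σ * q) 3)) := fun σ hσ =>
    hasSum_odd_contribution hσ hq
      (hasSum_even (sign_mul_ne_zero hσ hq0) (norm_sign_mul_lt hσ hq)) fun n => by
      rw [halfTerm_of_even hq0 hq hσ (m := n) (l := n + 1) (k := n) (N := n ^ 2 - 1)
        (by push_cast; ring) (by push_cast; ring) (by push_cast; ring) (by push_cast; ring)
        (by rw [show (n : ℤ) + (n + 1) + n - (n ^ 2 - 1) = 2 * (2 * n + 1) - n * (n + 1) by ring]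
            exact (even_two_mul _).sub (Int.even_mul_succ_self n)), pow_mul,
        zpow_sub_one₀ (sign_mul_ne_zero hσ hq0)]
      push_cast; norm_num; ring
  have hod : HasSum (fun n : ℕ => halfTerm q 0 2 1 (2 * n + 1))
      (qPochInf (q ^ 2) (q ^ 2) * (-1 * (8 * evenProduct q 4))) :=
    hasSum_even_contribution hq (hasSum_sq_odd hq0 hq) fun n => by
      rw [halfTerm_of_odd hq0 hq (m := n) (l := n + 1) (k := n) (N := n ^ 2 + n)
        (by push_cast; ring) (by push_cast; ring) (by push_cast; ring) (by push_cast; ring),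
        pow_succ (-1 : ℂ), pow_mul]
      push_cast; norm_num
  exact hasSum_nahmTerm hq0 hq (ε := 0) (y := 2) (by norm_num) (by norm_num)
    (hev 1 (by norm_num)) hod (hev (-1) (by norm_num))
    (hasSum_halfTerm_neg_one hq0 hq fun n => ⟨n, by push_cast; ring⟩)
    (by rw [one_mul q, neg_one_mul q, inv_neg]; field_simp; ring)

theorem hasSum_nahmTerm_one_one (hq0 : q ≠ 0) (hq : ‖q‖ < 1) :
    HasSum (nahmTerm q (-2) 2 0) ((4 * evenProduct q 2 - 1 / 2 * oddProduct (-q) 5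
      - 1 / 2 * oddProduct q 5) / qPochInf (q ^ 2) (q ^ 2)) := by
  have hod : ∀ σ : ℂ, σ ^ 2 = 1 → HasSum (fun n : ℕ => halfTerm q 1 1 σ (2 * n + 1))
      (qPochInf (q ^ 2) (q ^ 2) * (-1 * oddProduct (σ * q) 5)) := fun σ hσ =>
    hasSum_odd_contribution hσ hq
      (hasSum_odd (sign_mul_ne_zero hσ hq0) (norm_sign_mul_lt hσ hq)) fun n => by
      rw [halfTerm_of_even hq0 hq hσ (m := n) (l := n + 1) (k := n + 1) (N := n ^ 2 + 2 * n)
        (by push_cast; ring) (by push_cast; ring) (by push_cast; ring) (by push_cast; ring)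
        (by push_cast
            rw [show (n : ℤ) + (n + 1) + (n + 1) - (n ^ 2 + 2 * n)
              = 2 * (n + 1) - n * (n + 1) + 2 * 0 by ring]
            exact ((even_two_mul _).sub (Int.even_mul_succ_self n)).add (even_two_mul _)),
        pow_succ (-1 : ℂ), pow_mul]
      push_cast; norm_num
  have hev : HasSum (fun n : ℕ => halfTerm q 1 1 1 (2 * n))
      (qPochInf (q ^ 2) (q ^ 2) * (1 * (8 * evenProduct q 2))) :=
    hasSum_even_contribution hq (hasSum_sq_even hq0 hq) fun n => by
      rw [halfTerm_of_odd hq0 hq (m := n - 1) (l := n) (k := n) (N := n ^ 2 + n)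
        (by push_cast; ring) (by push_cast; ring) (by push_cast; ring) (by push_cast; ring),
        pow_mul]
      push_cast; norm_num
  exact hasSum_nahmTerm hq0 hq (ε := 1) (y := 1) (by norm_num) (by norm_num)
    hev (hod 1 (by norm_num))
    (hasSum_halfTerm_neg_one hq0 hq fun n => ⟨n - 1, by push_cast; ring⟩) (hod (-1) (by norm_num))
    (by rw [one_mul q, neg_one_mul q]; ring)

end

section

/-! ### Infinite products of level `28` -/

variable {q : ℂ}

/-- `(q^r; q^28)_∞`. -/
noncomputable def residueProd (q : ℂ) (r : ℕ) : ℂ := qPochInf (q ^ r) (q ^ 28)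

theorem norm_pow_lt_one (hq : ‖q‖ < 1) {m : ℕ} (hm : m ≠ 0) : ‖q ^ m‖ < 1 := by
  rw [norm_pow]; exact pow_lt_one₀ (norm_nonneg q) hq hm

theorem qPochInf_eq_prod_residueProd (hq : ‖q‖ < 1) {m k : ℕ} (h : m * k = 28) (a : ℕ) :
    qPochInf (q ^ a) (q ^ m) = ∏ i ∈ Finset.range k, residueProd q (a + m * i) := by
  have hm : m ≠ 0 := by rintro rfl; omega
  have hk : 0 < k := by rcases k.eq_zero_or_pos with rfl | hk <;> omega
  rw [qPochInf_eq_prod _ (norm_pow_lt_one hq hm) hk, ← pow_mul, h]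
  exact Finset.prod_congr rfl fun i _ => by rw [residueProd, ← pow_mul, ← pow_add]

theorem J_eq_prod (hq : ‖q‖ < 1) {m k : ℕ} (h : m * k = 28) :
    J q m = ∏ i ∈ Finset.range k, residueProd q (m + m * i) :=
  qPochInf_eq_prod_residueProd hq h m

theorem J₂_twenty_eight {q : ℂ} {a b : ℕ} (hab : a + b = 28) :
    J₂ q a 28 = residueProd q a * residueProd q b * J q 28 := by
  rw [J₂, show (((28 : ℕ) : ℤ) - a) = (b : ℕ) by omega, zpow_natCast, zpow_natCast]
  rfl

theorem J₂_fourteen (hq : ‖q‖ < 1) {a b : ℕ} (hab : a + b = 14) :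
    J₂ q a 14 = residueProd q a * residueProd q (a + 14) *
      (residueProd q b * residueProd q (b + 14)) * J q 14 := by
  rw [J₂, show (((14 : ℕ) : ℤ) - a) = (b : ℕ) by omega, zpow_natCast, zpow_natCast,
    qPochInf_eq_prod_residueProd hq (k := 2) rfl a, qPochInf_eq_prod_residueProd hq (k := 2) rfl b]
  simp only [Finset.prod_range_succ, Finset.prod_range_zero, mul_zero, add_zero, mul_one]
  rw [J]
  ring

theorem J₂_neg_mul (hq : ‖q‖ < 1) {a b : ℕ} (ha : Odd a) (hab : a + b = 14) :
    J₂ (-q) a 14 * J₂ q a 14 = residueProd q (2 * a) * residueProd q (2 * b) * J q 14 ^ 2 := by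
  have hb : Odd b := by
    rw [← Nat.not_even_iff_odd]
    intro h
    have h1 : Odd 14 := hab ▸ ha.add_even h
    exact absurd h1 (by decide)
  have h14 := norm_pow_lt_one hq (m := 14) (by norm_num)
  have key : ∀ c : ℕ, qPochInf (q ^ c) (q ^ 14) * qPochInf (-q ^ c) (q ^ 14)
      = residueProd q (2 * c) := fun c => by
    rw [qPochInf_mul_neg _ h14, residueProd, ← pow_mul, ← pow_mul, mul_comm c]
  rw [J₂, J₂, show (((14 : ℕ) : ℤ) - a) = (b : ℕ) by omega, zpow_natCast, zpow_natCast,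
    zpow_natCast, zpow_natCast, ha.neg_pow, hb.neg_pow, (by decide : Even 14).neg_pow,
    ← key a, ← key b, J]
  ring

/-- For odd `a` the sign of `q` changes the sign of the factors `q^a`, `q^{14 - a}` only, and
`(x; q^14)_∞ (-x; q^14)_∞ = (x²; q^28)_∞`. -/
theorem quintuple_neg_mul (hq : ‖q‖ < 1) {a b : ℕ} (ha : Odd a) (hab : a + b = 14) :
    quintuple (-q) a * (J₂ q a 14 * J q 28)
      = residueProd q (2 * a) * residueProd q (2 * b) * J q 14 ^ 2 * J₂ q (14 - 2 * a) 28 := by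
  have h28 := J_ne_zero hq (m := 28) (by norm_num)
  have h1 : J (-q) 28 = J q 28 := by
    rw [J, J, (by decide : Even 28).neg_pow]
  have h2 : J₂ (-q) (14 - 2 * a) 28 = J₂ q (14 - 2 * a) 28 := by
    rw [J₂, J₂, (by decide : Even 28).neg_pow, Even.neg_zpow ⟨7 - a, by omega⟩,
      Even.neg_zpow ⟨7 + a, by push_cast; ring⟩]
  rw [← J₂_neg_mul hq ha hab, quintuple, h1, h2]
  field_simp

theorem qPochInf_neg_sq (hq : ‖q‖ < 1) : qPochInf (-q ^ 2) (q ^ 2) = J q 4 / J q 2 := by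
  rw [eq_div_iff (J_ne_zero hq two_ne_zero), J, J, mul_comm,
    qPochInf_mul_neg _ (norm_sq_lt_one hq), ← pow_mul]

theorem qPochInf_self_sq (hq : ‖q‖ < 1) : qPochInf q (q ^ 2) = J q 1 / J q 2 := by
  rw [eq_div_iff (J_ne_zero hq two_ne_zero), J, J, pow_one,
    qPochInf_eq_prod q hq (m := 2) (by norm_num)]
  simp only [Finset.prod_range_succ, Finset.prod_range_zero, pow_zero, mul_one, one_mul, pow_one,
    ← sq]

theorem qPochInf_neg_self_sq (hq : ‖q‖ < 1) :
    qPochInf (-q) (q ^ 2) = J q 2 ^ 2 / (J q 1 * J q 4) := by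
  have h1 := J_ne_zero hq one_ne_zero
  have h2 := J_ne_zero hq two_ne_zero
  have h4 := J_ne_zero hq four_ne_zero
  have e1 := qPochInf_mul_neg q (norm_sq_lt_one hq)
  have e2 := qPochInf_self_sq (norm_sq_lt_one hq)
  have e3 : J (q ^ 2) 1 = J q 2 := by simp [J]
  have e4 : J (q ^ 2) 2 = J q 4 := by rw [J, J, ← pow_mul]
  rw [qPochInf_self_sq hq, e2, e3, e4] at e1
  rw [eq_div_iff (mul_ne_zero h1 h4)]
  field_simp at e1
  linear_combination e1

theorem oddProduct_eq (hq : ‖q‖ < 1) (a : ℤ) :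
    oddProduct q a = J q 2 ^ 12 / (J q 1 ^ 6 * J q 4 ^ 6) * quintuple q a := by
  rw [oddProduct, qPochInf_neg_self_sq hq]; ring

theorem oddProduct_neg_eq (hq : ‖q‖ < 1) (a : ℤ) :
    oddProduct (-q) a = J q 1 ^ 6 / J q 2 ^ 6 * quintuple (-q) a := by
  rw [oddProduct, neg_neg, neg_sq, qPochInf_self_sq hq, div_pow]

theorem evenProduct_eq (hq : ‖q‖ < 1) (a : ℤ) :
    evenProduct q a = J q 4 ^ 6 / J q 2 ^ 6 * quintuple q a := by
  rw [evenProduct, qPochInf_neg_sq hq, div_pow]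

theorem J₂_ne_zero (hq : ‖q‖ < 1) {m a b : ℕ} (hab : a + b = m) (ha : a ≠ 0)
    (hb : b ≠ 0) :
    J₂ q a m ≠ 0 := by
  have hm : m ≠ 0 := by omega
  have h := norm_pow_lt_one hq hm
  rw [J₂, show ((m : ℤ) - a) = (b : ℕ) by omega, zpow_natCast, zpow_natCast]
  exact mul_ne_zero (mul_ne_zero (qPochInf_ne_zero_of_norm_lt (norm_pow_lt_one hq ha) h)
    (qPochInf_ne_zero_of_norm_lt (norm_pow_lt_one hq hb) h)) (qPochInf_ne_zero_of_norm_lt h h)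

theorem quintuple_two_mul (hq : ‖q‖ < 1) :
    quintuple q 2 * (J₂ q 4 28 * J₂ q 6 28 * J₂ q 8 28) = J q 2 * J q 28 ^ 3 := by
  have h28 := J_ne_zero hq (m := 28) (by norm_num)
  have e0 := J₂_fourteen hq (a := 2) (b := 12) rfl
  have e1 := J₂_twenty_eight (q := q) (a := 10) (b := 18) rfl
  have e2 := J₂_twenty_eight (q := q) (a := 4) (b := 24) rfl
  have e3 := J₂_twenty_eight (q := q) (a := 6) (b := 22) rfl
  have e4 := J₂_twenty_eight (q := q) (a := 8) (b := 20) rfl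
  have e5 := J_eq_prod hq (m := 2) (k := 14) rfl
  have e6 := J_eq_prod hq (m := 14) (k := 2) rfl
  have e7 := J_eq_prod hq (m := 28) (k := 1) rfl
  simp only [Nat.cast_ofNat, Finset.prod_range_succ, Finset.prod_range_zero]
    at e0 e1 e2 e3 e4 e5 e6 e7
  rw [quintuple, div_mul_eq_mul_div, div_eq_iff h28, show (14 - 2 * 2 : ℤ) = 10 by norm_num,
    e0, e1, e2, e3, e4, e5, e6, e7]
  ring

theorem quintuple_four_mul (hq : ‖q‖ < 1) :
    quintuple q 4 * (J₂ q 2 28 * J₂ q 8 28 * J₂ q 12 28) = J q 2 * J q 28 ^ 3 := by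
  have h28 := J_ne_zero hq (m := 28) (by norm_num)
  have e0 := J₂_fourteen hq (a := 4) (b := 10) rfl
  have e1 := J₂_twenty_eight (q := q) (a := 6) (b := 22) rfl
  have e2 := J₂_twenty_eight (q := q) (a := 2) (b := 26) rfl
  have e3 := J₂_twenty_eight (q := q) (a := 8) (b := 20) rfl
  have e4 := J₂_twenty_eight (q := q) (a := 12) (b := 16) rfl
  have e5 := J_eq_prod hq (m := 2) (k := 14) rfl
  have e6 := J_eq_prod hq (m := 14) (k := 2) rfl
  have e7 := J_eq_prod hq (m := 28) (k := 1) rfl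
  simp only [Nat.cast_ofNat, Finset.prod_range_succ, Finset.prod_range_zero]
    at e0 e1 e2 e3 e4 e5 e6 e7
  rw [quintuple, div_mul_eq_mul_div, div_eq_iff h28, show (14 - 2 * 4 : ℤ) = 6 by norm_num,
    e0, e1, e2, e3, e4, e5, e6, e7]
  ring

theorem quintuple_six_mul (hq : ‖q‖ < 1) :
    quintuple q 6 * (J₂ q 4 28 * J₂ q 10 28 * J₂ q 12 28) = J q 2 * J q 28 ^ 3 := by
  have h28 := J_ne_zero hq (m := 28) (by norm_num)
  have e0 := J₂_fourteen hq (a := 6) (b := 8) rfl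
  have e1 := J₂_twenty_eight (q := q) (a := 2) (b := 26) rfl
  have e2 := J₂_twenty_eight (q := q) (a := 4) (b := 24) rfl
  have e3 := J₂_twenty_eight (q := q) (a := 10) (b := 18) rfl
  have e4 := J₂_twenty_eight (q := q) (a := 12) (b := 16) rfl
  have e5 := J_eq_prod hq (m := 2) (k := 14) rfl
  have e6 := J_eq_prod hq (m := 14) (k := 2) rfl
  have e7 := J_eq_prod hq (m := 28) (k := 1) rfl
  simp only [Nat.cast_ofNat, Finset.prod_range_succ, Finset.prod_range_zero]
    at e0 e1 e2 e3 e4 e5 e6 e7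
  rw [quintuple, div_mul_eq_mul_div, div_eq_iff h28, show (14 - 2 * 6 : ℤ) = 2 by norm_num,
    e0, e1, e2, e3, e4, e5, e6, e7]
  ring

theorem quintuple_three_mul (hq : ‖q‖ < 1) :
    quintuple q 3 * (J q 28 * J₂ q 4 28 * J₂ q 12 28)
      = J q 4 * J q 14 * J₂ q 3 28 * J₂ q 11 28 := by
  have h28 := J_ne_zero hq (m := 28) (by norm_num)
  have e0 := J₂_fourteen hq (a := 3) (b := 11) rfl
  have e1 := J₂_twenty_eight (q := q) (a := 8) (b := 20) rfl
  have e2 := J₂_twenty_eight (q := q) (a := 4) (b := 24) rfl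
  have e3 := J₂_twenty_eight (q := q) (a := 12) (b := 16) rfl
  have e4 := J₂_twenty_eight (q := q) (a := 3) (b := 25) rfl
  have e5 := J₂_twenty_eight (q := q) (a := 11) (b := 17) rfl
  have e6 := J_eq_prod hq (m := 4) (k := 7) rfl
  have e7 := J_eq_prod hq (m := 28) (k := 1) rfl
  simp only [Nat.cast_ofNat, Finset.prod_range_succ, Finset.prod_range_zero]
    at e0 e1 e2 e3 e4 e5 e6 e7
  rw [quintuple, div_mul_eq_mul_div, div_eq_iff h28, show (14 - 2 * 3 : ℤ) = 8 by norm_num,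
    e0, e1, e2, e3, e4, e5, e6, e7]
  ring

theorem quintuple_neg_five_mul (hq : ‖q‖ < 1) :
    J q 1 * quintuple (-q) 5 * (J₂ q 2 14 * J₂ q 6 14 * J q 14)
      = J q 2 ^ 2 * J q 7 * J₂ q 1 14 * J₂ q 3 14 := by
  have h0 : J₂ q 5 14 * J q 28 ≠ 0 := mul_ne_zero
    (by exact_mod_cast J₂_ne_zero hq (m := 14) (a := 5) (b := 9) rfl (by norm_num) (by norm_num))
    (J_ne_zero hq (by norm_num))
  have h1 := quintuple_neg_mul hq (a := 5) (b := 9) (by decide) rfl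
  have e0 := J₂_twenty_eight (q := q) (a := 4) (b := 24) rfl
  have e1 := J₂_fourteen hq (a := 2) (b := 12) rfl
  have e2 := J₂_fourteen hq (a := 6) (b := 8) rfl
  have e3 := J₂_fourteen hq (a := 1) (b := 13) rfl
  have e4 := J₂_fourteen hq (a := 3) (b := 11) rfl
  have e5 := J₂_fourteen hq (a := 5) (b := 9) rfl
  have e6 := J_eq_prod hq (m := 1) (k := 28) rfl
  have e7 := J_eq_prod hq (m := 2) (k := 14) rfl
  have e8 := J_eq_prod hq (m := 7) (k := 4) rfl
  have e9 := J_eq_prod hq (m := 14) (k := 2) rfl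
  simp only [Nat.cast_ofNat, Nat.cast_one, Finset.prod_range_succ, Finset.prod_range_zero]
    at h0 h1 e0 e1 e2 e3 e4 e5 e6 e7 e8 e9
  refine mul_right_cancel₀ h0 ?_
  rw [show J q 1 * quintuple (-q) 5 * (J₂ q 2 14 * J₂ q 6 14 * J q 14) * (J₂ q 5 14 * J q 28)
    = quintuple (-q) 5 * (J₂ q 5 14 * J q 28) * (J q 1 * (J₂ q 2 14 * J₂ q 6 14 * J q 14)) by ring,
    h1, show (14 - 2 * 5 : ℤ) = 4 by norm_num, e0, e1, e2, e3, e4, e5, e6, e7, e8, e9]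
  ring

theorem quintuple_neg_one_mul (hq : ‖q‖ < 1) :
    J q 1 * quintuple (-q) 1 * (J₂ q 4 14 * J₂ q 6 14 * J q 14)
      = J q 2 ^ 2 * J q 7 * J₂ q 3 14 * J₂ q 5 14 := by
  have h0 : J₂ q 1 14 * J q 28 ≠ 0 := mul_ne_zero
    (by exact_mod_cast J₂_ne_zero hq (m := 14) (a := 1) (b := 13) rfl (by norm_num) (by norm_num))
    (J_ne_zero hq (by norm_num))
  have h1 := quintuple_neg_mul hq (a := 1) (b := 13) (by decide) rfl
  have e0 := J₂_twenty_eight (q := q) (a := 12) (b := 16) rfl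
  have e1 := J₂_fourteen hq (a := 4) (b := 10) rfl
  have e2 := J₂_fourteen hq (a := 6) (b := 8) rfl
  have e3 := J₂_fourteen hq (a := 3) (b := 11) rfl
  have e4 := J₂_fourteen hq (a := 5) (b := 9) rfl
  have e5 := J₂_fourteen hq (a := 1) (b := 13) rfl
  have e6 := J_eq_prod hq (m := 1) (k := 28) rfl
  have e7 := J_eq_prod hq (m := 2) (k := 14) rfl
  have e8 := J_eq_prod hq (m := 7) (k := 4) rfl
  have e9 := J_eq_prod hq (m := 14) (k := 2) rfl
  simp only [Nat.cast_ofNat, Nat.cast_one, Finset.prod_range_succ, Finset.prod_range_zero]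
    at h0 h1 e0 e1 e2 e3 e4 e5 e6 e7 e8 e9
  refine mul_right_cancel₀ h0 ?_
  rw [show J q 1 * quintuple (-q) 1 * (J₂ q 4 14 * J₂ q 6 14 * J q 14) * (J₂ q 1 14 * J q 28)
    = quintuple (-q) 1 * (J₂ q 1 14 * J q 28) * (J q 1 * (J₂ q 4 14 * J₂ q 6 14 * J q 14)) by ring,
    h1, show (14 - 2 * 1 : ℤ) = 12 by norm_num, e0, e1, e2, e3, e4, e5, e6, e7, e8, e9]
  ring

theorem quintuple_neg_three_mul (hq : ‖q‖ < 1) :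
    J q 1 * quintuple (-q) 3 * (J₂ q 2 14 * J₂ q 4 14 * J q 14)
      = J q 2 ^ 2 * J q 7 * J₂ q 1 14 * J₂ q 5 14 := by
  have h0 : J₂ q 3 14 * J q 28 ≠ 0 := mul_ne_zero
    (by exact_mod_cast J₂_ne_zero hq (m := 14) (a := 3) (b := 11) rfl (by norm_num) (by norm_num))
    (J_ne_zero hq (by norm_num))
  have h1 := quintuple_neg_mul hq (a := 3) (b := 11) (by decide) rfl
  have e0 := J₂_twenty_eight (q := q) (a := 8) (b := 20) rfl
  have e1 := J₂_fourteen hq (a := 2) (b := 12) rfl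
  have e2 := J₂_fourteen hq (a := 4) (b := 10) rfl
  have e3 := J₂_fourteen hq (a := 1) (b := 13) rfl
  have e4 := J₂_fourteen hq (a := 5) (b := 9) rfl
  have e5 := J₂_fourteen hq (a := 3) (b := 11) rfl
  have e6 := J_eq_prod hq (m := 1) (k := 28) rfl
  have e7 := J_eq_prod hq (m := 2) (k := 14) rfl
  have e8 := J_eq_prod hq (m := 7) (k := 4) rfl
  have e9 := J_eq_prod hq (m := 14) (k := 2) rfl
  simp only [Nat.cast_ofNat, Nat.cast_one, Finset.prod_range_succ, Finset.prod_range_zero]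
    at h0 h1 e0 e1 e2 e3 e4 e5 e6 e7 e8 e9
  refine mul_right_cancel₀ h0 ?_
  rw [show J q 1 * quintuple (-q) 3 * (J₂ q 2 14 * J₂ q 4 14 * J q 14) * (J₂ q 3 14 * J q 28)
    = quintuple (-q) 3 * (J₂ q 3 14 * J q 28) * (J q 1 * (J₂ q 2 14 * J₂ q 4 14 * J q 14)) by ring,
    h1, show (14 - 2 * 3 : ℤ) = 8 by norm_num, e0, e1, e2, e3, e4, e5, e6, e7, e8, e9]
  ring

theorem evenProduct_div (hq : ‖q‖ < 1) {a : ℤ} {D : ℂ} (hD : D ≠ 0)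
    (h : quintuple q a * D = J q 2 * J q 28 ^ 3) :
    evenProduct q a / J q 2 = J q 4 ^ 6 * J q 28 ^ 3 / (J q 2 ^ 6 * D) := by
  have h2 := J_ne_zero hq two_ne_zero
  rw [evenProduct_eq hq, eq_div_of_mul_eq hD h]
  field_simp

theorem oddProduct_neg_div (hq : ‖q‖ < 1) {a : ℤ} {D N : ℂ} (hD : D ≠ 0)
    (h : J q 1 * quintuple (-q) a * D = J q 2 ^ 2 * N) :
    oddProduct (-q) a / J q 2 = J q 1 ^ 5 * N / (J q 2 ^ 5 * D) := by
  have h1 := J_ne_zero hq one_ne_zero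
  have h2 := J_ne_zero hq two_ne_zero
  rw [oddProduct_neg_eq hq, div_eq_div_iff h2 (mul_ne_zero (pow_ne_zero 5 h2) hD)]
  field_simp
  linear_combination h

theorem oddProduct_div (hq : ‖q‖ < 1) (a : ℤ) :
    oddProduct q a / J q 2 = J q 2 ^ 11 / (J q 1 ^ 6 * J q 4 ^ 6) * quintuple q a := by
  have h2 := J_ne_zero hq two_ne_zero
  rw [oddProduct_eq hq]
  field_simp

end

end NahmA3

open NahmA3

theorem theorem4p1 (q : ℂ) (hq0 : q ≠ 0) (hq1 : ‖q‖ < 1) :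
    HasSum (NahmA3.nahmTerm q (-2) 2 0)
      (4 * ((NahmA3.J q 4 ^ 6 * NahmA3.J q 28 ^ 3) /
          (NahmA3.J q 2 ^ 6 * NahmA3.J₂ q 4 28 * NahmA3.J₂ q 6 28 * NahmA3.J₂ q 8 28))
        - 1 / 2 * ((NahmA3.J q 1 ^ 5 * NahmA3.J q 7 * NahmA3.J₂ q 1 14 * NahmA3.J₂ q 3 14) /
          (NahmA3.J q 2 ^ 5 * NahmA3.J₂ q 2 14 * NahmA3.J₂ q 6 14 * NahmA3.J q 14))
        - 1 / 2 * ((NahmA3.J q 2 ^ 11 * NahmA3.J₂ q 5 14 * NahmA3.J₂ q 4 28) /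
          (NahmA3.J q 1 ^ 6 * NahmA3.J q 4 ^ 6 * NahmA3.J q 28))) ∧
    HasSum (NahmA3.nahmTerm q 0 0 0)
      (1 / 2 * ((NahmA3.J q 2 ^ 11 * NahmA3.J₂ q 1 14 * NahmA3.J₂ q 12 28) /
          (NahmA3.J q 1 ^ 6 * NahmA3.J q 4 ^ 6 * NahmA3.J q 28))
        + 1 / 2 * ((NahmA3.J q 1 ^ 5 * NahmA3.J q 7 * NahmA3.J₂ q 3 14 * NahmA3.J₂ q 5 14) /
          (NahmA3.J q 2 ^ 5 * NahmA3.J₂ q 4 14 * NahmA3.J₂ q 6 14 * NahmA3.J q 14))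
        - 4 * q ^ 2 * ((NahmA3.J q 4 ^ 6 * NahmA3.J q 28 ^ 3) /
          (NahmA3.J q 2 ^ 6 * NahmA3.J₂ q 4 28 * NahmA3.J₂ q 10 28 * NahmA3.J₂ q 12 28))) ∧
    HasSum (NahmA3.nahmTerm q (-2) 2 2)
      (1 / (2 * q) * ((NahmA3.J q 2 ^ 11 * NahmA3.J q 14 * NahmA3.J₂ q 3 28 * NahmA3.J₂ q 11 28) /
          (NahmA3.J q 1 ^ 6 * NahmA3.J q 4 ^ 5 * NahmA3.J q 28 *
            NahmA3.J₂ q 4 28 * NahmA3.J₂ q 12 28))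
        - 1 / (2 * q) * ((NahmA3.J q 1 ^ 5 * NahmA3.J q 7 * NahmA3.J₂ q 1 14 * NahmA3.J₂ q 5 14) /
          (NahmA3.J q 2 ^ 5 * NahmA3.J₂ q 2 14 * NahmA3.J₂ q 4 14 * NahmA3.J q 14))
        - 4 * ((NahmA3.J q 4 ^ 6 * NahmA3.J q 28 ^ 3) /
          (NahmA3.J q 2 ^ 6 * NahmA3.J₂ q 2 28 * NahmA3.J₂ q 8 28 * NahmA3.J₂ q 12 28))) := by
  have n28 : ∀ a b : ℕ, a + b = 28 → a ≠ 0 → b ≠ 0 → J₂ q a 28 ≠ 0 := fun a b => J₂_ne_zero hq1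
  have n14 : ∀ a b : ℕ, a + b = 14 → a ≠ 0 → b ≠ 0 → J₂ q a 14 ≠ 0 := fun a b => J₂_ne_zero hq1
  have m2 : J₂ q 2 28 ≠ 0 := mod_cast n28 2 26 rfl (by norm_num) (by norm_num)
  have m4 : J₂ q 4 28 ≠ 0 := mod_cast n28 4 24 rfl (by norm_num) (by norm_num)
  have m6 : J₂ q 6 28 ≠ 0 := mod_cast n28 6 22 rfl (by norm_num) (by norm_num)
  have m8 : J₂ q 8 28 ≠ 0 := mod_cast n28 8 20 rfl (by norm_num) (by norm_num)
  have m10 : J₂ q 10 28 ≠ 0 := mod_cast n28 10 18 rfl (by norm_num) (by norm_num)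
  have m12 : J₂ q 12 28 ≠ 0 := mod_cast n28 12 16 rfl (by norm_num) (by norm_num)
  have l2 : J₂ q 2 14 ≠ 0 := mod_cast n14 2 12 rfl (by norm_num) (by norm_num)
  have l4 : J₂ q 4 14 ≠ 0 := mod_cast n14 4 10 rfl (by norm_num) (by norm_num)
  have l6 : J₂ q 6 14 ≠ 0 := mod_cast n14 6 8 rfl (by norm_num) (by norm_num)
  have j1 := J_ne_zero hq1 one_ne_zero
  have j4 := J_ne_zero hq1 four_ne_zero
  have j14 := J_ne_zero hq1 (m := 14) (by norm_num)
  have j28 := J_ne_zero hq1 (m := 28) (by norm_num)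
  have hJ : qPochInf (q ^ 2) (q ^ 2) = J q 2 := rfl
  refine ⟨?_, ?_, ?_⟩
  · have h := hasSum_nahmTerm_one_one hq0 hq1
    have e1 := evenProduct_div hq1 (mul_ne_zero (mul_ne_zero m4 m6) m8) (quintuple_two_mul hq1)
    have e2 := oddProduct_neg_div hq1 (mul_ne_zero (mul_ne_zero l2 l6) j14)
      (by simpa only [mul_assoc] using quintuple_neg_five_mul hq1)
    have e3 := oddProduct_div hq1 5
    rw [hJ, sub_div, sub_div, mul_div_assoc, mul_div_assoc, mul_div_assoc, e1, e2, e3, quintuple,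
      show (14 - 2 * 5 : ℤ) = 4 by norm_num] at h
    convert h using 1
    ring
  · have h := hasSum_nahmTerm_zero_zero hq0 hq1
    have e1 := evenProduct_div hq1 (mul_ne_zero (mul_ne_zero m4 m10) m12) (quintuple_six_mul hq1)
    have e2 := oddProduct_neg_div hq1 (mul_ne_zero (mul_ne_zero l4 l6) j14)
      (by simpa only [mul_assoc] using quintuple_neg_one_mul hq1)
    have e3 := oddProduct_div hq1 1
    rw [hJ, sub_div, add_div, mul_div_assoc, mul_div_assoc, mul_div_assoc, e1, e2, e3, quintuple,
      show (14 - 2 * 1 : ℤ) = 12 by norm_num] at h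
    convert h using 1
    ring
  · have h := hasSum_nahmTerm_zero_two hq0 hq1
    have e1 := evenProduct_div hq1 (mul_ne_zero (mul_ne_zero m2 m8) m12) (quintuple_four_mul hq1)
    have e2 := oddProduct_neg_div hq1 (mul_ne_zero (mul_ne_zero l2 l4) j14)
      (by simpa only [mul_assoc] using quintuple_neg_three_mul hq1)
    have e3 := oddProduct_div hq1 3
    rw [hJ, sub_div, sub_div, mul_div_assoc, mul_div_assoc, mul_div_assoc, e1, e2, e3,
      eq_div_of_mul_eq (mul_ne_zero (mul_ne_zero j28 m4) m12) (quintuple_three_mul hq1)] at h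
    convert h using 1
    field_simp
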